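/- For a finite simple graph $\Gamma$ with distinct vertex degrees $k_1>\dots>k_r$, where exactly $n_i$ vertices have degree $k_i$, the valency-array of $\Gamma$ is $(n_1,\dots,n_r;k_1,\dots,k_r)$; the spectrum of $\Gamma$ is the multiset of eigenvalues of its adjacency matrix, where $[\theta]^m$ denotes the eigenvalue $\theta$ with multiplicity $m$. Up to isomorphism, there are exactly two finite simple graphs with valency-array $(18,9,9;24,14,8)$ and spectrum $\{[20]^1,[2]^{17},[-3]^{18}\}$. -/

import Mathlib

open Classical in
/-- The distinct valencies `k₁ > ⋯ > k_r` of a finite graph, in decreasing order. -/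
noncomputable def SimpleGraph.valencies {V : Type*} [Fintype V] (G : SimpleGraph V) : List ℕ :=
  (Finset.univ.image fun v => G.degree v).sort (· ≥ ·)

open Classical in
/-- The valency-array `(n₁, …, n_r; k₁, …, k_r)` of a finite graph: `k₁ > ⋯ > k_r` are its distinct
valencies and `n_i` is the number of vertices of valency `k_i`. -/
noncomputable def SimpleGraph.valencyArray {V : Type*} [Fintype V] (G : SimpleGraph V) :
    List ℕ × List ℕ :=
  (G.valencies.map fun k => (Finset.univ.filter fun v => G.degree v = k).card, G.valencies)

open Classical in
/-- The spectrum of a finite graph: the multiset of eigenvalues of its real adjacency matrix,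
counted with multiplicity (the matrix is symmetric, so all roots of its characteristic polynomial
are real and algebraic and geometric multiplicities agree). -/
noncomputable def SimpleGraph.adjSpectrum {V : Type*} [Fintype V] (G : SimpleGraph V) :
    Multiset ℝ :=
  (G.adjMatrix ℝ).charpoly.roots

/-- The graph has valency-array `(18,9,9; 24,14,8)` and spectrum `{[20]¹, [2]¹⁷, [-3]¹⁸}`. -/
def SimpleGraph.HasPrescribedArrayAndSpectrum {V : Type*} [Fintype V] (G : SimpleGraph V) : Prop :=
  G.valencyArray = ([18, 9, 9], [24, 14, 8]) ∧
    G.adjSpectrum =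
      Multiset.replicate 1 20 + Multiset.replicate 17 2 + Multiset.replicate 18 (-3)

/-!
The spectrum yields a Perron vector `α`, with values `3`, `2`, `1` at the vertices of degree `24`,
`14`, `8`, such that `A² + A = 6I + 2ααᵀ`. This forces that vertices of degrees `14` and `8` are
never adjacent, and that the subgraph `F` on these 18 vertices and the complement `K` of the
subgraph on the other 18 are both 2-regular. Up to complementing rows, the adjacencies between the
two halves form a 0/1 matrix `N` such that `NNᵀ = 6I + 2J - F - F²`, likewise for `NᵀN` and `K`,
and `FN = NK`.

The last equation is a discrete wave equation: along a pair of cycles of `F` and `K` a block of `N`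
is a function of `i + j` plus one of `i - j`. With the Gram equations it leaves only cycles of
length `3` in `F` and `K`, or two hexagons and two triangles in each. The blocks that involve a
triangle are then permutation matrices and those between hexagons are circulants, and comparing
inner products of rows leaves one matrix in each case. The two graphs differ in whether every
vertex of degree `8` lies in a triangle of such vertices.
-/

section Spectral

open Matrix

variable {V : Type*} [Fintype V] [DecidableEq V] {A : Matrix V V ℝ}

theorem eq_of_mulVec_eigenvectorBasis (hA : A.IsHermitian)
    {B C : Matrix V V ℝ}
    (h : ∀ i, B *ᵥ (hA.eigenvectorBasis i).ofLp = C *ᵥ (hA.eigenvectorBasis i).ofLp) : B = C := by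
  apply (toEuclideanLin (𝕜 := ℝ) (m := V) (n := V)).injective
  refine hA.eigenvectorBasis.toBasis.ext fun i => ?_
  simp [toLpLin_apply, h]

theorem dotProduct_eigenvectorBasis (hA : A.IsHermitian) (i j : V) :
    (hA.eigenvectorBasis i).ofLp ⬝ᵥ (hA.eigenvectorBasis j).ofLp = if i = j then 1 else 0 := by
  have h := orthonormal_iff_ite.1 hA.eigenvectorBasis.orthonormal i j
  rw [← h, EuclideanSpace.inner_eq_star_dotProduct, star_trivial, dotProduct_comm]

theorem sub_mul_sub_mulVec_eigenvectorBasis (hA : A.IsHermitian) (a b : ℝ) (i : V) :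
    ((A - a • 1) * (A - b • 1)) *ᵥ (hA.eigenvectorBasis i).ofLp =
      ((hA.eigenvalues i - a) * (hA.eigenvalues i - b)) • (hA.eigenvectorBasis i).ofLp := by
  simp only [← mulVec_mulVec, sub_mulVec, mulVec_sub, smul_mulVec, one_mulVec, mulVec_smul,
    hA.mulVec_eigenvectorBasis]
  module

theorem exists_rank_one_of_charpoly_roots (hA : A.IsHermitian) {θ a b : ℝ} {m n : ℕ}
    (hθa : θ ≠ a) (hθb : θ ≠ b)
    (h : A.charpoly.roots =
      Multiset.replicate 1 θ + Multiset.replicate m a + Multiset.replicate n b) :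
    ∃ v : V → ℝ, A *ᵥ v = θ • v ∧
      (A - a • 1) * (A - b • 1) = ((θ - a) * (θ - b)) • vecMulVec v v := by
  have hroots : Finset.univ.val.map hA.eigenvalues =
      Multiset.replicate 1 θ + Multiset.replicate m a + Multiset.replicate n b := by
    rw [← h, hA.roots_charpoly_eq_eigenvalues]; rfl
  have hsimple : (Finset.univ.filter fun i => θ = hA.eigenvalues i).card = 1 := by
    have hcount := congrArg (Multiset.count θ) hroots
    simp only [Multiset.count_map, Multiset.count_add, Multiset.count_replicate, if_neg hθa.symm,
      if_neg hθb.symm] at hcount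
    exact hcount
  obtain ⟨i₀, hi₀⟩ := Finset.card_eq_one.1 hsimple
  have hi₀' (i) : θ = hA.eigenvalues i ↔ i = i₀ := by
    simpa using Finset.ext_iff.1 hi₀ i
  have hother (i) (hi : i ≠ i₀) : hA.eigenvalues i = a ∨ hA.eigenvalues i = b := by
    have hmem : hA.eigenvalues i ∈ Finset.univ.val.map hA.eigenvalues :=
      Multiset.mem_map_of_mem _ (Finset.mem_univ i)
    have hne := fun h => hi ((hi₀' i).1 h)
    simp only [hroots, Multiset.mem_add, Multiset.mem_replicate] at hmem
    grind
  refine ⟨(hA.eigenvectorBasis i₀).ofLp, ?_, eq_of_mulVec_eigenvectorBasis hA fun i => ?_⟩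
  · rw [hA.mulVec_eigenvectorBasis, ← (hi₀' i₀).2 rfl]
  · rw [sub_mul_sub_mulVec_eigenvectorBasis, smul_mulVec, vecMulVec_mulVec,
      dotProduct_eigenvectorBasis]
    rcases eq_or_ne i i₀ with rfl | hi
    · simp [← (hi₀' i).2 rfl]
    · rcases hother i hi with h | h <;> simp [h, hi.symm]

theorem eigenvalues_mem_of_rank_one (hA : A.IsHermitian) {θ a b c : ℝ} {u : V → ℝ}
    (hu : A *ᵥ u = θ • u) (h : (A - a • 1) * (A - b • 1) = c • vecMulVec u u) (i : V) :
    hA.eigenvalues i = θ ∨ hA.eigenvalues i = a ∨ hA.eigenvalues i = b := by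
  set v := (hA.eigenvectorBasis i).ofLp with hv
  have hAv : A *ᵥ v = hA.eigenvalues i • v := hA.mulVec_eigenvectorBasis i
  have hv0 : v ≠ 0 := fun h0 => by
    simpa [← hv, h0] using dotProduct_eigenvectorBasis hA i i
  have horth : (θ - hA.eigenvalues i) * (u ⬝ᵥ v) = 0 := by
    have hself : u ⬝ᵥ (A *ᵥ v) = (A *ᵥ u) ⬝ᵥ v := by
      rw [dotProduct_mulVec, ← mulVec_transpose, ← conjTranspose_eq_transpose_of_trivial, hA.eq]
    rw [hAv, hu, dotProduct_smul, smul_dotProduct, smul_eq_mul, smul_eq_mul] at hself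
    linear_combination -hself
  rcases mul_eq_zero.1 horth with hθ | huv
  · exact .inl (sub_eq_zero.1 hθ).symm
  · have hker : ((hA.eigenvalues i - a) * (hA.eigenvalues i - b)) • v = 0 := by
      rw [hv, ← sub_mul_sub_mulVec_eigenvectorBasis hA, h, smul_mulVec, vecMulVec_mulVec, huv]
      simp
    rcases mul_eq_zero.1 ((smul_eq_zero.1 hker).resolve_right hv0) with h | h
    · exact .inr (.inl (sub_eq_zero.1 h))
    · exact .inr (.inr (sub_eq_zero.1 h))

theorem trace_mul_self_eq_sum_eigenvalues_sq (hA : A.IsHermitian) :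
    (A * A).trace = ∑ i, hA.eigenvalues i ^ 2 := by
  have hU := Unitary.coe_star_mul_self hA.eigenvectorUnitary
  have hspec := hA.spectral_theorem
  rw [Unitary.conjStarAlgAut_apply] at hspec
  set U : Matrix V V ℝ := (hA.eigenvectorUnitary : Matrix V V ℝ)
  calc (A * A).trace = (U * (diagonal hA.eigenvalues * (star U * U) * diagonal hA.eigenvalues) *
        star U).trace := by
        conv_lhs => rw [hspec]
        simp only [Matrix.mul_assoc]; rfl
    _ = ∑ i, hA.eigenvalues i ^ 2 := by
        rw [hU, Matrix.mul_one, diagonal_mul_diagonal, trace_mul_comm, ← Matrix.mul_assoc, hU,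
          Matrix.one_mul, trace_diagonal]
        simp only [sq]

end Spectral

theorem eq_replicate_add_of_power_sums {s : Multiset ℝ} {a b c : ℝ} {k m n : ℕ}
    (hab : a ≠ b) (hac : a ≠ c) (hbc : b ≠ c) (hs : ∀ x ∈ s, x = a ∨ x = b ∨ x = c)
    (h₀ : s.card = k + m + n) (h₁ : s.sum = k * a + m * b + n * c)
    (h₂ : (s.map (· ^ 2)).sum = k * a ^ 2 + m * b ^ 2 + n * c ^ 2) :
    s = Multiset.replicate k a + Multiset.replicate m b + Multiset.replicate n c := by
  obtain ⟨k', m', n', rfl⟩ : ∃ k' m' n' : ℕ,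
      s = Multiset.replicate k' a + Multiset.replicate m' b + Multiset.replicate n' c := by
    refine ⟨s.count a, s.count b, s.count c, Multiset.ext.2 fun x => ?_⟩
    by_cases hx : x ∈ s
    · rcases hs x hx with rfl | rfl | rfl <;>
        simp [Multiset.count_replicate, hab, hac, hbc, hab.symm, hac.symm, hbc.symm]
    · simp only [Multiset.count_add, Multiset.count_replicate, Multiset.count_eq_zero_of_notMem hx]
      split_ifs <;> simp_all
  simp only [Multiset.card_add, Multiset.card_replicate, Multiset.sum_add, Multiset.sum_replicate,
    Multiset.map_add, Multiset.map_replicate, nsmul_eq_mul] at h₀ h₁ h₂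
  have h₀' : (k' + m' + n' : ℝ) = k + m + n := by exact_mod_cast h₀
  have hk : (k' : ℝ) = k := by
    refine sub_eq_zero.1 ((mul_eq_zero.1 ?_).resolve_right
      (mul_ne_zero (sub_ne_zero.2 hab) (sub_ne_zero.2 hac)))
    linear_combination h₂ - (b + c) * h₁ + b * c * h₀'
  have hm : (m' : ℝ) = m := by
    refine sub_eq_zero.1 ((mul_eq_zero.1 ?_).resolve_right (sub_ne_zero.2 hbc))
    linear_combination h₁ - c * h₀' - (a - c) * hk
  obtain rfl : k' = k := by exact_mod_cast hk
  obtain rfl : m' = m := by exact_mod_cast hm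
  obtain rfl : n' = n := by omega
  rfl

open Matrix

section Weights

open Classical

variable {V : Type*}

theorem adjMatrix_nonneg (G : SimpleGraph V) (u v : V) : 0 ≤ G.adjMatrix ℤ u v := by
  rw [SimpleGraph.adjMatrix_apply]; split_ifs <;> simp

theorem adjMatrix_comm (G : SimpleGraph V) (u v : V) : G.adjMatrix ℤ u v = G.adjMatrix ℤ v u := by
  simp only [SimpleGraph.adjMatrix_apply, G.adj_comm]

theorem adjMatrix_real_eq_cast (G : SimpleGraph V) (u v : V) :
    G.adjMatrix ℝ u v = (G.adjMatrix ℤ u v : ℤ) := by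
  simp [SimpleGraph.adjMatrix_apply]

theorem isHermitian_adjMatrix (G : SimpleGraph V) : (G.adjMatrix ℝ).IsHermitian := by
  rw [Matrix.IsHermitian, conjTranspose_eq_transpose_of_trivial]
  exact G.transpose_adjMatrix (α := ℝ)

variable [Fintype V] {G : SimpleGraph V}

/-- The Perron eigenvector of a graph with spectrum `{[20]¹, [2]¹⁷, [-3]¹⁸}`, normalised to take the
values `3`, `2`, `1` on the vertices of valency `24`, `14`, `8`. -/
structure IsPerronWeight (G : SimpleGraph V) (α : V → ℤ) : Prop where
  values : ∀ v, α v = 3 ∨ α v = 2 ∨ α v = 1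
  card_three : {v | α v = 3}.ncard = 18
  card_two : {v | α v = 2}.ncard = 9
  card_one : {v | α v = 1}.ncard = 9
  quad : ∀ u v, (G.adjMatrix ℤ * G.adjMatrix ℤ) u v + G.adjMatrix ℤ u v =
    (if u = v then 6 else 0) + 2 * (α u * α v)
  eig : ∀ u, ∑ w, G.adjMatrix ℤ u w * α w = 20 * α u

theorem adjMatrix_mul_self_apply_self_add (G : SimpleGraph V) (v : V) :
    (G.adjMatrix ℤ * G.adjMatrix ℤ) v v + G.adjMatrix ℤ v v = G.degree v := by
  rw [SimpleGraph.adjMatrix_mul_self_apply_self]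
  simp

theorem IsPerronWeight.degree_eq {α : V → ℤ} (h : IsPerronWeight G α) (v : V) :
    (G.degree v : ℤ) = 6 + 2 * α v ^ 2 := by
  rw [← adjMatrix_mul_self_apply_self_add, h.quad, if_pos rfl, sq]

theorem valencies_eq_of_hasPrescribedArrayAndSpectrum (h : G.HasPrescribedArrayAndSpectrum) :
    G.valencies = [24, 14, 8] :=
  congrArg Prod.snd h.1

theorem degree_eq_of_hasPrescribedArrayAndSpectrum (h : G.HasPrescribedArrayAndSpectrum) (v : V) :
    G.degree v = 24 ∨ G.degree v = 14 ∨ G.degree v = 8 := by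
  have hmem : G.degree v ∈ G.valencies :=
    (Finset.mem_sort _).2 (Finset.mem_image_of_mem _ (Finset.mem_univ v))
  simpa [valencies_eq_of_hasPrescribedArrayAndSpectrum h] using hmem

theorem ncard_degree_of_hasPrescribedArrayAndSpectrum (h : G.HasPrescribedArrayAndSpectrum) :
    {v | G.degree v = 24}.ncard = 18 ∧ {v | G.degree v = 14}.ncard = 9 ∧
      {v | G.degree v = 8}.ncard = 9 := by
  have hfst := congrArg Prod.fst h.1
  simp only [SimpleGraph.valencyArray, valencies_eq_of_hasPrescribedArrayAndSpectrum h,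
    List.map_cons, List.map_nil, List.cons.injEq, and_true] at hfst
  simpa only [Set.ncard_eq_toFinset_card', Set.toFinset_ofPred] using hfst

theorem exists_eigenvector_quadratic (h : G.HasPrescribedArrayAndSpectrum) :
    ∃ w : V → ℝ, (∀ u, ∑ v, (G.adjMatrix ℤ u v : ℝ) * w v = 20 * w u) ∧
      ∀ u v, (((G.adjMatrix ℤ * G.adjMatrix ℤ) u v + G.adjMatrix ℤ u v : ℤ) : ℝ) =
        (if u = v then 6 else 0) + 414 * (w u * w v) := by
  obtain ⟨w, heig, hrank⟩ := exists_rank_one_of_charpoly_roots (isHermitian_adjMatrix G)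
    (by norm_num) (by norm_num) h.2
  refine ⟨w, fun u => ?_, fun u v => ?_⟩
  · simpa [mulVec, dotProduct, adjMatrix_real_eq_cast] using congrFun heig u
  · have huv := congrFun (congrFun hrank u) v
    simp only [sub_mul, mul_sub, Matrix.sub_apply, Matrix.smul_apply, one_mul, smul_mul,
      mul_one, smul_eq_mul, vecMulVec_apply, one_apply, Matrix.mul_smul] at huv
    push_cast
    simp only [mul_apply, ← adjMatrix_real_eq_cast, Int.cast_sum, Int.cast_mul] at huv ⊢
    split_ifs at huv ⊢ <;> linear_combination huv

/-- All entries of `A² + A` are nonnegative, so the eigenvector of `exists_eigenvector_quadratic`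
has constant sign, and the diagonal entries determine it. -/
theorem eigenvector_mul_eq {w : V → ℝ} {α : V → ℤ} (hα : ∀ v, 0 < α v)
    (hdeg : ∀ v, (G.degree v : ℤ) = 6 + 2 * α v ^ 2)
    (hw : ∀ u v, (((G.adjMatrix ℤ * G.adjMatrix ℤ) u v + G.adjMatrix ℤ u v : ℤ) : ℝ) =
      (if u = v then 6 else 0) + 414 * (w u * w v)) (u v : V) :
    207 * (w u * w v) = α u * α v := by
  have hsq (v) : 207 * (w v * w v) = α v * α v := by
    have hv := hw v v
    rw [adjMatrix_mul_self_apply_self_add, hdeg, if_pos rfl] at hv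
    push_cast at hv
    linarith
  rcases eq_or_ne u v with rfl | huv
  · exact hsq u
  have hnonneg : 0 ≤ w u * w v := by
    have hsum : 0 ≤ (G.adjMatrix ℤ * G.adjMatrix ℤ) u v + G.adjMatrix ℤ u v :=
      add_nonneg (Finset.sum_nonneg fun _ _ =>
        mul_nonneg (adjMatrix_nonneg _ _ _) (adjMatrix_nonneg _ _ _)) (adjMatrix_nonneg _ _ _)
    have hw' := (hw u v).symm.trans_ge (Int.cast_nonneg hsum)
    simpa [huv] using hw'
  have hu : (0 : ℝ) < α u := by exact_mod_cast hα u
  have hv : (0 : ℝ) < α v := by exact_mod_cast hα v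
  refine (sq_eq_sq₀ (by positivity) (by positivity)).1 ?_
  calc (207 * (w u * w v)) ^ 2 = (207 * (w u * w u)) * (207 * (w v * w v)) := by ring
    _ = (α u * α v : ℝ) ^ 2 := by rw [hsq, hsq]; ring

theorem exists_isPerronWeight (h : G.HasPrescribedArrayAndSpectrum) :
    ∃ α : V → ℤ, IsPerronWeight G α := by
  obtain ⟨w, heig, hquad⟩ := exists_eigenvector_quadratic h
  obtain ⟨h24, h14, h8⟩ := ncard_degree_of_hasPrescribedArrayAndSpectrum h
  let α : V → ℤ := fun v => if G.degree v = 24 then 3 else if G.degree v = 14 then 2 else 1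
  have hα (v) : G.degree v = 24 ∧ α v = 3 ∨ G.degree v = 14 ∧ α v = 2 ∨
      G.degree v = 8 ∧ α v = 1 := by
    rcases degree_eq_of_hasPrescribedArrayAndSpectrum h v with h | h | h <;> simp [α, h]
  have hlevel (k : ℤ) (d : ℕ) (hkd : ∀ v, α v = k ↔ G.degree v = d) :
      {v | α v = k}.ncard = {v | G.degree v = d}.ncard := by simp only [hkd]
  have hprod := eigenvector_mul_eq (α := α) (fun v => by have := hα v; lia)
    (fun v => by rcases hα v with h | h | h <;> simp [h]) hquad
  refine ⟨α, fun v => by have := hα v; tauto,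
    (hlevel 3 24 fun v => by have := hα v; lia).trans h24,
    (hlevel 2 14 fun v => by have := hα v; lia).trans h14,
    (hlevel 1 8 fun v => by have := hα v; lia).trans h8, fun u v => ?_, fun u => ?_⟩
  · have huv := hquad u v
    rw [show (414 : ℝ) = 2 * 207 by norm_num, mul_assoc, hprod] at huv
    exact_mod_cast huv
  · have hpos : (α u : ℝ) ≠ 0 := by have := hα u; norm_cast; lia
    rw [← @Int.cast_inj ℝ]
    refine mul_right_cancel₀ hpos ?_
    push_cast
    calc _ = 207 * w u * ∑ v, (G.adjMatrix ℤ u v : ℝ) * w v := by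
          rw [Finset.sum_mul, Finset.mul_sum]
          exact Finset.sum_congr rfl fun v _ => by
            linear_combination -(G.adjMatrix ℤ u v : ℝ) * hprod v u
      _ = 20 * α u * α u := by rw [heig]; linear_combination 20 * hprod u u

end Weights

open Matrix

section Converse

open Classical

variable {V : Type*} [Fintype V] {G : SimpleGraph V} {α : V → ℤ}

theorem IsPerronWeight.sum_comp (h : IsPerronWeight G α) (f : ℤ → ℤ) :
    ∑ v, f (α v) = 18 * f 3 + 9 * f 2 + 9 * f 1 := by
  have hcard (k : ℤ) : ∑ v, (if α v = k then 1 else 0 : ℤ) = {v | α v = k}.ncard := by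
    simp [Set.ncard_eq_toFinset_card']
  have hsplit (v : V) : f (α v) = (if α v = 3 then 1 else 0) * f 3 +
      (if α v = 2 then 1 else 0) * f 2 + (if α v = 1 then 1 else 0) * f 1 := by
    rcases h.values v with hv | hv | hv <;> simp [hv]
  simp_rw [hsplit, Finset.sum_add_distrib, ← Finset.sum_mul, hcard, h.card_three, h.card_two,
    h.card_one]
  norm_num

theorem IsPerronWeight.card_eq (h : IsPerronWeight G α) : Fintype.card V = 36 := by
  have hsum := h.sum_comp fun _ => 1
  simp only [Finset.sum_const, Finset.card_univ, nsmul_eq_mul, mul_one] at hsum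
  exact_mod_cast hsum

theorem IsPerronWeight.card_filter_degree (h : IsPerronWeight G α) {k : ℤ} {d : ℕ}
    (hkd : (d : ℤ) = 6 + 2 * k ^ 2) (hk : 0 < k) :
    (Finset.univ.filter fun v => G.degree v = d).card = {v | α v = k}.ncard := by
  rw [Set.ncard_eq_toFinset_card', Set.toFinset_ofPred]
  congr 2
  ext v
  have hv := h.degree_eq v
  rw [← @Nat.cast_inj ℤ, hv, hkd]
  rcases h.values v with h | h | h <;> rw [h] <;> constructor <;> intro h' <;> nlinarith

theorem IsPerronWeight.valencyArray_eq (h : IsPerronWeight G α) :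
    G.valencyArray = ([18, 9, 9], [24, 14, 8]) := by
  have h24 := (h.card_filter_degree (k := 3) (d := 24) rfl (by norm_num)).trans h.card_three
  have h14 := (h.card_filter_degree (k := 2) (d := 14) rfl (by norm_num)).trans h.card_two
  have h8 := (h.card_filter_degree (k := 1) (d := 8) rfl (by norm_num)).trans h.card_one
  have hdegree (v) : G.degree v = 24 ∨ G.degree v = 14 ∨ G.degree v = 8 := by
    have hv := h.degree_eq v
    rcases h.values v with h | h | h <;> rw [h] at hv <;> omega
  have hattained (d : ℕ) (hd : (Finset.univ.filter fun v => G.degree v = d).card ≠ 0) :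
      ∃ v, G.degree v = d := by
    simpa [Finset.Nonempty] using Finset.card_ne_zero.1 hd
  have himage : Finset.univ.image (fun v => G.degree v) = {24, 14, 8} := by
    ext d
    simp only [Finset.mem_image, Finset.mem_univ, true_and, Finset.mem_insert,
      Finset.mem_singleton]
    constructor
    · rintro ⟨v, rfl⟩
      exact hdegree v
    · rintro (rfl | rfl | rfl)
      exacts [hattained _ (by omega), hattained _ (by omega), hattained _ (by omega)]
  have hvalencies : G.valencies = [24, 14, 8] := by
    rw [SimpleGraph.valencies, himage]
    exact (List.toFinset_sort (· ≥ ·) (l := [24, 14, 8]) (by decide)).2 (by decide)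
  simp [SimpleGraph.valencyArray, hvalencies, h24, h14, h8]

theorem IsPerronWeight.sub_mul_sub_eq (h : IsPerronWeight G α) :
    (G.adjMatrix ℝ - (2 : ℝ) • 1) * (G.adjMatrix ℝ - (-3 : ℝ) • 1) =
      (2 : ℝ) • vecMulVec (fun v => (α v : ℝ)) fun v => (α v : ℝ) := by
  ext v w
  have hvw := congrArg (Int.cast : ℤ → ℝ) (h.quad v w)
  push_cast at hvw
  simp only [sub_mul, mul_sub, Matrix.sub_apply, Matrix.smul_apply, one_mul, smul_mul,
    mul_one, smul_eq_mul, vecMulVec_apply, one_apply, Matrix.mul_smul]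
  simp only [mul_apply, adjMatrix_real_eq_cast, Int.cast_sum, Int.cast_mul] at hvw ⊢
  split_ifs at hvw ⊢ <;> linear_combination hvw

theorem IsPerronWeight.adjSpectrum_eq (h : IsPerronWeight G α) :
    G.adjSpectrum =
      Multiset.replicate 1 20 + Multiset.replicate 17 2 + Multiset.replicate 18 (-3) := by
  have hA := isHermitian_adjMatrix G
  have heig : G.adjMatrix ℝ *ᵥ (fun v => (α v : ℝ)) = (20 : ℝ) • fun v => (α v : ℝ) := by
    ext v
    simpa [mulVec, dotProduct, adjMatrix_real_eq_cast] using
      congrArg (Int.cast : ℤ → ℝ) (h.eig v)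
  have htrace : ∑ i, hA.eigenvalues i = 0 := by
    have := hA.trace_eq_sum_eigenvalues
    simpa using this.symm
  have htrace_sq : ∑ i, hA.eigenvalues i ^ 2 = 630 := by
    have hdeg : ∑ v, (G.degree v : ℤ) = 630 := by
      rw [Finset.sum_congr rfl fun v _ => h.degree_eq v, h.sum_comp fun k => 6 + 2 * k ^ 2]
      norm_num
    rw [← trace_mul_self_eq_sum_eigenvalues_sq, Matrix.trace]
    simp only [diag_apply, SimpleGraph.adjMatrix_mul_self_apply_self]
    exact_mod_cast hdeg
  rw [SimpleGraph.adjSpectrum, hA.roots_charpoly_eq_eigenvalues]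
  refine eq_replicate_add_of_power_sums (by norm_num) (by norm_num) (by norm_num) ?_ ?_ ?_ ?_
  · rintro x hx
    obtain ⟨i, -, rfl⟩ := Multiset.mem_map.1 hx
    exact eigenvalues_mem_of_rank_one hA heig h.sub_mul_sub_eq i
  · simpa using h.card_eq
  · calc _ = ∑ i, hA.eigenvalues i := rfl
      _ = _ := by rw [htrace]; norm_num
  · rw [Multiset.map_map]
    calc _ = ∑ i, hA.eigenvalues i ^ 2 := rfl
      _ = _ := by rw [htrace_sq]; norm_num

end Converse

section CycleGram

open Classical

variable {Y : Type*} {F : SimpleGraph Y}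

/-- A union of connected components of `F`, as a finset. -/
def AdjClosed (F : SimpleGraph Y) (P : Finset Y) : Prop :=
  ∀ y ∈ P, ∀ z, F.Adj y z → z ∈ P

theorem AdjClosed.sdiff {P Q : Finset Y} (hP : AdjClosed F P) (hQ : AdjClosed F Q) :
    AdjClosed F (P \ Q) := fun y hy z hyz => by
  rw [Finset.mem_sdiff] at hy ⊢
  exact ⟨hP y hy.1 z hyz, fun hz => hy.2 (hQ z hz y hyz.symm)⟩

variable {X : Type*} [Fintype X] [Fintype Y] {K : SimpleGraph X} {N : Matrix Y X ℤ}

/-- A `0/1` matrix with `18` columns and rows indexed by the vertices of a disjoint union `F` of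
cycles, whose Gram matrix is `6I + 2J - F - F²`. -/
structure HasCycleGram (F : SimpleGraph Y) (N : Matrix Y X ℤ) : Prop where
  entry : ∀ y x, N y x = 0 ∨ N y x = 1
  card_columns : Fintype.card X = 18
  degree_eq : ∀ y, F.degree y = 2
  gram : ∀ y z, ∑ x, N y x * N z x = (if y = z then 6 else 0) + 2 - F.adjMatrix ℤ y z -
    (F.adjMatrix ℤ * F.adjMatrix ℤ) y z

/-- Two disjoint unions of cycles on `18` vertices, intertwined by a matrix whose rows and columns
have the Gram matrices of `HasCycleGram`. The matrix restricted to two cycles solves the discrete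
wave equation, by `comm`. -/
structure IsWavePair (F : SimpleGraph Y) (K : SimpleGraph X) (N : Matrix Y X ℤ) : Prop where
  left : HasCycleGram F N
  right : HasCycleGram K N.transpose
  comm : ∀ y x, ∑ z, F.adjMatrix ℤ y z * N z x = ∑ w, K.adjMatrix ℤ x w * N y w

theorem IsWavePair.swap (h : IsWavePair F K N) : IsWavePair K F N.transpose :=
  ⟨h.right, h.left, fun x y => (h.comm y x).symm⟩

theorem adjClosed_univ (F : SimpleGraph Y) : AdjClosed F Finset.univ :=
  fun _ _ _ _ => Finset.mem_univ _

theorem sum_adjMatrix_of_adjClosed {P : Finset Y} (hP : AdjClosed F P) {y : Y} (hy : y ∈ P) :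
    ∑ z ∈ P, F.adjMatrix ℤ y z = F.degree y := by
  rw [Finset.sum_subset P.subset_univ fun z _ hz => by
    rw [SimpleGraph.adjMatrix_apply, if_neg fun h => hz (hP y hy z h)]]
  simp [SimpleGraph.adjMatrix_apply, ← SimpleGraph.card_neighborFinset_eq_degree,
    SimpleGraph.neighborFinset_eq_filter]

theorem sum_adjMatrix_sq_of_adjClosed {P : Finset Y} (hP : AdjClosed F P) {y : Y} (hy : y ∈ P)
    {d : ℕ} (hd : ∀ z, F.degree z = d) :
    ∑ z ∈ P, (F.adjMatrix ℤ * F.adjMatrix ℤ) y z = d * d := by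
  have hcol (w : Y) : ∑ z ∈ P, F.adjMatrix ℤ y w * F.adjMatrix ℤ w z = F.adjMatrix ℤ y w * d := by
    by_cases h : F.Adj y w
    · rw [← Finset.mul_sum, sum_adjMatrix_of_adjClosed hP (hP y hy w h), hd]
    · simp [h]
  simp only [Matrix.mul_apply]
  rw [Finset.sum_comm, Finset.sum_congr rfl fun w _ => hcol w, ← Finset.sum_mul,
    sum_adjMatrix_of_adjClosed (adjClosed_univ F) (Finset.mem_univ y), hd]

namespace HasCycleGram

theorem mul_self_apply (h : HasCycleGram F N) (y : Y) (x : X) : N y x * N y x = N y x := by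
  rcases h.entry y x with h | h <;> simp [h]

theorem nonneg (h : HasCycleGram F N) (y : Y) (x : X) : 0 ≤ N y x := by
  rcases h.entry y x with h | h <;> simp [h]

theorem row_sum (h : HasCycleGram F N) (y : Y) : ∑ x, N y x = 6 := by
  have hy := h.gram y y
  have hsq := adjMatrix_mul_self_apply_self_add F y
  rw [h.degree_eq] at hsq
  simp only [h.mul_self_apply, if_true] at hy
  push_cast at hsq
  linarith

/-- The variance of the column sums over `P` vanishes. -/
theorem three_mul_sum_eq_card (h : HasCycleGram F N) {P : Finset Y} (hP : AdjClosed F P) (x : X) :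
    3 * ∑ y ∈ P, N y x = P.card := by
  have hfirst : ∑ x, ∑ y ∈ P, N y x = 6 * P.card := by
    rw [Finset.sum_comm, Finset.sum_congr rfl fun y _ => h.row_sum y, Finset.sum_const]
    simp [mul_comm]
  have hgram (y) (hy : y ∈ P) : ∑ z ∈ P, ∑ x, N y x * N z x = 2 * P.card := by
    simp only [h.gram, Finset.sum_sub_distrib, Finset.sum_add_distrib, Finset.sum_ite_eq, if_pos hy,
      sum_adjMatrix_of_adjClosed hP hy, sum_adjMatrix_sq_of_adjClosed hP hy h.degree_eq,
      h.degree_eq, Finset.sum_const, nsmul_eq_mul]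
    push_cast
    ring
  have hsecond : ∑ x, (∑ y ∈ P, N y x) ^ 2 = 2 * (P.card : ℤ) ^ 2 := by
    simp only [sq, Finset.sum_mul_sum]
    rw [Finset.sum_comm, Finset.sum_congr rfl fun y hy => Finset.sum_comm.trans (hgram y hy)]
    simp only [Finset.sum_const, nsmul_eq_mul]
    ring
  have hvar : ∑ x, (3 * ∑ y ∈ P, N y x - P.card) ^ 2 = 0 := by
    calc _ = 9 * ∑ x, (∑ y ∈ P, N y x) ^ 2 - 6 * P.card * ∑ x, ∑ y ∈ P, N y x +
          Fintype.card X * (P.card : ℤ) ^ 2 := by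
          have hexpand (s c : ℤ) : (3 * s - c) ^ 2 = 9 * s ^ 2 - 6 * c * s + c ^ 2 := by ring
          simp only [hexpand, Finset.sum_add_distrib, Finset.sum_sub_distrib, ← Finset.mul_sum,
            Finset.sum_const, nsmul_eq_mul, Finset.card_univ]
      _ = 0 := by rw [hfirst, hsecond, h.card_columns]; push_cast; ring
  have hx := (Finset.sum_eq_zero_iff_of_nonneg fun x _ => sq_nonneg _).1 hvar x (Finset.mem_univ x)
  exact sub_eq_zero.1 (pow_eq_zero_iff two_ne_zero |>.1 hx)

end HasCycleGram

end CycleGram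

section Levels

open Classical

variable {V : Type*} [Fintype V] {G : SimpleGraph V} {α : V → ℤ}

/-- The number of neighbours of `v` of weight `k`. -/
noncomputable def levelDegree (G : SimpleGraph V) (α : V → ℤ) (k : ℤ) (v : V) : ℤ :=
  ∑ w with α w = k, G.adjMatrix ℤ v w

theorem levelDegree_nonneg (G : SimpleGraph V) (α : V → ℤ) (k : ℤ) (v : V) :
    0 ≤ levelDegree G α k v :=
  Finset.sum_nonneg fun _ _ => adjMatrix_nonneg _ _ _

theorem one_le_levelDegree {v w : V} (h : G.Adj v w) : 1 ≤ levelDegree G α (α w) v := by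
  have hle : G.adjMatrix ℤ v w ≤ levelDegree G α (α w) v :=
    Finset.single_le_sum (f := fun w => G.adjMatrix ℤ v w) (fun _ _ => adjMatrix_nonneg G _ _)
      (Finset.mem_filter.2 ⟨Finset.mem_univ w, rfl⟩)
  rwa [SimpleGraph.adjMatrix_apply, if_pos h] at hle

namespace IsPerronWeight

theorem sum_levels (h : IsPerronWeight G α) (f : V → ℤ) :
    ∑ v, f v = ∑ v with α v = 3, f v + ∑ v with α v = 2, f v + ∑ v with α v = 1, f v := by
  simp only [Finset.sum_filter, ← Finset.sum_add_distrib]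
  refine Finset.sum_congr rfl fun v _ => ?_
  rcases h.values v with hv | hv | hv <;> simp [hv]

theorem sum_adjMatrix (h : IsPerronWeight G α) (v : V) :
    ∑ w, G.adjMatrix ℤ v w = 6 + 2 * α v ^ 2 := by
  rw [← h.degree_eq, ← sum_adjMatrix_of_adjClosed (adjClosed_univ G) (Finset.mem_univ v)]

theorem levelDegree_add (h : IsPerronWeight G α) (v : V) :
    levelDegree G α 3 v + levelDegree G α 2 v + levelDegree G α 1 v = 6 + 2 * α v ^ 2 := by
  rw [← h.sum_adjMatrix, h.sum_levels, levelDegree, levelDegree, levelDegree]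

theorem levelDegree_weighted_add (h : IsPerronWeight G α) (v : V) :
    3 * levelDegree G α 3 v + 2 * levelDegree G α 2 v + levelDegree G α 1 v = 20 * α v := by
  have hlevel (k : ℤ) : ∑ w with α w = k, G.adjMatrix ℤ v w * α w = k * levelDegree G α k v := by
    rw [levelDegree, Finset.mul_sum]
    refine Finset.sum_congr rfl fun w hw => ?_
    rw [(Finset.mem_filter.1 hw).2, mul_comm]
  rw [← h.eig, h.sum_levels, hlevel, hlevel, hlevel, one_mul]

theorem sum_level_three_const (h : IsPerronWeight G α) (c : ℤ) :
    ∑ v with α v = 3, c = 18 * c := by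
  have hcard := h.card_three
  rw [Set.ncard_eq_toFinset_card', Set.toFinset_ofPred] at hcard
  rw [Finset.sum_const, hcard, nsmul_eq_mul, Nat.cast_ofNat]

theorem levelDegree_of_adj_weight_one (h : IsPerronWeight G α) {b c : V} (hb : α b = 2)
    (hc : α c = 1) (hbc : G.Adj b c) : levelDegree G α 3 b = 13 ∧ levelDegree G α 2 b = 0 := by
  have hone := hc ▸ one_le_levelDegree (α := α) hbc
  have hnonneg := levelDegree_nonneg G α 2 b
  have hadd := h.levelDegree_add b
  have hweighted := h.levelDegree_weighted_add b
  rw [hb] at hadd hweighted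
  constructor <;> lia

theorem exists_ne_adj_of_weight_two_one (h : IsPerronWeight G α) {b c : V} (hb : α b = 2)
    (hc : α c = 1) (hbc : G.Adj b c) : ∃ d, α d = 2 ∧ G.Adj c d ∧ b ≠ d := by
  by_contra! hunique
  have hle : levelDegree G α 2 c ≤ 1 := by
    rw [levelDegree, Finset.sum_eq_single b]
    · simp [hbc.symm]
    · intro d hd hdb
      have hd := (Finset.mem_filter.1 hd).2
      simpa using fun hcd => hdb (hunique d hd hcd).symm
    · simp [hb]
  have hone := hb ▸ one_le_levelDegree (α := α) hbc.symm
  have hadd := h.levelDegree_add c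
  have hweighted := h.levelDegree_weighted_add c
  rw [hc] at hadd hweighted
  lia

/-- Two vertices of weight `2` with a common neighbour of weight `1` would have too many common
neighbours of weight `3`. -/
theorem not_adj_of_weight_two_one (h : IsPerronWeight G α) {b c : V} (hb : α b = 2)
    (hc : α c = 1) : ¬ G.Adj b c := fun hbc => by
  obtain ⟨d, hd, hcd, hbd⟩ := h.exists_ne_adj_of_weight_two_one hb hc hbc
  obtain ⟨hb3, hb2⟩ := h.levelDegree_of_adj_weight_one hb hc hbc
  have hd3 := (h.levelDegree_of_adj_weight_one hd hc hcd.symm).1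
  have hbd' : ¬ G.Adj b d := fun hadj => by
    have := hd ▸ one_le_levelDegree (α := α) hadj
    lia
  have hcommon : ∑ w with α w = 3, (G.adjMatrix ℤ b w + G.adjMatrix ℤ d w - 1) ≤
      ∑ w with α w = 3, G.adjMatrix ℤ b w * G.adjMatrix ℤ w d := by
    refine Finset.sum_le_sum fun w _ => ?_
    by_cases hbw : G.Adj b w <;> by_cases hdw : G.Adj d w <;> simp [hbw, hdw, G.adj_comm w d]
  have hc_common : 1 ≤ ∑ w with α w = 1, G.adjMatrix ℤ b w * G.adjMatrix ℤ w d := by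
    calc (1 : ℤ) = G.adjMatrix ℤ b c * G.adjMatrix ℤ c d := by simp [hbc, hcd]
      _ ≤ _ := Finset.single_le_sum (f := fun w => G.adjMatrix ℤ b w * G.adjMatrix ℤ w d)
        (fun _ _ => mul_nonneg (adjMatrix_nonneg G _ _) (adjMatrix_nonneg G _ _))
        (Finset.mem_filter.2 ⟨Finset.mem_univ c, hc⟩)
  have hrest : 0 ≤ ∑ w with α w = 2, G.adjMatrix ℤ b w * G.adjMatrix ℤ w d :=
    Finset.sum_nonneg fun _ _ => mul_nonneg (adjMatrix_nonneg G _ _) (adjMatrix_nonneg G _ _)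
  have hquad := h.quad b d
  rw [Matrix.mul_apply, h.sum_levels, if_neg hbd, hb, hd, SimpleGraph.adjMatrix_apply G b d,
    if_neg hbd'] at hquad
  rw [Finset.sum_sub_distrib, Finset.sum_add_distrib, h.sum_level_three_const,
    ← levelDegree, ← levelDegree, hb3, hd3] at hcommon
  lia

theorem levelDegree_three_of_ne (h : IsPerronWeight G α) {v : V} (hv : α v ≠ 3) :
    levelDegree G α 3 v = 6 * α v := by
  have hadd := h.levelDegree_add v
  have hweighted := h.levelDegree_weighted_add v
  have hzero (k : ℤ) (hk : ∀ w, α w = k → ¬ G.Adj v w) : levelDegree G α k v = 0 :=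
    Finset.sum_eq_zero fun w hw => by simp [hk w (Finset.mem_filter.1 hw).2]
  rcases h.values v with h3 | h2 | h1
  · exact absurd h3 hv
  · have := hzero 1 fun w hw => h.not_adj_of_weight_two_one h2 hw
    rw [h2] at hadd hweighted ⊢
    lia
  · have := hzero 2 fun w hw hadj => h.not_adj_of_weight_two_one hw h1 hadj.symm
    rw [h1] at hadd hweighted ⊢
    lia

end IsPerronWeight

end Levels

section Decomposition

open Classical

variable {V : Type*} {G : SimpleGraph V} {α : V → ℤ}

/-- The subgraph induced on the vertices of weight `1` and `2`. -/
def lowGraph (G : SimpleGraph V) (α : V → ℤ) : SimpleGraph {v // α v ≠ 3} :=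
  G.comap Subtype.val

/-- The complement of the subgraph induced on the vertices of weight `3`. -/
def topGraph (G : SimpleGraph V) (α : V → ℤ) : SimpleGraph {v // α v = 3} :=
  Gᶜ.comap Subtype.val

/-- The adjacency between low and top vertices, complemented in the rows of weight `2`, so that all
rows have sum `6`. -/
noncomputable def crossMatrix (G : SimpleGraph V) (α : V → ℤ) :
    Matrix {v // α v ≠ 3} {v // α v = 3} ℤ :=
  fun y x => if α y = 1 then G.adjMatrix ℤ y x else 1 - G.adjMatrix ℤ y x

theorem lowGraph_adjMatrix (y z : {v // α v ≠ 3}) :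
    (lowGraph G α).adjMatrix ℤ y z = G.adjMatrix ℤ y z := by
  rw [SimpleGraph.adjMatrix_apply, SimpleGraph.adjMatrix_apply]
  exact if_congr Iff.rfl rfl rfl

theorem topGraph_adjMatrix (x w : {v // α v = 3}) :
    (topGraph G α).adjMatrix ℤ x w = 1 - (if x = w then 1 else 0) - G.adjMatrix ℤ x w := by
  rcases eq_or_ne x w with rfl | hxw
  · simp
  · have hiff : (topGraph G α).Adj x w ↔ ¬ G.Adj x w := by
      simp [topGraph, SimpleGraph.compl_adj, Subtype.coe_ne_coe.2 hxw]
    by_cases hadj : G.Adj x w <;>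
      simp [SimpleGraph.adjMatrix_apply, hiff, hxw, hadj]

theorem crossMatrix_entry (y : {v // α v ≠ 3}) (x : {v // α v = 3}) :
    crossMatrix G α y x = 0 ∨ crossMatrix G α y x = 1 := by
  by_cases hadj : G.Adj y x <;> by_cases hy : α y = 1 <;> simp [crossMatrix, hadj, hy]

variable [Fintype V]

/-- The vertices of `lowGraph G α` of weight `k`. -/
noncomputable def lowLevel (α : V → ℤ) (k : ℤ) : Finset {v // α v ≠ 3} :=
  Finset.univ.filter fun y => α y = k

theorem mem_lowLevel {k : ℤ} {y : {v // α v ≠ 3}} : y ∈ lowLevel α k ↔ α y = k := by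
  simp [lowLevel]

theorem sum_low_add_sum_top (f : V → ℤ) :
    ∑ y : {v // α v ≠ 3}, f y + ∑ x : {v // α v = 3}, f x = ∑ v, f v := by
  rw [add_comm, ← Fintype.sum_subtype_add_sum_subtype (fun v => α v = 3) f]

theorem sum_lowLevel {k : ℤ} (hk : k ≠ 3) (f : V → ℤ) :
    ∑ y ∈ lowLevel α k, f y = ∑ v with α v = k, f v := by
  rw [lowLevel, Finset.sum_filter, Finset.sum_filter,
    ← sum_low_add_sum_top (α := α) fun v => if α v = k then f v else 0, left_eq_add]
  exact Finset.sum_eq_zero fun x _ => if_neg fun hx => hk (hx.symm.trans x.2)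

theorem sum_crossMatrix_lowLevel (k : ℤ) (x : {v // α v = 3}) :
    ∑ y ∈ lowLevel α k, crossMatrix G α y x =
      ∑ y ∈ lowLevel α k, if k = 1 then G.adjMatrix ℤ x y else 1 - G.adjMatrix ℤ x y :=
  Finset.sum_congr rfl fun y hy => by rw [crossMatrix, mem_lowLevel.1 hy, adjMatrix_comm]

theorem sum_topGraph_mul (x : {v // α v = 3}) (f : {v // α v = 3} → ℤ) :
    ∑ w, (topGraph G α).adjMatrix ℤ x w * f w =
      ∑ w, f w - f x - ∑ w : {v // α v = 3}, G.adjMatrix ℤ x w * f w := by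
  simp only [topGraph_adjMatrix, sub_mul, Finset.sum_sub_distrib, one_mul, ite_mul, zero_mul,
    Finset.sum_ite_eq, Finset.mem_univ, if_true]

namespace IsPerronWeight

theorem quad_split (h : IsPerronWeight G α) (u v : V) :
    ∑ y : {v // α v ≠ 3}, G.adjMatrix ℤ u y * G.adjMatrix ℤ y v +
      ∑ x : {v // α v = 3}, G.adjMatrix ℤ u x * G.adjMatrix ℤ x v + G.adjMatrix ℤ u v =
      (if u = v then 6 else 0) + 2 * (α u * α v) := by
  rw [sum_low_add_sum_top fun w => G.adjMatrix ℤ u w * G.adjMatrix ℤ w v, ← Matrix.mul_apply,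
    h.quad]

theorem weight_low (h : IsPerronWeight G α) (y : {v // α v ≠ 3}) : α y = 1 ∨ α y = 2 := by
  have := h.values y
  have := y.2
  tauto

theorem card_top (h : IsPerronWeight G α) : Fintype.card {v // α v = 3} = 18 := by
  rw [Fintype.card_subtype, ← h.card_three, Set.ncard_eq_toFinset_card', Set.toFinset_ofPred]

theorem card_low (h : IsPerronWeight G α) : Fintype.card {v // α v ≠ 3} = 18 := by
  rw [Fintype.card_subtype_compl, h.card_eq, h.card_top]

theorem sum_top_low (h : IsPerronWeight G α) (y : {v // α v ≠ 3}) :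
    ∑ x : {v // α v = 3}, G.adjMatrix ℤ y x = 6 * α y := by
  rw [← h.levelDegree_three_of_ne y.2, levelDegree]
  exact (Finset.sum_subtype _ (by simp) _).symm

theorem sum_low_low (h : IsPerronWeight G α) (y : {v // α v ≠ 3}) :
    ∑ z : {v // α v ≠ 3}, G.adjMatrix ℤ y z = 2 := by
  have hsplit := sum_low_add_sum_top (α := α) fun w => G.adjMatrix ℤ y w
  rw [h.sum_top_low, h.sum_adjMatrix] at hsplit
  rcases h.weight_low y with hy | hy <;> rw [hy] at hsplit <;> linarith

theorem adjMatrix_low_eq_zero (h : IsPerronWeight G α) {y z : {v // α v ≠ 3}} (hyz : α y ≠ α z) :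
    G.adjMatrix ℤ y z = 0 := by
  rw [SimpleGraph.adjMatrix_apply, if_neg]
  rcases h.weight_low y with hy | hy <;> rcases h.weight_low z with hz | hz
  · lia
  · exact fun hadj => h.not_adj_of_weight_two_one hz hy hadj.symm
  · exact h.not_adj_of_weight_two_one hy hz
  · lia

theorem sum_low_mul_eq_zero (h : IsPerronWeight G α) {y z : {v // α v ≠ 3}} (hyz : α y ≠ α z) :
    ∑ w : {v // α v ≠ 3}, G.adjMatrix ℤ y w * G.adjMatrix ℤ w z = 0 := by
  refine Finset.sum_eq_zero fun w _ => ?_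
  by_cases hw : α y = α w
  · rw [h.adjMatrix_low_eq_zero (hw ▸ hyz : α w ≠ α z), mul_zero]
  · rw [h.adjMatrix_low_eq_zero hw, zero_mul]

theorem hasCycleGram_low (h : IsPerronWeight G α) :
    HasCycleGram (lowGraph G α) (crossMatrix G α) where
  entry := crossMatrix_entry
  card_columns := h.card_top
  degree_eq y := by
    have hsum := h.sum_low_low y
    simp only [← lowGraph_adjMatrix] at hsum
    rw [sum_adjMatrix_of_adjClosed (adjClosed_univ _) (Finset.mem_univ y)] at hsum
    exact_mod_cast hsum
  gram y z := by
    have hquad := h.quad_split y z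
    simp only [Matrix.mul_apply, lowGraph_adjMatrix, crossMatrix, ← Subtype.ext_iff] at hquad ⊢
    have hy := h.sum_top_low y
    have hz := h.sum_top_low z
    simp only [fun x : {v // α v = 3} => adjMatrix_comm G x z] at hquad
    by_cases hyz : α y = α z
    · generalize G.adjMatrix ℤ = A at *
      rcases h.weight_low z with hz' | hz' <;> simp only [hyz, hz'] at hy hz hquad ⊢
      · split_ifs at hquad ⊢ <;> linarith
      · norm_num [sub_mul, mul_sub, Finset.sum_sub_distrib, hy, hz, h.card_top]
        split_ifs at hquad ⊢ <;> linarith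
    · have hne : y ≠ z := fun heq => hyz (congrArg (α ∘ Subtype.val) heq)
      rw [h.adjMatrix_low_eq_zero hyz, h.sum_low_mul_eq_zero hyz] at hquad ⊢
      generalize G.adjMatrix ℤ = A at *
      rcases h.weight_low y with hy' | hy' <;> rcases h.weight_low z with hz' | hz' <;>
        simp only [hy', hz', if_neg hne] at hy hz hquad hyz ⊢
      · exact absurd trivial hyz
      · norm_num [mul_sub, Finset.sum_sub_distrib, hy]; linarith
      · norm_num [sub_mul, Finset.sum_sub_distrib, hz]; linarith
      · exact absurd trivial hyz

theorem adjClosed_lowLevel (h : IsPerronWeight G α) (k : ℤ) :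
    AdjClosed (lowGraph G α) (lowLevel α k) := by
  intro y hy z hyz
  rw [mem_lowLevel] at hy ⊢
  by_contra hz
  have hzero := h.adjMatrix_low_eq_zero (fun heq => hz (heq.symm.trans hy) : α y ≠ α z)
  rw [← lowGraph_adjMatrix] at hzero
  simp [hyz] at hzero

theorem card_lowLevel (h : IsPerronWeight G α) {k : ℤ} (hk : k = 1 ∨ k = 2) :
    (lowLevel α k).card = 9 := by
  have hcard : ((lowLevel α k).card : ℤ) = {v | α v = k}.ncard := by
    rw [Finset.card_eq_sum_ones, Nat.cast_sum, Set.ncard_eq_toFinset_card', Set.toFinset_ofPred,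
      Finset.card_eq_sum_ones, Nat.cast_sum]
    exact sum_lowLevel (by lia) fun _ => 1
  rcases hk with rfl | rfl
  · rw [h.card_one] at hcard; exact_mod_cast hcard
  · rw [h.card_two] at hcard; exact_mod_cast hcard

theorem levelDegree_top (h : IsPerronWeight G α) (x : {v // α v = 3}) :
    levelDegree G α 1 x = 3 ∧ levelDegree G α 2 x = 6 := by
  have hone := h.hasCycleGram_low.three_mul_sum_eq_card (h.adjClosed_lowLevel 1) x
  have htwo := h.hasCycleGram_low.three_mul_sum_eq_card (h.adjClosed_lowLevel 2) x
  simp only [h.card_lowLevel (.inl rfl), sum_crossMatrix_lowLevel, if_true] at hone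
  rw [sum_lowLevel (by decide) fun v => G.adjMatrix ℤ x v, ← levelDegree] at hone
  simp only [h.card_lowLevel (.inr rfl), sum_crossMatrix_lowLevel,
    if_neg (by decide : ¬ (2 : ℤ) = 1)] at htwo
  rw [Finset.sum_sub_distrib, Finset.sum_const, h.card_lowLevel (.inr rfl),
    sum_lowLevel (by decide) fun v => G.adjMatrix ℤ x v, ← levelDegree] at htwo
  norm_num at hone htwo
  constructor <;> linarith

theorem sum_top_top (h : IsPerronWeight G α) (x : {v // α v = 3}) :
    ∑ w : {v // α v = 3}, G.adjMatrix ℤ x w = 15 := by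
  have hadd := h.levelDegree_add x
  rw [(h.levelDegree_top x).1, (h.levelDegree_top x).2, x.2, levelDegree] at hadd
  rw [← Finset.sum_subtype (Finset.univ.filter fun v => α v = 3) (by simp)
    fun v => G.adjMatrix ℤ x v]
  linarith

theorem sum_low (h : IsPerronWeight G α) (f : {v // α v ≠ 3} → ℤ) :
    ∑ y, f y = ∑ y ∈ lowLevel α 1, f y + ∑ y ∈ lowLevel α 2, f y := by
  rw [lowLevel, lowLevel, Finset.sum_filter, Finset.sum_filter, ← Finset.sum_add_distrib]
  refine Finset.sum_congr rfl fun y _ => ?_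
  rcases h.weight_low y with hy | hy <;> simp [hy]

theorem sum_crossMatrix_mul (h : IsPerronWeight G α) (x w : {v // α v = 3}) :
    ∑ y, crossMatrix G α y x * crossMatrix G α y w =
      ∑ y : {v // α v ≠ 3}, G.adjMatrix ℤ x y * G.adjMatrix ℤ y w - 3 := by
  have hlevel (x : {v // α v = 3}) : ∑ y ∈ lowLevel α 2, G.adjMatrix ℤ y x = 6 := by
    rw [← (h.levelDegree_top x).2, levelDegree, ← sum_lowLevel (by decide)]
    exact Finset.sum_congr rfl fun y _ => adjMatrix_comm _ _ _
  have hone : ∑ y ∈ lowLevel α 1, crossMatrix G α y x * crossMatrix G α y w =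
      ∑ y ∈ lowLevel α 1, G.adjMatrix ℤ y x * G.adjMatrix ℤ y w :=
    Finset.sum_congr rfl fun y hy => by
      rw [crossMatrix, crossMatrix, mem_lowLevel.1 hy, if_pos rfl, if_pos rfl]
  have htwo : ∑ y ∈ lowLevel α 2, crossMatrix G α y x * crossMatrix G α y w =
      ∑ y ∈ lowLevel α 2, (1 - G.adjMatrix ℤ y x - G.adjMatrix ℤ y w +
        G.adjMatrix ℤ y x * G.adjMatrix ℤ y w) :=
    Finset.sum_congr rfl fun y hy => by
      rw [crossMatrix, crossMatrix, mem_lowLevel.1 hy, if_neg (by decide), if_neg (by decide)]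
      ring
  rw [h.sum_low, hone, htwo, Finset.sum_add_distrib, Finset.sum_sub_distrib,
    Finset.sum_sub_distrib, hlevel, hlevel, Finset.sum_const, h.card_lowLevel (.inr rfl),
    h.sum_low]
  simp only [adjMatrix_comm G x]
  norm_num
  ring

theorem hasCycleGram_top (h : IsPerronWeight G α) :
    HasCycleGram (topGraph G α) (crossMatrix G α).transpose where
  entry x y := crossMatrix_entry y x
  card_columns := h.card_low
  degree_eq x := by
    have hsum := sum_topGraph_mul (G := G) x fun _ => 1
    simp only [mul_one, h.sum_top_top] at hsum
    rw [sum_adjMatrix_of_adjClosed (adjClosed_univ _) (Finset.mem_univ x),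
      Finset.sum_const, Finset.card_univ, h.card_top] at hsum
    norm_num at hsum
    exact_mod_cast hsum
  gram x w := by
    have hquad := h.quad_split x w
    have hsum := h.sum_top_top w
    simp only [adjMatrix_comm G w] at hsum
    simp only [Matrix.transpose_apply, h.sum_crossMatrix_mul, Matrix.mul_apply, sum_topGraph_mul]
    simp only [topGraph_adjMatrix, Finset.sum_sub_distrib, mul_sub, mul_one, mul_ite, mul_zero,
      Finset.sum_ite_eq', Finset.mem_univ, if_true, h.sum_top_top, hsum, Finset.sum_const,
      Finset.card_univ, h.card_top, nsmul_eq_mul, Nat.cast_ofNat]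
    rw [x.2, w.2] at hquad
    rcases eq_or_ne x w with rfl | hxw
    · simp only [if_true] at hquad ⊢
      linarith
    · simp only [if_neg hxw, if_neg (Subtype.coe_ne_coe.2 hxw)] at hquad ⊢
      linarith

theorem isWavePair (h : IsPerronWeight G α) :
    IsWavePair (lowGraph G α) (topGraph G α) (crossMatrix G α) where
  left := h.hasCycleGram_low
  right := h.hasCycleGram_top
  comm y x := by
    have hquad := h.quad_split y x
    have hne : (y : V) ≠ x := fun heq => y.2 (heq ▸ x.2)
    rw [if_neg hne, x.2] at hquad
    have hlow := h.sum_low_low y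
    have htop := h.sum_top_low y
    have hx := h.sum_top_top x
    have hcross (z) : (lowGraph G α).adjMatrix ℤ y z * crossMatrix G α z x =
        G.adjMatrix ℤ y z * if α y = 1 then G.adjMatrix ℤ z x else 1 - G.adjMatrix ℤ z x := by
      by_cases hyz : α y = α z
      · rw [lowGraph_adjMatrix, crossMatrix, hyz]
      · rw [lowGraph_adjMatrix, h.adjMatrix_low_eq_zero hyz, zero_mul, zero_mul]
    rw [Finset.sum_congr rfl fun z _ => hcross z, sum_topGraph_mul]
    simp only [fun w : {v // α v = 3} => adjMatrix_comm G w x] at hquad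
    rcases h.weight_low y with hy | hy <;>
      simp only [crossMatrix, hy, if_true, if_neg (by decide : ¬ (2 : ℤ) = 1), mul_sub, sub_mul,
        one_mul, mul_one, Finset.sum_sub_distrib, Finset.sum_const, Finset.card_univ, h.card_top,
        nsmul_eq_mul, Nat.cast_ofNat, hlow, hx,
        fun w : {v // α v = 3} => mul_comm (G.adjMatrix ℤ x w)] at hquad htop ⊢
    · linarith
    · linarith

end IsPerronWeight

end Decomposition

section CycleCover

open Classical

variable {Y : Type*} {F : SimpleGraph Y} {n : ℕ} {p : ℤ → Y}

/-- The map `p` walks along a connected component of `F`, never turning back. -/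
structure IsUnrolling (F : SimpleGraph Y) (p : ℤ → Y) : Prop where
  adj_iff : ∀ i y, F.Adj (p i) y ↔ y = p (i - 1) ∨ y = p (i + 1)
  ne : ∀ i, p (i - 1) ≠ p (i + 1)

namespace IsUnrolling

theorem adj_add_one (h : IsUnrolling F p) (i : ℤ) : F.Adj (p i) (p (i + 1)) :=
  (h.adj_iff i _).2 (.inr rfl)

theorem comp_add (h : IsUnrolling F p) (c : ℤ) : IsUnrolling F fun i => p (c + i) where
  adj_iff i y := by rw [h.adj_iff, add_sub_assoc, add_assoc]
  ne i := by simpa only [add_sub_assoc, add_assoc] using h.ne (c + i)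

theorem comp_sub (h : IsUnrolling F p) (c : ℤ) : IsUnrolling F fun i => p (c - i) where
  adj_iff i y := by
    rw [h.adj_iff, or_comm, sub_sub_eq_add_sub, sub_add_eq_sub_sub, add_sub_right_comm]
  ne i := by
    simpa only [sub_sub_eq_add_sub, sub_add_eq_sub_sub, add_sub_right_comm] using
      (h.ne (c - i)).symm

theorem eq_of_two_eq {q : ℤ → Y} (hp : IsUnrolling F p) (hq : IsUnrolling F q)
    (h0 : p 0 = q 0) (h1 : p 1 = q 1) (t : ℤ) : p t = q t := by
  have hnext (i : ℤ) (h : p (i - 1) = q (i - 1)) (h' : p i = q i) : p (i + 1) = q (i + 1) :=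
    ((hq.adj_iff i _).1 (h' ▸ hp.adj_add_one i)).resolve_left (h ▸ (hp.ne i).symm)
  have hprev (i : ℤ) (h : p (i + 1) = q (i + 1)) (h' : p i = q i) : p (i - 1) = q (i - 1) :=
    ((hq.adj_iff i _).1 (h' ▸ (hp.adj_iff i _).2 (.inl rfl))).resolve_right (h ▸ hp.ne i)
  suffices h : p t = q t ∧ p (t + 1) = q (t + 1) from h.1
  induction t with
  | zero => exact ⟨h0, h1⟩
  | succ i ih => exact ⟨ih.2, hnext (i + 1) (by simpa using ih.1) ih.2⟩
  | pred i ih => exact ⟨hprev (-i) ih.2 ih.1, by simpa using ih.1⟩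

/-- If the walk came back reversed, it would turn back or stall halfway. -/
theorem add_one_ne_sub_one (h : IsUnrolling F p) {i j : ℤ} (hij : p i = p j) :
    p (i + 1) ≠ p (j - 1) := by
  intro hrefl
  have heq := (h.comp_add i).eq_of_two_eq (h.comp_sub j) (by simpa using hij) hrefl
  obtain ⟨k, hk | hk⟩ := Int.even_or_odd' (j - i)
  · exact h.ne (i + k)
      ((congrArg p (by ring)).trans ((heq (k - 1)).trans (congrArg p (by linarith))))
  · exact (h.adj_add_one (i + k)).ne ((heq k).trans (congrArg p (by linarith)))

theorem add_eq_add (h : IsUnrolling F p) {i j : ℤ} (hij : p i = p j) (t : ℤ) :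
    p (i + t) = p (j + t) :=
  (h.comp_add i).eq_of_two_eq (h.comp_add j) (by simpa using hij)
    (((h.adj_iff j _).1 (hij ▸ h.adj_add_one i)).resolve_left (h.add_one_ne_sub_one hij)) t

theorem exists_eq_iff_dvd [Finite Y] (h : IsUnrolling F p) :
    ∃ n : ℕ, 3 ≤ n ∧ ∀ i j, p i = p j ↔ (n : ℤ) ∣ i - j := by
  let H : AddSubgroup ℤ :=
    { carrier := {k | p k = p 0}
      zero_mem' := rfl
      add_mem' := fun {a b} ha hb => by simpa [hb.out] using h.add_eq_add (j := 0) ha b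
      neg_mem' := fun {a} ha => by simpa using (h.add_eq_add (j := 0) ha (-a)).symm }
  obtain ⟨g, hg⟩ := Int.subgroup_cyclic H
  have hmem (k : ℤ) : p k = p 0 ↔ (g.natAbs : ℤ) ∣ k := by
    rw [Int.natAbs_dvd, ← Int.mem_zmultiples_iff, AddSubgroup.zmultiples_eq_closure, ← hg]
    rfl
  have hiff (i j : ℤ) : p i = p j ↔ (g.natAbs : ℤ) ∣ i - j := by
    rw [← hmem]
    exact ⟨fun hij => by simpa [← sub_eq_add_neg] using h.add_eq_add hij (-j),
      fun hij => by simpa using h.add_eq_add hij j⟩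
  refine ⟨g.natAbs, ?_, hiff⟩
  by_contra! hlt
  interval_cases g.natAbs
  · obtain ⟨i, j, hne, heq⟩ := Finite.exists_ne_map_eq_of_infinite p
    exact hne (by simpa [sub_eq_zero] using (hiff i j).1 heq)
  · exact (h.adj_add_one 0).ne ((hiff _ _).2 (by simp))
  · exact h.ne 0 ((hiff _ _).2 (by simp))

end IsUnrolling

theorem exists_ne_adj_iff [Fintype Y] {y z : Y} (hdeg : F.degree y = 2) (hadj : F.Adj y z) :
    ∃ w ≠ z, ∀ u, F.Adj y u ↔ u = z ∨ u = w := by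
  obtain ⟨a, b, hab, heq⟩ := Finset.card_eq_two.1 hdeg
  have hiff (u) : F.Adj y u ↔ u = a ∨ u = b := by
    rw [← SimpleGraph.mem_neighborFinset, heq, Finset.mem_insert, Finset.mem_singleton]
  rcases (hiff z).1 hadj with rfl | rfl
  · exact ⟨b, hab.symm, hiff⟩
  · exact ⟨a, hab, fun u => (hiff u).trans or_comm⟩

theorem exists_isUnrolling [Fintype Y] (hdeg : ∀ y, F.degree y = 2) (y : Y) :
    ∃ p, IsUnrolling F p ∧ p 0 = y := by
  choose other hne hadj using fun d : F.Dart => exists_ne_adj_iff (hdeg d.snd) d.adj.symm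
  let next (d : F.Dart) : F.Dart := ⟨⟨d.snd, other d⟩, (hadj d _).2 (.inr rfl)⟩
  have hinj : next.Injective := fun d e hde => by
    have hsnd : d.snd = e.snd := congrArg (·.fst) hde
    have hfst := ((hadj e d.fst).1 (hsnd ▸ d.adj.symm)).resolve_right
      ((congrArg (·.snd) hde : other d = other e) ▸ (hne d).symm)
    exact SimpleGraph.Dart.ext _ _ (Prod.ext hfst hsnd)
  let σ : Equiv.Perm F.Dart := Equiv.ofBijective next (Finite.injective_iff_bijective.1 hinj)
  obtain ⟨z, hz⟩ := (F.degree_pos_iff_exists_adj y).1 (by rw [hdeg]; norm_num)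
  let d (i : ℤ) : F.Dart := (σ ^ i) ⟨⟨y, z⟩, hz⟩
  have hd (i : ℤ) : d (i + 1) = next (d i) := by
    simp only [d, add_comm i, _root_.zpow_one_add]
    rfl
  have hsnd (i : ℤ) : (d i).snd = (d (i + 1)).fst := by rw [hd]
  have hother (i : ℤ) : other (d (i - 1)) = (d (i + 1)).fst := by
    rw [← hsnd, ← sub_add_cancel i 1, hd, sub_add_cancel]
  refine ⟨fun i => (d i).fst, ⟨fun i u => ?_, fun i => ?_⟩, rfl⟩
  · rw [← hother, ← hadj, hsnd, sub_add_cancel]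
  · rw [← hother]
    exact (hne _).symm

/-- The map `p` unrolls a connected component of `F` that is a cycle of length `n`. -/
structure IsCycleCover (F : SimpleGraph Y) (n : ℕ) (p : ℤ → Y) : Prop extends IsUnrolling F p where
  three_le : 3 ≤ n
  eq_iff : ∀ i j, p i = p j ↔ (n : ℤ) ∣ i - j

theorem exists_isCycleCover [Fintype Y] (hdeg : ∀ y, F.degree y = 2) (y : Y) :
    ∃ n p, IsCycleCover F n p ∧ p 0 = y := by
  obtain ⟨p, hp, h0⟩ := exists_isUnrolling hdeg y
  obtain ⟨n, hn, hiff⟩ := hp.exists_eq_iff_dvd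
  exact ⟨n, p, ⟨hp, hn, hiff⟩, h0⟩

theorem IsCycleCover.apply_val [NeZero n] (hp : IsCycleCover F n p) (i : ℤ) :
    p ((i : ZMod n).val : ℤ) = p i := by
  rw [hp.eq_iff]
  exact (ZMod.intCast_eq_intCast_iff_dvd_sub i _ n).1 (by simp)

end CycleCover

section CyclePoints

open Classical

variable {Y : Type*} {F : SimpleGraph Y} {n : ℕ} {p : ℤ → Y}

/-- The vertices of the cycle of length `n` unrolled by `p`. -/
noncomputable def cyclePoints (n : ℕ) (p : ℤ → Y) : Finset Y :=
  (Finset.range n).image fun i : ℕ => p i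

theorem AdjClosed.apply_mem {P : Finset Y} (hP : AdjClosed F P) (hp : IsUnrolling F p) {i : ℤ}
    (hi : p i ∈ P) (j : ℤ) : p j ∈ P := by
  suffices h : ∀ t : ℤ, p (i + t) ∈ P by simpa using h (j - i)
  intro t
  induction t with
  | zero => simpa using hi
  | succ t ih => exact hP _ ih _ ((hp.adj_iff _ _).2 (.inr (by rw [add_assoc])))
  | pred t ih => exact hP _ ih _ ((hp.adj_iff _ _).2 (.inl (by rw [add_sub_assoc])))

namespace IsCycleCover

theorem comp_add (h : IsCycleCover F n p) (c : ℤ) : IsCycleCover F n fun i => p (c + i) :=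
  ⟨h.toIsUnrolling.comp_add c, h.three_le, fun i j => by rw [h.eq_iff, add_sub_add_left_eq_sub]⟩

theorem comp_sub (h : IsCycleCover F n p) (c : ℤ) : IsCycleCover F n fun i => p (c - i) :=
  ⟨h.toIsUnrolling.comp_sub c, h.three_le, fun i j => by
    rw [h.eq_iff, sub_sub_sub_cancel_left, dvd_sub_comm]⟩

theorem mem_cyclePoints (h : IsCycleCover F n p) {y : Y} : y ∈ cyclePoints n p ↔ ∃ i, p i = y := by
  have hn : (0 : ℤ) < n := by have := h.three_le; lia
  simp only [cyclePoints, Finset.mem_image, Finset.mem_range]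
  refine ⟨fun ⟨i, _, hi⟩ => ⟨i, hi⟩, fun ⟨i, hi⟩ => ⟨(i % n).toNat, ?_, ?_⟩⟩
  · have := Int.emod_lt_of_pos i hn
    have := Int.emod_nonneg i hn.ne'
    lia
  · rw [Int.toNat_of_nonneg (Int.emod_nonneg i hn.ne'), ← hi, h.eq_iff, dvd_sub_comm]
    exact Int.dvd_self_sub_emod

theorem injOn (h : IsCycleCover F n p) : Set.InjOn (fun i : ℕ => p i) (Finset.range n) := by
  intro i hi j hj hij
  rw [Finset.mem_coe, Finset.mem_range] at hi hj
  have hdvd := (h.eq_iff i j).1 hij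
  have := Int.eq_zero_of_abs_lt_dvd hdvd (by rw [abs_lt]; lia)
  lia

theorem sum_cyclePoints (h : IsCycleCover F n p) (f : Y → ℤ) :
    ∑ y ∈ cyclePoints n p, f y = ∑ i ∈ Finset.range n, f (p i) :=
  Finset.sum_image h.injOn

theorem card_cyclePoints (h : IsCycleCover F n p) : (cyclePoints n p).card = n := by
  rw [cyclePoints, Finset.card_image_of_injOn h.injOn, Finset.card_range]

theorem adjClosed_cyclePoints (h : IsCycleCover F n p) : AdjClosed F (cyclePoints n p) := by
  intro y hy z hyz
  rw [h.mem_cyclePoints] at hy ⊢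
  obtain ⟨i, rfl⟩ := hy
  rcases (h.adj_iff i z).1 hyz with rfl | rfl
  exacts [⟨_, rfl⟩, ⟨_, rfl⟩]

theorem length_le_card (hp : IsCycleCover F n p) {P : Finset Y} (hP : AdjClosed F P)
    {i : ℤ} (hi : p i ∈ P) : n ≤ P.card := by
  rw [← hp.card_cyclePoints]
  refine Finset.card_le_card fun y hy => ?_
  obtain ⟨j, rfl⟩ := hp.mem_cyclePoints.1 hy
  exact hP.apply_mem hp.toIsUnrolling hi j

theorem length_unique {m : ℕ} {q : ℤ → Y} (hp : IsCycleCover F n p) (hq : IsCycleCover F m q)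
    {i j : ℤ} (heq : p i = q j) : n = m :=
  le_antisymm
    (hq.card_cyclePoints ▸ hp.length_le_card hq.adjClosed_cyclePoints
      (hq.mem_cyclePoints.2 ⟨j, heq.symm⟩))
    (hp.card_cyclePoints ▸ hq.length_le_card hp.adjClosed_cyclePoints
      (hp.mem_cyclePoints.2 ⟨i, heq⟩))

variable [Fintype Y]

theorem sum_adjMatrix_mul (h : IsCycleCover F n p) (i : ℤ) (f : Y → ℤ) :
    ∑ z, F.adjMatrix ℤ (p i) z * f z = f (p (i - 1)) + f (p (i + 1)) := by
  have hfilter : (Finset.univ.filter fun z => F.Adj (p i) z) = {p (i - 1), p (i + 1)} := by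
    ext z
    simp [h.adj_iff]
  simp only [SimpleGraph.adjMatrix_apply, ite_mul, one_mul, zero_mul]
  rw [← Finset.sum_filter, hfilter, Finset.sum_pair (h.ne i)]

end IsCycleCover

variable [Fintype Y] {X : Type*} [Fintype X] {K : SimpleGraph X} {N : Matrix Y X ℤ}
  {m : ℕ} {r : ℤ → X}

namespace HasCycleGram

theorem gram_cover (h : HasCycleGram F N) (hp : IsCycleCover F n p) (i : ℤ) (z : Y) :
    ∑ x, N (p i) x * N z x = 2 + 4 * (if p i = z then 1 else 0) -
      (if p (i - 1) = z then 1 else 0) - (if p (i + 1) = z then 1 else 0) -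
      (if p (i - 2) = z then 1 else 0) - (if p (i + 2) = z then 1 else 0) := by
  have hadj (i : ℤ) : F.adjMatrix ℤ (p i) z =
      (if p (i - 1) = z then 1 else 0) + (if p (i + 1) = z then 1 else 0) := by
    rw [← hp.sum_adjMatrix_mul i fun u => if u = z then 1 else 0]
    simp
  rw [h.gram, Matrix.mul_apply, hp.sum_adjMatrix_mul, hadj, hadj, hadj]
  ring_nf
  split_ifs <;> ring

theorem gram_le_two (h : HasCycleGram F N) {y z : Y} (hyz : y ≠ z) :
    ∑ x, N y x * N z x ≤ 2 := by
  rw [h.gram, if_neg hyz, Matrix.mul_apply]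
  have hsq : 0 ≤ ∑ w, F.adjMatrix ℤ y w * F.adjMatrix ℤ w z :=
    Finset.sum_nonneg fun w _ => mul_nonneg (adjMatrix_nonneg F _ _) (adjMatrix_nonneg F _ _)
  linarith [adjMatrix_nonneg F y z]

end HasCycleGram

namespace IsWavePair

theorem card_left (h : IsWavePair F K N) : Fintype.card Y = 18 := h.right.card_columns

theorem wave (h : IsWavePair F K N) (hp : IsCycleCover F n p) (hr : IsCycleCover K m r) (i j : ℤ) :
    N (p (i - 1)) (r j) + N (p (i + 1)) (r j) = N (p i) (r (j - 1)) + N (p i) (r (j + 1)) := by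
  rw [← hp.sum_adjMatrix_mul i fun y => N y (r j), h.comm, hr.sum_adjMatrix_mul]

theorem wave_nat (h : IsWavePair F K N) (hp : IsCycleCover F n p) (hr : IsCycleCover K m r)
    (k : ℕ) (i j : ℤ) : N (p (i - k)) (r j) + N (p (i + k)) (r j) =
      N (p i) (r (j - k)) + N (p i) (r (j + k)) := by
  induction k using Nat.twoStepInduction generalizing i j with
  | zero => simp
  | one => exact_mod_cast h.wave hp hr i j
  | more k ih0 ih1 =>
    have h1 := ih1 (i - 1) j
    have h2 := ih1 (i + 1) j
    have h3 := ih0 i j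
    have h4 := h.wave hp hr i (j - (k + 1))
    have h5 := h.wave hp hr i (j + (k + 1))
    push_cast at *
    ring_nf at *
    linarith

/-- A period `2k` along the rows lets a shift by `k` jump between rows and columns, because
`N (p (i + k)) (r j)` is the mean of two entries equal to `0` or `1`. -/
theorem apply_add_eq (h : IsWavePair F K N) (hp : IsCycleCover F n p) (hr : IsCycleCover K m r)
    {k : ℕ} (hk : n ∣ 2 * k) (i j : ℤ) : N (p i) (r (j + k)) = N (p (i + k)) (r j) := by
  have hperiod : p (i - k) = p (i + k) := by
    rw [hp.eq_iff, dvd_sub_comm]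
    exact (Int.natCast_dvd_natCast.2 hk).trans (dvd_of_eq (by push_cast; ring))
  have hmean := h.wave_nat hp hr k i j
  rw [hperiod] at hmean
  rcases h.left.entry (p i) (r (j + k)) with h1 | h1 <;>
    rcases h.left.entry (p i) (r (j - k)) with h2 | h2 <;>
    rcases h.left.entry (p (i + k)) (r j) with h3 | h3 <;> rw [h1, h2, h3] at hmean <;> lia

theorem card_le_six (h : IsWavePair F K N) {P : Finset Y} (hP : AdjClosed F P) {x x' : X}
    (hxx' : x ≠ x') (heq : ∀ y ∈ P, N y x = N y x') : P.card ≤ 6 := by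
  have hagree : ∑ y ∈ P, N y x = ∑ y ∈ P, N y x * N y x' :=
    Finset.sum_congr rfl fun y hy => by rw [← heq y hy, h.left.mul_self_apply]
  have hle : ∑ y ∈ P, N y x * N y x' ≤ ∑ y, N y x * N y x' :=
    Finset.sum_le_univ_sum_of_nonneg fun y => mul_nonneg (h.left.nonneg _ _) (h.left.nonneg _ _)
  have htwo := h.right.gram_le_two hxx'
  have hthree := h.left.three_mul_sum_eq_card hP x
  simp only [Matrix.transpose_apply] at htwo
  lia

end IsWavePair

end CyclePoints

section CycleFamily

open Classical

variable {Y : Type*} {F : SimpleGraph Y} {n : ℕ}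

/-- Unrollings of distinct connected components of `F`, the `a`-th one a cycle of length `n a`. -/
structure IsCycleFamily {ι : Type*} (F : SimpleGraph Y) (n : ι → ℕ) (p : ι → ℤ → Y) : Prop where
  cover : ∀ a, IsCycleCover F (n a) (p a)
  disjoint : ∀ {a b i j}, p a i = p b j → a = b

theorem IsCycleFamily.comp {ι κ : Type*} {n : ι → ℕ} {p : ι → ℤ → Y} (h : IsCycleFamily F n p)
    {f : κ → ι} (hf : f.Injective) : IsCycleFamily F (n ∘ f) (p ∘ f) :=
  ⟨fun a => h.cover (f a), fun heq => hf (h.disjoint heq)⟩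

theorem IsCycleFamily.injective {ι : Type*} {n : ι → ℕ} {p : ι → ℤ → Y} (h : IsCycleFamily F n p) :
    Function.Injective fun v : Σ a, Fin (n a) => p v.1 (v.2 : ℕ) := by
  rintro ⟨a, i⟩ ⟨b, j⟩ hij
  obtain rfl := h.disjoint hij
  congr
  exact Fin.ext ((h.cover a).injOn (by simp) (by simp) hij)

theorem IsCycleFamily.sum_eq [Fintype Y] {ι : Type*} [Fintype ι] {n : ι → ℕ} {p : ι → ℤ → Y}
    (h : IsCycleFamily F n p) (hcard : ∑ a, n a = Fintype.card Y) (f : Y → ℤ) :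
    ∑ y, f y = ∑ a, ∑ i ∈ Finset.range (n a), f (p a i) := by
  have hbij : Function.Bijective fun v : Σ a, Fin (n a) => p v.1 (v.2 : ℕ) :=
    (Fintype.bijective_iff_injective_and_card _).2 ⟨h.injective, by simp [hcard]⟩
  rw [← hbij.sum_comp, Fintype.sum_sigma]
  exact Finset.sum_congr rfl fun a _ => Fin.sum_univ_eq_sum_range (fun i : ℕ => f (p a i)) (n a)

theorem exists_isCycleFamily [Fintype Y] (hdeg : ∀ y, F.degree y = 2) {S : Finset Y}
    (hS : AdjClosed F S) (hlength : ∀ m p, IsCycleCover F m p → p 0 ∈ S → m = n) :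
    ∃ k, S.card = k * n ∧
      ∃ p : Fin k → ℤ → Y, IsCycleFamily F (fun _ => n) p ∧ ∀ a i, p a i ∈ S := by
  induction S using Finset.strongInduction with
  | H S ih =>
    rcases S.eq_empty_or_nonempty with rfl | ⟨y, hy⟩
    · exact ⟨0, by simp, Fin.elim0, ⟨fun a => a.elim0, fun {a} => a.elim0⟩, fun a => a.elim0⟩
    obtain ⟨m, q, hq, rfl⟩ := exists_isCycleCover hdeg y
    obtain rfl := hlength m q hq hy
    have hsub : cyclePoints m q ⊆ S := fun z hz => by
      obtain ⟨i, rfl⟩ := hq.mem_cyclePoints.1 hz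
      exact hS.apply_mem hq.toIsUnrolling hy i
    have hmem : q 0 ∈ cyclePoints m q := hq.mem_cyclePoints.2 ⟨0, rfl⟩
    obtain ⟨k, hcard, p, hp, hpS⟩ := ih (S \ cyclePoints m q)
      (Finset.sdiff_ssubset hsub ⟨_, hmem⟩) (hS.sdiff hq.adjClosed_cyclePoints)
      fun m p hp hp0 => hlength m p hp (Finset.mem_sdiff.1 hp0).1
    have hne (a i j) : p a i ≠ q j := fun heq =>
      (Finset.mem_sdiff.1 (hpS a i)).2 (hq.mem_cyclePoints.2 ⟨j, heq.symm⟩)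
    have hle := Finset.card_le_card hsub
    rw [Finset.card_sdiff_of_subset hsub] at hcard
    rw [hq.card_cyclePoints] at hcard hle
    refine ⟨k + 1, by rw [add_mul]; lia, Fin.cons q p, ⟨?_, ?_⟩, ?_⟩
    · exact Fin.cases hq hp.cover
    · intro a b i j
      cases a using Fin.cases <;> cases b using Fin.cases <;>
        simp only [Fin.cons_zero, Fin.cons_succ]
      · exact fun _ => trivial
      · exact fun heq => absurd heq.symm (hne _ _ _)
      · exact fun heq => absurd heq (hne _ _ _)
      · exact fun heq => congrArg Fin.succ (hp.disjoint heq)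
    · exact Fin.cases (fun i => hS.apply_mem hq.toIsUnrolling hy i)
        fun a i => (Finset.mem_sdiff.1 (hpS a i)).1

end CycleFamily

section CycleLengths

open Classical

variable {Y : Type*} [Fintype Y] {F : SimpleGraph Y} {n : ℕ} {p : ℤ → Y}
  {X : Type*} [Fintype X] {K : SimpleGraph X} {N : Matrix Y X ℤ} {m : ℕ} {r : ℤ → X}

/-- The vertices of the connected components of `K` that are triangles. -/
noncomputable def trianglePoints (K : SimpleGraph X) : Finset X :=
  Finset.univ.filter fun x => ∃ r, IsCycleCover K 3 r ∧ r 0 = x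

theorem mem_trianglePoints {x : X} : x ∈ trianglePoints K ↔ ∃ r, IsCycleCover K 3 r ∧ r 0 = x := by
  simp [trianglePoints]

theorem IsCycleCover.apply_mem_trianglePoints (hr : IsCycleCover K 3 r) (j : ℤ) :
    r j ∈ trianglePoints K :=
  mem_trianglePoints.2 ⟨_, hr.comp_add j, by rw [add_zero]⟩

theorem adjClosed_trianglePoints (K : SimpleGraph X) : AdjClosed K (trianglePoints K) := by
  intro x hx w hxw
  obtain ⟨r, hr, rfl⟩ := mem_trianglePoints.1 hx
  rcases (hr.adj_iff 0 w).1 hxw with rfl | rfl <;> exact hr.apply_mem_trianglePoints _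

namespace IsWavePair

theorem three_dvd_card (h : IsWavePair F K N) {P : Finset Y} (hP : AdjClosed F P) : 3 ∣ P.card := by
  obtain ⟨x⟩ : Nonempty X := Fintype.card_pos_iff.1 (by rw [h.left.card_columns]; norm_num)
  exact_mod_cast Dvd.intro _ (h.left.three_mul_sum_eq_card hP x)

theorem length_eq (h : IsWavePair F K N) {C : Finset Y} (hC : AdjClosed F C) (hcard : C.card = 9)
    (hp : IsCycleCover F n p) : n = 3 ∨ n = 6 ∨ n = 9 := by
  have hthree := h.three_dvd_card hp.adjClosed_cyclePoints
  rw [hp.card_cyclePoints] at hthree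
  have hle : n ≤ 9 := by
    by_cases hmem : p 0 ∈ C
    · exact hcard ▸ hp.length_le_card hC hmem
    · have hcompl : (Finset.univ \ C).card = 9 := by
        rw [Finset.card_univ_sdiff, h.card_left, hcard]
      have hclosed : AdjClosed F (Finset.univ \ C) := (adjClosed_univ _).sdiff hC
      exact hcompl ▸ hp.length_le_card hclosed (i := 0) (by simpa using hmem)
  have := hp.three_le
  lia

theorem length_dvd_nine (h : IsWavePair F K N) (hp : IsCycleCover F 9 p)
    (hr : IsCycleCover K m r) : m ∣ 9 := by
  by_contra hdvd
  have hne : r 0 ≠ r (0 + (9 : ℕ)) := fun heq =>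
    hdvd (by exact_mod_cast (by simpa using (hr.eq_iff _ _).1 heq : (m : ℤ) ∣ 9))
  refine absurd (h.card_le_six hp.adjClosed_cyclePoints hne fun y hy => ?_)
    (by rw [hp.card_cyclePoints]; norm_num)
  obtain ⟨i, rfl⟩ := hp.mem_cyclePoints.1 hy
  rw [h.apply_add_eq hp hr (by norm_num), (hp.eq_iff (i + (9 : ℕ)) i).2 (by simp)]

theorem length_dvd_six (h : IsWavePair F K N) (hF : ∀ n p, IsCycleCover F n p → n ∣ 6)
    (hr : IsCycleCover K m r) : m ∣ 6 := by
  by_contra hdvd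
  have hne : r 0 ≠ r (0 + (6 : ℕ)) := fun heq =>
    hdvd (by exact_mod_cast (by simpa using (hr.eq_iff _ _).1 heq : (m : ℤ) ∣ 6))
  refine absurd (h.card_le_six (adjClosed_univ _) hne
    fun y _ => ?_) (by rw [Finset.card_univ, h.card_left]; norm_num)
  obtain ⟨n, p, hp, rfl⟩ := exists_isCycleCover h.left.degree_eq y
  have hn := hF n p hp
  rw [h.apply_add_eq hp hr (hn.mul_left 2),
    (hp.eq_iff (0 + (6 : ℕ)) 0).2 (by simpa using Int.natCast_dvd_natCast.2 hn)]

/-- Rows at distance three in a cycle that is not a triangle agree on all triangles of `K`. -/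
theorem card_trianglePoints_le_six (h : IsWavePair F K N) (hp : IsCycleCover F n p) (hn : n ≠ 3) :
    (trianglePoints K).card ≤ 6 := by
  have hne : p 0 ≠ p (0 + (3 : ℕ)) := fun heq => by
    have hdvd : n ∣ 3 := by exact_mod_cast (by simpa using (hp.eq_iff _ _).1 heq : (n : ℤ) ∣ 3)
    exact hn (le_antisymm (Nat.le_of_dvd (by norm_num) hdvd) hp.three_le)
  refine h.swap.card_le_six (adjClosed_trianglePoints K) hne fun x hx => ?_
  obtain ⟨r, hr, rfl⟩ := mem_trianglePoints.1 hx
  rw [h.swap.apply_add_eq hr hp (by norm_num), (hr.eq_iff (0 + (3 : ℕ)) 0).2 (by simp)]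

theorem eq_nine_of_dvd_nine (h : IsWavePair F K N) (hp : IsCycleCover F 9 p)
    (hK : ∀ m r, IsCycleCover K m r → m ∣ 9) (hr : IsCycleCover K m r) : m = 9 := by
  have hlength {m r} (hr : IsCycleCover K m r) : m = 3 ∨ m = 9 := by
    have hmem : m ∈ Nat.divisors 9 := by simpa using hK m r hr
    have := hr.three_le
    rw [show Nat.divisors 9 = {1, 3, 9} from by decide] at hmem
    simp only [Finset.mem_insert, Finset.mem_singleton] at hmem
    lia
  refine (hlength hr).resolve_left fun hm => ?_
  subst hm
  have hsix := h.card_trianglePoints_le_six hp (by norm_num)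
  have hthree := hr.length_le_card (adjClosed_trianglePoints K) (hr.apply_mem_trianglePoints 0)
  have hclosed : AdjClosed K (Finset.univ \ trianglePoints K) :=
    (adjClosed_univ _).sdiff (adjClosed_trianglePoints K)
  obtain ⟨k, hcard, -⟩ := exists_isCycleFamily h.right.degree_eq (n := 9) hclosed
    fun m' r' hr' hmem => (hlength hr').resolve_left fun hm' => by
      subst hm'
      exact (Finset.mem_sdiff.1 hmem).2 (hr'.apply_mem_trianglePoints 0)
  rw [Finset.card_univ_sdiff, h.left.card_columns] at hcard
  lia

end IsWavePair

end CycleLengths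

section NineCycles

open Classical

variable {Y : Type*} [Fintype Y] {F : SimpleGraph Y} {n : ℕ} {p : ℤ → Y}
  {X : Type*} [Fintype X] {K : SimpleGraph X} {N : Matrix Y X ℤ} {m : ℕ} {r : ℤ → X}

namespace IsWavePair

theorem ne_along_diagonal (h : IsWavePair F K N) (hp : IsCycleCover F n p)
    (hr : IsCycleCover K m r) {i j : ℤ} (hne : N (p i) (r (j + 1)) ≠ N (p (i + 1)) (r j)) (t : ℤ) :
    N (p (i + t)) (r (j + t + 1)) ≠ N (p (i + t + 1)) (r (j + t)) := by
  induction t with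
  | zero => simpa using hne
  | succ t ih =>
    have hw := h.wave hp hr (i + t + 1) (j + t + 1)
    contrapose! ih
    simp only [add_sub_cancel_right, ← add_assoc] at hw ih
    linarith
  | pred t ih =>
    have hw := h.wave hp hr (i + -t) (j + -t)
    contrapose! ih
    simp only [sub_add_cancel, ← add_sub_assoc] at hw ih
    linarith

/-- A `0/1` solution of the wave equation cannot locally move in both directions, and for an odd
period the left-moving and the right-moving characteristics meet. -/
theorem forall_eq_or_forall_eq (h : IsWavePair F K N) (hp : IsCycleCover F n p)
    (hr : IsCycleCover K n r) (hn : Odd n) :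
    (∀ i j, N (p i) (r (j + 1)) = N (p (i + 1)) (r j)) ∨
      ∀ i j, N (p i) (r (j - 1)) = N (p (i + 1)) (r j) := by
  by_contra! hne
  obtain ⟨⟨i₀, j₀, h₀⟩, i₁, j₁, h₁⟩ := hne
  obtain ⟨k, rfl⟩ := hn
  set d := i₀ - j₀ - i₁ + j₁
  set s := (k + 1) * d
  have hforward := h.ne_along_diagonal hp hr h₀ (i₁ + s - i₀)
  have hbackward := h.ne_along_diagonal hp (hr.comp_sub 0) (j := -j₁)
    (by simpa only [sub_eq_add_neg, zero_add, neg_add, neg_neg] using h₁) s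
  simp only [zero_sub, neg_add, neg_neg, ← sub_eq_add_neg] at hbackward
  have hperiod (e : ℤ) : r (j₀ + (i₁ + s - i₀) + e) = r (j₁ - s + e) :=
    (hr.eq_iff _ _).2 ⟨d, by simp only [s, d]; push_cast; ring⟩
  have hzero := hperiod 0
  simp only [add_zero] at hzero
  rw [add_sub_cancel, hperiod, hzero] at hforward
  have hw := h.wave hp hr (i₁ + s) (j₁ - s)
  rcases h.left.entry (p (i₁ + s)) (r (j₁ - s + 1)) with h2 | h2 <;>
    rcases h.left.entry (p (i₁ + s)) (r (j₁ - s - 1)) with h3 | h3 <;>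
    rcases h.left.entry (p (i₁ + s + 1)) (r (j₁ - s)) with h4 | h4 <;>
    rcases h.left.entry (p (i₁ + s - 1)) (r (j₁ - s)) with h5 | h5 <;>
    rw [h2, h3, h4, h5] at hw <;> lia

theorem exists_direction (h : IsWavePair F K N) (hp : IsCycleCover F n p)
    (hr : IsCycleCover K n r) (hn : Odd n) :
    ∃ ε : ℤ, (ε = 1 ∨ ε = -1) ∧ ∀ i j, N (p i) (r j) = N (p (i + ε * j)) (r 0) := by
  rcases h.forall_eq_or_forall_eq hp hr hn with hdir | hdir
  · refine ⟨1, .inl rfl, fun i j => ?_⟩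
    induction j generalizing i with
    | zero => simp
    | succ j ih => rw [hdir, ih]; ring_nf
    | pred j ih =>
      rw [← sub_add_cancel i 1, ← hdir, sub_add_cancel, ih]; ring_nf
  · refine ⟨-1, .inr rfl, fun i j => ?_⟩
    induction j generalizing i with
    | zero => simp
    | succ j ih => rw [← sub_add_cancel i 1, ← hdir, add_sub_cancel_right, ih]; ring_nf
    | pred j ih => rw [hdir, ih]; ring_nf

end IsWavePair

end NineCycles

section NineBlocks

open Classical

/-- The number of pairs in `s × u` of the form `(v, t + e v)`: the inner product of rows `0` and `t`
in two blocks of period nine with first columns `s` and `u`. -/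
def crossCount (s u : Finset (ZMod 9)) (e t : ZMod 9) : ℕ :=
  (s.filter fun v => t + e * v ∈ u).card

theorem crossCount_neg (s : Finset (ZMod 9)) (t : ZMod 9) :
    crossCount s s 1 (-t) = crossCount s s 1 t := by
  refine Finset.card_bij' (fun v _ => -t + v) (fun v _ => t + v) ?_ ?_ ?_ ?_ <;>
    simp +contextual

set_option synthInstance.maxHeartbeats 400000 in
-- The nested bounded quantifiers make the `Decidable` instance deep.
set_option synthInstance.maxSize 1000 in
theorem crossCount_pattern : ∀ s ∈ Finset.univ.powersetCard 3, ∀ u ∈ Finset.univ.powersetCard 3,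
    (∀ t ∈ [1, 2, 3], crossCount s s 1 t + crossCount u u 1 t = if t = 3 then 2 else 1) →
    ∀ e ∈ [1, -1],
      (∀ t, ¬(crossCount s u e t = 2 ∧ crossCount s u e (t + 1) = 2)) ∧
      (∃ t, crossCount s u e t = 0 ∧
        (crossCount s u e (t + 1) = 0 ∨ crossCount s u e (t + 3) = 0)) ∧
      ((∃ t, crossCount s u e t = 2 ∧ crossCount s u e (t + 3) = 2) →
        ∃ t, crossCount s u e t = 0 ∧ crossCount s u e (t + 1) = 0) := by
  decide +kernel

theorem exists_crossCount_add_ne_two {s u : Fin 2 → Finset (ZMod 9)} {e : Fin 2 → ZMod 9}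
    (hs : ∀ b, s b ∈ Finset.univ.powersetCard 3) (hu : ∀ b, u b ∈ Finset.univ.powersetCard 3)
    (hauto : ∀ b, ∀ t ∈ [1, 2, 3], crossCount (s b) (s b) 1 t + crossCount (u b) (u b) 1 t =
      if t = 3 then 2 else 1) (he : ∀ b, e b ∈ [1, -1]) :
    ∃ t, ∑ b, crossCount (s b) (u b) (e b) t ≠ 2 := by
  by_contra! hsum
  simp only [Fin.sum_univ_two] at hsum
  have hpattern (b) := crossCount_pattern _ (hs b) _ (hu b) (hauto b) _ (he b)
  obtain ⟨htwo, ⟨t, h0, h1 | h3⟩, -⟩ := hpattern 0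
  · exact (hpattern 1).1 t ⟨by have := hsum t; lia, by have := hsum (t + 1); lia⟩
  · obtain ⟨t', h0', h1'⟩ := (hpattern 1).2.2
      ⟨t, by have := hsum t; lia, by have := hsum (t + 3); lia⟩
    exact htwo t' ⟨by have := hsum t'; lia, by have := hsum (t' + 1); lia⟩

theorem sum_range_cast {n : ℕ} [NeZero n] (g : ZMod n → ℤ) :
    ∑ j ∈ Finset.range n, g ((j : ℤ) : ZMod n) = ∑ z, g z := by
  rw [← Fin.sum_univ_eq_sum_range fun j : ℕ => g ((j : ℤ) : ZMod n)]
  refine Fintype.sum_bijective (fun j : Fin n => ((j : ℕ) : ZMod n)) ?_ _ _ fun j => by simp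
  refine (Fintype.bijective_iff_injective_and_card _).2 ⟨fun i j hij => ?_, by simp⟩
  rw [ZMod.natCast_eq_natCast_iff'] at hij
  exact Fin.ext (by simpa [Nat.mod_eq_of_lt] using hij)

theorem sum_range_ite_mul_ite {s u : Finset (ZMod 9)} {e : ZMod 9} (he : e ∈ [1, -1])
    (e' t : ZMod 9) :
    ∑ j ∈ Finset.range 9, (if e * ((j : ℤ) : ZMod 9) ∈ s then 1 else 0) *
      (if t + e' * ((j : ℤ) : ZMod 9) ∈ u then 1 else 0) = (crossCount s u (e * e') t : ℤ) := by
  have hinv : Function.Involutive (e * ·) := fun z => by fin_cases he <;> simp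
  rw [sum_range_cast fun z => (if e * z ∈ s then 1 else 0) * (if t + e' * z ∈ u then 1 else 0),
    ← hinv.bijective.sum_comp]
  simp only [hinv _, ite_mul, one_mul, zero_mul, ← ite_and, mul_left_comm e', ← mul_assoc]
  rw [Finset.sum_boole, crossCount, Finset.filter_and, Finset.filter_univ_mem,
    Finset.inter_filter, Finset.inter_univ]

variable {Y : Type*} [Fintype Y] {F : SimpleGraph Y} {p : ℤ → Y}
  {X : Type*} [Fintype X] {K : SimpleGraph X} {N : Matrix Y X ℤ} {r : ℤ → X}

namespace IsWavePair

theorem exists_block (h : IsWavePair F K N) (hp : IsCycleCover F 9 p) (hr : IsCycleCover K 9 r) :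
    ∃ s ∈ (Finset.univ : Finset (ZMod 9)).powersetCard 3, ∃ e : ZMod 9, e ∈ [1, -1] ∧
      ∀ i j : ℤ, N (p i) (r j) = if (i : ZMod 9) + e * j ∈ s then 1 else 0 := by
  obtain ⟨ε, hε, hdir⟩ := h.exists_direction hp hr (by decide)
  let s : Finset (ZMod 9) := Finset.univ.filter fun v => N (p v.val) (r 0) = 1
  have hcolumn (i : ℤ) : N (p i) (r 0) = if (i : ZMod 9) ∈ s then 1 else 0 := by
    simp only [s, Finset.mem_filter, Finset.mem_univ, true_and, hp.apply_val]
    rcases h.left.entry (p i) (r 0) with h0 | h0 <;> simp [h0]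
  refine ⟨s, ?_, ε, by rcases hε with rfl | rfl <;> simp, fun i j => ?_⟩
  · have hcard := h.left.three_mul_sum_eq_card hp.adjClosed_cyclePoints (r 0)
    simp only [hp.sum_cyclePoints, hp.card_cyclePoints, hcolumn] at hcard
    rw [sum_range_cast fun z => if z ∈ s then 1 else 0, Finset.sum_boole,
      Finset.filter_univ_mem] at hcard
    rw [Finset.mem_powersetCard_univ]
    lia
  · rw [hdir, hcolumn]
    push_cast
    rfl

theorem crossCount_add_crossCount (h : IsWavePair F K N) {p : Fin 2 → ℤ → Y}
    (hp : IsCycleFamily F (fun _ => 9) p) (hr : IsCycleCover K 9 r)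
    {s : Fin 2 → Finset (ZMod 9)} {e : Fin 2 → ZMod 9} (he : ∀ a, e a ∈ [1, -1])
    (hblock : ∀ a (i j : ℤ), N (p a i) (r j) = if (i : ZMod 9) + e a * j ∈ s a then 1 else 0) :
    ∀ t ∈ [1, 2, 3], crossCount (s 0) (s 0) 1 t + crossCount (s 1) (s 1) 1 t =
      if t = 3 then 2 else 1 := by
  have hcolumns (k : ℤ) (hk : 1 ≤ k ∧ k ≤ 3) :
      ∑ a, crossCount (s a) (s a) 1 k = if k = 3 then 2 else 1 := by
    have hgram := h.right.gram_cover hr 0 (r k)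
    simp only [Matrix.transpose_apply, hr.eq_iff] at hgram
    rw [hp.sum_eq (by simp [h.card_left])] at hgram
    have hblocks (a : Fin 2) : ∑ i ∈ Finset.range 9, N (p a i) (r 0) * N (p a i) (r k) =
        crossCount (s a) (s a) 1 k := by
      have hsymm : crossCount (s a) (s a) 1 (e a * k) = crossCount (s a) (s a) 1 k := by
        have ha := he a
        generalize e a = x at ha ⊢
        fin_cases ha <;> simp [crossCount_neg]
      rw [← hsymm, ← one_mul (1 : ZMod 9), ← sum_range_ite_mul_ite (by simp)]
      exact Finset.sum_congr rfl fun i _ => by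
        rw [hblock, hblock, Int.cast_zero, mul_zero, add_zero, one_mul, add_comm]
    simp only [hblocks] at hgram
    rw [← Nat.cast_inj (R := ℤ)]
    push_cast
    rw [hgram]
    obtain ⟨h1, h3⟩ := hk
    interval_cases k <;> decide
  have h1 := hcolumns 1 (by simp)
  have h2 := hcolumns 2 (by simp)
  have h3 := hcolumns 3 (by simp)
  rw [Fin.sum_univ_two] at h1 h2 h3
  intro t ht
  fin_cases ht
  exacts [h1, h2, h3]

theorem not_isCycleFamily_nine {p : Fin 2 → ℤ → Y} {r : Fin 2 → ℤ → X} (h : IsWavePair F K N)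
    (hp : IsCycleFamily F (fun _ => 9) p) : ¬ IsCycleFamily K (fun _ => 9) r := by
  intro hr
  choose s hs e he hblock using fun a b => h.exists_block (hp.cover a) (hr.cover b)
  have hrows (t : ZMod 9) : ∑ b, crossCount (s 0 b) (s 1 b) (e 0 b * e 1 b) t = 2 := by
    have hgram := h.left.gram_cover (hp.cover 0) 0 (p 1 t.val)
    have hne (i : ℤ) : p 0 i ≠ p 1 t.val := fun heq => absurd (hp.disjoint heq) (by simp)
    have hval : (((t.val : ℕ) : ℤ) : ZMod 9) = t := by simp
    rw [hr.sum_eq (by simp [h.left.card_columns])] at hgram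
    simp only [hne, if_false, hblock, Int.cast_zero, zero_add, hval,
      sum_range_ite_mul_ite (he 0 _)] at hgram
    norm_num at hgram
    exact_mod_cast hgram
  have hsign (b : Fin 2) : e 0 b * e 1 b ∈ [1, -1] := by
    have h0 := he 0 b
    have h1 := he 1 b
    generalize e 0 b = x at *
    generalize e 1 b = y at *
    fin_cases h0 <;> fin_cases h1 <;> simp
  obtain ⟨t, ht⟩ := exists_crossCount_add_ne_two (hs 0) (hs 1) (fun b =>
    h.crossCount_add_crossCount hp (hr.cover b) (fun a => he a b) fun a => hblock a b) hsign
  exact ht (hrows t)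

end IsWavePair

end NineBlocks

section CycleTypes

open Classical

variable {Y : Type*} [Fintype Y] {F : SimpleGraph Y} {n : ℕ} {p : ℤ → Y}
  {X : Type*} [Fintype X] {K : SimpleGraph X} {N : Matrix Y X ℤ} {m : ℕ} {r : ℤ → X}

theorem trianglePoints_eq_univ (hdeg : ∀ y, F.degree y = 2)
    (hF : ∀ n p, IsCycleCover F n p → n = 3) : trianglePoints F = Finset.univ := by
  refine Finset.eq_univ_of_forall fun y => ?_
  obtain ⟨n, p, hp, rfl⟩ := exists_isCycleCover hdeg y
  obtain rfl := hF n p hp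
  exact hp.apply_mem_trianglePoints 0

theorem exists_isCycleFamily_triangles (hdeg : ∀ y, F.degree y = 2) {S : Finset Y}
    (hS : AdjClosed F S) :
    ∃ k, (S ∩ trianglePoints F).card = k * 3 ∧ ∃ p : Fin k → ℤ → Y,
      IsCycleFamily F (fun _ => 3) p ∧ ∀ a i, p a i ∈ S ∩ trianglePoints F := by
  refine exists_isCycleFamily hdeg (fun y hy z hyz => ?_) fun m p hp h0 => ?_
  · rw [Finset.mem_inter] at hy ⊢
    exact ⟨hS y hy.1 z hyz, adjClosed_trianglePoints F y hy.2 z hyz⟩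
  · obtain ⟨q, hq, hq0⟩ := mem_trianglePoints.1 (Finset.mem_inter.1 h0).2
    exact hp.length_unique hq hq0.symm

theorem exists_isCycleFamily_hexagons (hdeg : ∀ y, F.degree y = 2)
    (hlength : ∀ n p, IsCycleCover F n p → n = 3 ∨ n = 6) {S : Finset Y} (hS : AdjClosed F S) :
    ∃ k, (S \ trianglePoints F).card = k * 6 ∧ ∃ p : Fin k → ℤ → Y,
      IsCycleFamily F (fun _ => 6) p ∧ ∀ a i, p a i ∈ S \ trianglePoints F := by
  refine exists_isCycleFamily hdeg (hS.sdiff (adjClosed_trianglePoints F)) fun m p hp h0 =>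
    (hlength m p hp).resolve_left ?_
  rintro rfl
  exact (Finset.mem_sdiff.1 h0).2 (hp.apply_mem_trianglePoints 0)

namespace IsWavePair

theorem not_isCycleCover_nine (h : IsWavePair F K N) : ¬ IsCycleCover F 9 p := by
  intro hp
  have hK {m r} (hr : IsCycleCover K m r) : m = 9 :=
    h.eq_nine_of_dvd_nine hp (fun _ _ => h.length_dvd_nine hp) hr
  obtain ⟨x⟩ : Nonempty X := Fintype.card_pos_iff.1 (by rw [h.left.card_columns]; norm_num)
  obtain ⟨m, r, hr, -⟩ := exists_isCycleCover h.right.degree_eq x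
  obtain rfl := hK hr
  have hF {n q} (hq : IsCycleCover F n q) : n = 9 :=
    h.swap.eq_nine_of_dvd_nine hr (fun _ _ => h.swap.length_dvd_nine hr) hq
  obtain ⟨k, hk, q, hq, -⟩ := exists_isCycleFamily h.left.degree_eq (adjClosed_univ F)
    fun _ _ hp _ => hF hp
  obtain ⟨l, hl, s, hs, -⟩ := exists_isCycleFamily h.right.degree_eq (adjClosed_univ K)
    fun _ _ hp _ => hK hp
  rw [Finset.card_univ, h.card_left] at hk
  rw [Finset.card_univ, h.left.card_columns] at hl
  obtain rfl : k = 2 := by lia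
  obtain rfl : l = 2 := by lia
  exact h.not_isCycleFamily_nine hq hs

theorem length_eq_three_or_six (h : IsWavePair F K N) {C : Finset Y} (hC : AdjClosed F C)
    (hcard : C.card = 9) (hp : IsCycleCover F n p) : n = 3 ∨ n = 6 := by
  rcases h.length_eq hC hcard hp with rfl | rfl | rfl
  exacts [.inl rfl, .inr rfl, (h.not_isCycleCover_nine hp).elim]

theorem length_eq_three_or_six_of_left (h : IsWavePair F K N)
    (hF : ∀ n p, IsCycleCover F n p → n = 3 ∨ n = 6) (hr : IsCycleCover K m r) :
    m = 3 ∨ m = 6 := by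
  have hdvd := h.length_dvd_six (fun n p hp => by rcases hF n p hp with rfl | rfl <;> norm_num) hr
  have hmem : m ∈ Nat.divisors 6 := by simpa using hdvd
  have := hr.three_le
  rw [show Nat.divisors 6 = {1, 2, 3, 6} from by decide] at hmem
  simp only [Finset.mem_insert, Finset.mem_singleton] at hmem
  lia

theorem length_eq_three_of_left (h : IsWavePair F K N) (hF : ∀ n p, IsCycleCover F n p → n = 3)
    (hr : IsCycleCover K m r) : m = 3 := by
  by_contra hm
  have hle := h.swap.card_trianglePoints_le_six hr hm
  rw [trianglePoints_eq_univ h.left.degree_eq hF, Finset.card_univ, h.card_left] at hle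
  lia

theorem exists_hexagon_right (h : IsWavePair F K N) (hK : ∀ m r, IsCycleCover K m r → m = 3 ∨ m = 6)
    (hp : IsCycleCover F 6 p) : ∃ r, IsCycleCover K 6 r := by
  by_contra! hno
  have := h.swap.length_eq_three_of_left (fun m r hr => (hK m r hr).resolve_right fun hm =>
    hno r (hm ▸ hr)) hp
  lia

theorem card_inter_trianglePoints (h : IsWavePair F K N)
    (hF : ∀ n p, IsCycleCover F n p → n = 3 ∨ n = 6) (hr : IsCycleCover K 6 r) {C : Finset Y}
    (hC : AdjClosed F C) (hcard : C.card = 9) : (C ∩ trianglePoints F).card = 3 := by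
  have hsix := h.swap.card_trianglePoints_le_six hr (by norm_num)
  have hle := Finset.card_le_card (Finset.inter_subset_right (s₁ := C) (s₂ := trianglePoints F))
  have hsplit := Finset.card_inter_add_card_sdiff C (trianglePoints F)
  obtain ⟨k, hk, -⟩ := exists_isCycleFamily_triangles h.left.degree_eq hC
  obtain ⟨l, hl, -⟩ := exists_isCycleFamily_hexagons h.left.degree_eq hF hC
  lia

end IsWavePair

end CycleTypes

section TriangleBlocks

/-- The six permutations of `ZMod 3`: three translations, for `k < 3`, and three reflections. -/
def triangleMap (k : Fin 6) (i : ZMod 3) : ZMod 3 :=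
  if k < 3 then (k : ℕ) + i else (k : ℕ) - i

/-- The permutation matrix of `triangleMap k`. -/
def triangleBlock (k : Fin 6) (i j : ZMod 3) : ℤ :=
  if j = triangleMap k i then 1 else 0

theorem exists_triangleMap_eq :
    ∀ g : ZMod 3 → ZMod 3, g.Injective → ∃ k, ∀ i, triangleMap k i = g i := by
  decide

theorem exists_triangleBlock_transpose :
    ∀ k, ∃ l, ∀ i j, triangleBlock k i j = triangleBlock l j i := by
  decide

theorem exists_eq_ite_of_sum_eq_one {ι : Type*} [Fintype ι] [DecidableEq ι] {f : ι → ℤ}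
    (hf : ∀ i, f i = 0 ∨ f i = 1) (hsum : ∑ i, f i = 1) :
    ∃ k, ∀ i, f i = if i = k then 1 else 0 := by
  obtain ⟨k, -, hk⟩ := Finset.exists_ne_zero_of_sum_ne_zero (hsum.trans_ne one_ne_zero)
  have hk1 := (hf k).resolve_left hk
  have hnonneg (i : ι) : 0 ≤ f i := by rcases hf i with h | h <;> simp [h]
  have hrest : ∑ i ∈ Finset.univ.erase k, f i = 0 := by
    linarith [Finset.add_sum_erase Finset.univ f (Finset.mem_univ k)]
  have hzero := (Finset.sum_eq_zero_iff_of_nonneg fun i _ => hnonneg i).1 hrest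
  refine ⟨k, fun i => ?_⟩
  split_ifs with hi
  exacts [hi ▸ hk1, hzero i (by simp [hi])]

open Classical

variable {Y : Type*} [Fintype Y] {F : SimpleGraph Y} {n : ℕ} {p : ℤ → Y}
  {X : Type*} [Fintype X] {K : SimpleGraph X} {N : Matrix Y X ℤ} {r : ℤ → X}

namespace IsWavePair

theorem apply_add_three (h : IsWavePair F K N) (hp : IsCycleCover F n p) (hr : IsCycleCover K 3 r)
    (i j : ℤ) : N (p (i + 3)) (r j) = N (p i) (r j) := by
  have happly := h.swap.apply_add_eq hr hp (k := 3) (by norm_num) j i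
  rw [(hr.eq_iff (j + (3 : ℕ)) j).2 (by simp)] at happly
  exact_mod_cast happly

theorem sum_column_eq_one (h : IsWavePair F K N) (hp : IsCycleCover F n p)
    (hn : n = 3 ∨ n = 6) (hr : IsCycleCover K 3 r) (j : ℤ) :
    N (p 0) (r j) + N (p 1) (r j) + N (p 2) (r j) = 1 := by
  have hsum := h.left.three_mul_sum_eq_card hp.adjClosed_cyclePoints (r j)
  have h0 := h.apply_add_three hp hr 0 j
  have h1 := h.apply_add_three hp hr 1 j
  have h2 := h.apply_add_three hp hr 2 j
  rw [hp.sum_cyclePoints, hp.card_cyclePoints] at hsum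
  rcases hn with rfl | rfl <;> norm_num [Finset.sum_range_succ] at hsum h0 h1 h2 <;> linarith

theorem exists_triangleBlock (h : IsWavePair F K N) (hp : IsCycleCover F n p)
    (hn : n = 3 ∨ n = 6) (hr : IsCycleCover K 3 r) :
    ∃ k, ∀ i j : ℤ, N (p i) (r j) = triangleBlock k i j := by
  have hrow (i : ℤ) : ∑ z : ZMod 3, N (p i) (r z.val) = 1 := by
    have hsum := h.right.three_mul_sum_eq_card hr.adjClosed_cyclePoints (p i)
    rw [hr.sum_cyclePoints, hr.card_cyclePoints] at hsum
    rw [← sum_range_cast]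
    simp only [hr.apply_val, Matrix.transpose_apply] at hsum ⊢
    push_cast at hsum
    linarith
  choose g hg using fun i : ZMod 3 =>
    exists_eq_ite_of_sum_eq_one (fun z => h.left.entry (p i.val) (r z.val)) (hrow i.val)
  have hinj : g.Injective := fun i i' hii' => by
    by_contra hne
    have h1 := hg i (g i)
    have h2 := hg i' (g i)
    have hsum := h.sum_column_eq_one hp hn hr (g i).val
    rw [if_pos rfl] at h1
    rw [if_pos hii'] at h2
    have hnonneg (y : Y) := h.left.nonneg y (r (g i).val)
    have := hnonneg (p 0)
    have := hnonneg (p 1)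
    have := hnonneg (p 2)
    fin_cases i <;> fin_cases i' <;> first | exact hne rfl | (simp [ZMod.val] at *; linarith)
  obtain ⟨k, hk⟩ := exists_triangleMap_eq g hinj
  refine ⟨k, fun i j => ?_⟩
  have hval : N (p (i : ZMod 3).val) (r j) = N (p i) (r j) := by
    have hmod : i = (i : ZMod 3).val + i / 3 * 3 := by rw [ZMod.val_intCast]; lia
    conv_rhs => rw [hmod]
    have hfun : Function.Periodic (fun i => N (p i) (r j)) 3 := fun i => h.apply_add_three hp hr i j
    exact (hfun.int_mul _ _).symm
  rw [← hval, ← hr.apply_val j, hg, triangleBlock, hk]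

theorem exists_aligned (h : IsWavePair F K N) (hp : IsCycleCover F n p)
    (hn : n = 3 ∨ n = 6) (hr : IsCycleCover K 3 r) :
    ∃ s, IsCycleCover K 3 s ∧ (∀ j, ∃ j', s j = r j') ∧
      ∀ i j : ℤ, N (p i) (s j) = triangleBlock 0 i j := by
  obtain ⟨k, hk⟩ := h.exists_triangleBlock hp hn hr
  by_cases hk3 : k < 3
  · refine ⟨_, hr.comp_add (k : ℕ), fun j => ⟨_, rfl⟩, fun i j => ?_⟩
    rw [hk]
    clear hk
    push_cast
    generalize (i : ZMod 3) = x, (j : ZMod 3) = y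
    revert k x y
    decide
  · refine ⟨_, hr.comp_sub (k : ℕ), fun j => ⟨_, rfl⟩, fun i j => ?_⟩
    rw [hk]
    clear hk
    push_cast
    generalize (i : ZMod 3) = x, (j : ZMod 3) = y
    revert k x y
    decide

end IsWavePair

end TriangleBlocks

section TriangleWords

/-- Two words in the permutations `triangleMap k` are balanced if the quotients of corresponding
letters take each point to each point exactly twice. -/
def BalancedWords (u v : List (Fin 6)) : Prop :=
  ∀ i j, (u.zip v).countP (fun x => triangleMap x.1 i = triangleMap x.2 j) = 2

instance (u v : List (Fin 6)) : Decidable (BalancedWords u v) :=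
  inferInstanceAs (Decidable (∀ _, _))

/-- The words starting with `0` and balanced with `000000` and `001122`. -/
def balancedCandidates : List (List (Fin 6)) :=
  [[0, 0, 2, 2, 1, 1], [0, 1, 0, 2, 1, 2], [0, 1, 0, 2, 2, 1], [0, 1, 2, 0, 1, 2],
   [0, 1, 2, 0, 2, 1], [0, 2, 1, 2, 0, 1], [0, 2, 1, 2, 1, 0], [0, 2, 2, 1, 0, 1],
   [0, 2, 2, 1, 1, 0], [0, 3, 2, 5, 1, 4], [0, 3, 2, 5, 4, 1], [0, 3, 5, 2, 1, 4],
   [0, 3, 5, 2, 4, 1], [0, 4, 2, 3, 1, 5], [0, 4, 2, 3, 5, 1], [0, 4, 3, 2, 1, 5],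
   [0, 4, 3, 2, 5, 1], [0, 5, 2, 4, 1, 3], [0, 5, 2, 4, 3, 1], [0, 5, 4, 2, 1, 3],
   [0, 5, 4, 2, 3, 1]]

theorem eq_of_balanced_zero_of_le : ∀ a b, a ≤ b → ∀ c, b ≤ c → ∀ d, c ≤ d → ∀ e, d ≤ e →
    BalancedWords [0, 0, 0, 0, 0, 0] [0, a, b, c, d, e] →
      [a, b, c, d, e] = [0, 1, 1, 2, 2] ∨ [a, b, c, d, e] = [1, 2, 3, 4, 5] := by
  decide +kernel

theorem mem_balancedCandidates : ∀ a b c d e, BalancedWords [0, 0, 0, 0, 0, 0] [0, a, b, c, d, e] →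
    BalancedWords [0, 0, 1, 1, 2, 2] [0, a, b, c, d, e] →
      [0, a, b, c, d, e] ∈ balancedCandidates := by
  decide +kernel

/-- The words starting with `0` and balanced with `000000` and `012345`. -/
def mixedCandidates : List (List (Fin 6)) :=
  [[0, 2, 1, 0, 2, 1], [0, 2, 1, 1, 0, 2], [0, 2, 1, 2, 1, 0], [0, 2, 1, 3, 5, 4],
   [0, 2, 1, 4, 3, 5], [0, 2, 1, 5, 4, 3]]

theorem mem_mixedCandidates : ∀ a b c d e, BalancedWords [0, 0, 0, 0, 0, 0] [0, a, b, c, d, e] →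
    BalancedWords [0, 1, 2, 3, 4, 5] [0, a, b, c, d, e] →
      [0, a, b, c, d, e] ∈ mixedCandidates := by
  decide +kernel

theorem not_balanced_of_mem_mixedCandidates :
    ∀ u ∈ mixedCandidates, ∀ v ∈ mixedCandidates, ¬ BalancedWords u v := by
  decide +kernel

/-- The rows of the array of blocks `triangleBlock k` to which every array between six triangles and
six triangles reduces by renumbering the triangles and their vertices. -/
def canonicalWords : List (List (Fin 6)) :=
  [[0, 0, 0, 0, 0, 0], [0, 0, 1, 1, 2, 2], [0, 1, 0, 2, 1, 2], [0, 1, 2, 0, 2, 1],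
   [0, 2, 1, 2, 0, 1], [0, 2, 2, 1, 1, 0]]

/-- The entry in row `a` and column `b` of an array given by the list of its rows. -/
def arrayEntry (rows : List (List (Fin 6))) (a b : Fin 6) : Fin 6 :=
  (rows.getD a []).getD b 0

/-- The array obtained from the list `rows` by reordering the last three rows, reordering the
columns, and translating each row so that a chosen column becomes `0` is `canonicalWords`. -/
def ReducesToCanonical (rows : List (List (Fin 6))) : Prop :=
  ∃ ρ ∈ ([3, 4, 5] : List (Fin 6)).permutations', ∃ b₀, ∀ b, ∃ b', ∀ a : Fin 6, ∀ i,
    triangleMap (arrayEntry rows ((0 :: 1 :: 2 :: ρ).getD a 0) b')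
      (i - (arrayEntry rows ((0 :: 1 :: 2 :: ρ).getD a 0) b₀ : ℕ)) =
    triangleMap (arrayEntry canonicalWords a b) i

instance (rows : List (List (Fin 6))) : Decidable (ReducesToCanonical rows) :=
  inferInstanceAs (Decidable (∃ _ ∈ _, _))

set_option synthInstance.maxHeartbeats 400000 in
-- The nested bounded quantifiers make the `Decidable` instance deep.
set_option synthInstance.maxSize 1000 in
theorem reducesToCanonical_of_balanced : ∀ v₂ ∈ balancedCandidates,
    ∀ v₃ ∈ balancedCandidates, BalancedWords v₂ v₃ →
    ∀ v₄ ∈ balancedCandidates, BalancedWords v₂ v₄ → BalancedWords v₃ v₄ →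
    ∀ v₅ ∈ balancedCandidates, BalancedWords v₂ v₅ → BalancedWords v₃ v₅ → BalancedWords v₄ v₅ →
    ReducesToCanonical [[0, 0, 0, 0, 0, 0], [0, 0, 1, 1, 2, 2], v₂, v₃, v₄, v₅] := by
  decide +kernel

theorem canonicalWords_column_injective : ∀ b b', (∀ a i,
    triangleMap (arrayEntry canonicalWords a b) i =
      triangleMap (arrayEntry canonicalWords a b') i) →
      b = b' := by
  decide +kernel

theorem rowOrder_injective : ∀ ρ ∈ ([3, 4, 5] : List (Fin 6)).permutations', ∀ a a' : Fin 6,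
    (0 :: 1 :: 2 :: ρ).getD a 0 = (0 :: 1 :: 2 :: ρ).getD a' 0 → a = a' := by
  decide +kernel

theorem rowOrder_lt_three : ∀ ρ ∈ ([3, 4, 5] : List (Fin 6)).permutations', ∀ a : Fin 6,
    (0 :: 1 :: 2 :: ρ).getD a 0 < 3 ↔ a < 3 := by
  decide +kernel

theorem reducesToCanonical_of_normalized {w : Fin 6 → Fin 6 → Fin 6} (hrow : ∀ b, w 0 b = 0)
    (hcolumn : ∀ a, w a 0 = 0) (hmono : Monotone fun b : Fin 5 => w 1 b.succ)
    (hbalanced : ∀ a a', a ≠ a' → BalancedWords (List.ofFn (w a)) (List.ofFn (w a'))) :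
    ReducesToCanonical (List.ofFn fun a => List.ofFn (w a)) := by
  have hword (a : Fin 6) : List.ofFn (w a) = [0, w a 1, w a 2, w a 3, w a 4, w a 5] := by
    simp [hcolumn]
  have hzero : List.ofFn (w 0) = [0, 0, 0, 0, 0, 0] := by simp [hrow]
  have hmono (b : Fin 4) := hmono (Fin.castSucc_le_succ b)
  have hfirst : List.ofFn (w 1) = [0, 0, 1, 1, 2, 2] ∨ List.ofFn (w 1) = [0, 1, 2, 3, 4, 5] :=
    hword 1 ▸ (eq_of_balanced_zero_of_le _ _ (hmono 0) _ (hmono 1) _ (hmono 2) _ (hmono 3)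
      (by rw [← hzero]; exact hword 1 ▸ hbalanced 0 1 (by decide))).imp
        (congrArg (List.cons 0)) (congrArg (List.cons 0))
  have hpair (a : Fin 6) (ha : 1 < a) {u : List (Fin 6)} (hone : List.ofFn (w 1) = u) :
      BalancedWords [0, 0, 0, 0, 0, 0] [0, w a 1, w a 2, w a 3, w a 4, w a 5] ∧
        BalancedWords u [0, w a 1, w a 2, w a 3, w a 4, w a 5] := by
    rw [← hzero, ← hone, ← hword]
    exact ⟨hbalanced 0 a (by rintro rfl; simp at ha), hbalanced 1 a ha.ne⟩
  rcases hfirst with hone | hone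
  · have hmem (a : Fin 6) (ha : 1 < a) : List.ofFn (w a) ∈ balancedCandidates :=
      hword a ▸ mem_balancedCandidates _ _ _ _ _ (hpair a ha hone).1 (hpair a ha hone).2
    have hrows : (List.ofFn fun a => List.ofFn (w a)) = [[0, 0, 0, 0, 0, 0], [0, 0, 1, 1, 2, 2],
        List.ofFn (w 2), List.ofFn (w 3), List.ofFn (w 4), List.ofFn (w 5)] := by
      rw [← hzero, ← hone]
      rfl
    rw [hrows]
    apply reducesToCanonical_of_balanced <;>
      first | exact hmem _ (by decide) | exact hbalanced _ _ (by decide)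
  · have hmem (a : Fin 6) (ha : 1 < a) : List.ofFn (w a) ∈ mixedCandidates :=
      hword a ▸ mem_mixedCandidates _ _ _ _ _ (hpair a ha hone).1 (hpair a ha hone).2
    exact (not_balanced_of_mem_mixedCandidates _ (hmem 2 (by decide)) _ (hmem 3 (by decide))
      (hbalanced 2 3 (by decide))).elim

end TriangleWords

section TriangleFamilies

open Classical

variable {Y : Type*} {F : SimpleGraph Y} {X : Type*} {K : SimpleGraph X} {N : Matrix Y X ℤ}

namespace IsCycleFamily

variable {ι κ : Type*} {n : ι → ℕ} {p : ι → ℤ → Y}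

theorem of_subset (h : IsCycleFamily F n p) {f : κ → ι} (hf : f.Injective) {m : κ → ℕ}
    {q : κ → ℤ → Y} (hq : ∀ a, IsCycleCover F (m a) (q a)) (hmem : ∀ a i, ∃ j, q a i = p (f a) j) :
    IsCycleFamily F m q where
  cover := hq
  disjoint {a b i j} heq := by
    obtain ⟨i', hi⟩ := hmem a i
    obtain ⟨j', hj⟩ := hmem b j
    exact hf (h.disjoint (hi.symm.trans (heq.trans hj)))

theorem append {k l : ℕ} {n : Fin k → ℕ} {m : Fin l → ℕ} {p : Fin k → ℤ → Y} {q : Fin l → ℤ → Y}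
    (hp : IsCycleFamily F n p) (hq : IsCycleFamily F m q) (hne : ∀ a i b j, p a i ≠ q b j) :
    IsCycleFamily F (Fin.append n m) (Fin.append p q) where
  cover a := by
    induction a using Fin.addCases with
    | left a => simpa only [Fin.append_left] using hp.cover a
    | right a => simpa only [Fin.append_right] using hq.cover a
  disjoint {a b i j} := by
    induction a using Fin.addCases <;> induction b using Fin.addCases <;>
      simp only [Fin.append_left, Fin.append_right] <;> intro heq
    · rw [hp.disjoint heq]
    · exact (hne _ _ _ _ heq).elim
    · exact (hne _ _ _ _ heq.symm).elim
    · rw [hq.disjoint heq]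

end IsCycleFamily

theorem arrayEntry_ofFn (w : Fin 6 → Fin 6 → Fin 6) (a b : Fin 6) :
    arrayEntry (List.ofFn fun a => List.ofFn (w a)) a b = w a b := by
  simp [arrayEntry, List.getD_eq_getElem?_getD, -List.ofFn_succ]

theorem triangleBlock_injective :
    ∀ k l, (∀ i j, triangleBlock k i j = triangleBlock l i j) → k = l := by
  decide

theorem triangleBlock_zero_comm : ∀ i j, triangleBlock 0 i j = triangleBlock 0 j i := by
  decide

theorem triangleBlock_intCast_injective {k l : Fin 6}
    (h : ∀ i j : ℤ, triangleBlock k i j = triangleBlock l i j) : k = l :=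
  triangleBlock_injective k l fun i j => by simpa using h i.val j.val

variable [Fintype Y] [Fintype X]

namespace IsWavePair

theorem exists_triangleFamily_right (h : IsWavePair F K N)
    (hK : ∀ m r, IsCycleCover K m r → m = 3) :
    ∃ r : Fin 6 → ℤ → X, IsCycleFamily K (fun _ => 3) r := by
  obtain ⟨k, hk, r, hr, -⟩ := exists_isCycleFamily h.right.degree_eq (adjClosed_univ K)
    fun m r hr _ => hK m r hr
  rw [Finset.card_univ, h.left.card_columns] at hk
  obtain rfl : k = 6 := by lia
  exact ⟨r, hr⟩

theorem exists_triangleFamily_left (h : IsWavePair F K N) (hF : ∀ m r, IsCycleCover F m r → m = 3)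
    {C : Finset Y} (hC : AdjClosed F C) (hcard : C.card = 9) :
    ∃ p : Fin 6 → ℤ → Y, IsCycleFamily F (fun _ => 3) p ∧ ∀ a i, p a i ∈ C ↔ a < 3 := by
  obtain ⟨k, hk, p, hp, hpC⟩ := exists_isCycleFamily h.left.degree_eq hC fun m r hr _ => hF m r hr
  obtain ⟨l, hl, q, hq, hqC⟩ := exists_isCycleFamily h.left.degree_eq ((adjClosed_univ F).sdiff hC)
    fun m r hr _ => hF m r hr
  rw [Finset.card_sdiff_of_subset (Finset.subset_univ _), Finset.card_univ, h.card_left] at hl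
  obtain rfl : k = 3 := by lia
  obtain rfl : l = 3 := by lia
  have hqC (b j) : q b j ∉ C := (Finset.mem_sdiff.1 (hqC b j)).2
  have happend := hp.append hq fun a i b j heq => hqC b j (heq ▸ hpC a i)
  have hconst :
      Fin.append (fun _ : Fin 3 => 3) (fun _ : Fin 3 => 3) = fun _ : Fin (3 + 3) => 3 := by decide
  refine ⟨Fin.append p q, hconst ▸ happend, fun a i => ?_⟩
  induction a using Fin.addCases (m := 3) (n := 3) with
  | left a => simp [Fin.append_left, hpC, Fin.lt_def]
  | right a =>
    rw [show Fin.append p q (Fin.natAdd 3 a) = q a from Fin.append_right p q a]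
    simp [hqC, Fin.lt_def]

theorem balancedWords (h : IsWavePair F K N) {p : Fin 6 → ℤ → Y} {r : Fin 6 → ℤ → X}
    (hp : IsCycleFamily F (fun _ => 3) p) (hr : IsCycleFamily K (fun _ => 3) r)
    {w : Fin 6 → Fin 6 → Fin 6}
    (hw : ∀ a b (i j : ℤ), N (p a i) (r b j) = triangleBlock (w a b) i j)
    {a a' : Fin 6} (ha : a ≠ a') : BalancedWords (List.ofFn (w a)) (List.ofFn (w a')) := by
  intro i i'
  have hne (j) : p a j ≠ p a' i'.val := fun heq => ha (hp.disjoint heq)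
  have hgram := h.left.gram_cover (hp.cover a) i.val (p a' i'.val)
  rw [hr.sum_eq (by simp [h.left.card_columns])] at hgram
  simp only [hw, hne, if_false] at hgram
  have hblock (b : Fin 6) : ∑ j ∈ Finset.range 3, triangleBlock (w a b) (i.val : ℤ) (j : ℤ) *
      triangleBlock (w a' b) (i'.val : ℤ) (j : ℤ) =
        if triangleMap (w a b) i = triangleMap (w a' b) i' then 1 else 0 := by
    rw [sum_range_cast (n := 3) fun z => triangleBlock (w a b) (i.val : ℤ) z *
      triangleBlock (w a' b) (i'.val : ℤ) z]
    simp [triangleBlock, eq_comm]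
  simp only [hblock] at hgram
  have hcount (u v : Fin 6 → Fin 6) : ((List.ofFn u).zip (List.ofFn v)).countP
      (fun x => triangleMap x.1 i = triangleMap x.2 i') =
        ∑ b, if triangleMap (u b) i = triangleMap (v b) i' then 1 else 0 := by
    simp [List.countP_cons, Fin.sum_univ_succ, -Finset.sum_boole]
    ring
  rw [hcount]
  exact_mod_cast hgram.trans (by norm_num : _ = (2 : ℤ))

theorem exists_normalized (h : IsWavePair F K N) {p : Fin 6 → ℤ → Y} {r : Fin 6 → ℤ → X}
    (hp : IsCycleFamily F (fun _ => 3) p) (hr : IsCycleFamily K (fun _ => 3) r) :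
    ∃ q s, IsCycleFamily F (fun _ => 3) q ∧ IsCycleFamily K (fun _ => 3) s ∧
      (∀ a i, ∃ j, q a i = p a j) ∧ ∃ w : Fin 6 → Fin 6 → Fin 6, (∀ b, w 0 b = 0) ∧
        (∀ a, w a 0 = 0) ∧ ∀ a b (i j : ℤ), N (q a i) (s b j) = triangleBlock (w a b) i j := by
  choose s hs hsr hsN using fun b => h.exists_aligned (hp.cover 0) (.inl rfl) (hr.cover b)
  have hrows (a : Fin 6) : ∃ q, IsCycleCover F 3 q ∧ (∀ j, ∃ j', q j = p a j') ∧
      (∀ i j : ℤ, N (q i) (s 0 j) = triangleBlock 0 i j) ∧ (a = 0 → q = p 0) := by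
    by_cases ha : a = 0
    · subst ha
      exact ⟨p 0, hp.cover 0, fun j => ⟨j, rfl⟩, hsN 0, fun _ => rfl⟩
    · obtain ⟨q, hq, hqp, hqN⟩ := h.swap.exists_aligned (hs 0) (.inl rfl) (hp.cover a)
      exact ⟨q, hq, hqp, fun i j => (hqN j i).trans (triangleBlock_zero_comm _ _),
        fun h0 => (ha h0).elim⟩
  choose q hq hqp hqN hq0 using hrows
  choose w hw using fun a b => h.exists_triangleBlock (hq a) (.inl rfl) (hs b)
  refine ⟨q, s, hp.of_subset Function.injective_id hq hqp,
    hr.of_subset Function.injective_id hs hsr, hqp, w, fun b => ?_, fun a => ?_, hw⟩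
  · exact triangleBlock_intCast_injective fun i j => by rw [← hw, hq0 0 rfl, hsN]
  · exact triangleBlock_intCast_injective fun i j => by rw [← hw, hqN]

theorem exists_sorted (h : IsWavePair F K N) {p : Fin 6 → ℤ → Y} {r : Fin 6 → ℤ → X}
    (hp : IsCycleFamily F (fun _ => 3) p) (hr : IsCycleFamily K (fun _ => 3) r) :
    ∃ q s, IsCycleFamily F (fun _ => 3) q ∧ IsCycleFamily K (fun _ => 3) s ∧
      (∀ a i, ∃ j, q a i = p a j) ∧ ∃ w : Fin 6 → Fin 6 → Fin 6,
        ReducesToCanonical (List.ofFn fun a => List.ofFn (w a)) ∧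
        ∀ a b (i j : ℤ), N (q a i) (s b j) = triangleBlock (w a b) i j := by
  obtain ⟨q, s, hq, hs, hqp, w, hrow, hcolumn, hw⟩ := h.exists_normalized hp hr
  let τ : Fin 6 → Fin 6 := Fin.cons 0 (Fin.succ ∘ Tuple.sort fun b : Fin 5 => w 1 b.succ)
  have hτ : τ.Injective := Fin.cons_injective_iff.2
    ⟨by simp, (Fin.succ_injective _).comp (Equiv.injective _)⟩
  have hs := hs.comp hτ
  have hw (a b) (i j : ℤ) : N (q a i) ((s ∘ τ) b j) = triangleBlock (w a (τ b)) i j := hw ..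
  refine ⟨q, s ∘ τ, hq, hs, hqp, fun a b => w a (τ b), ?_, hw⟩
  exact reducesToCanonical_of_normalized (fun b => hrow _) (fun a => hcolumn a)
    (Tuple.monotone_sort fun b : Fin 5 => w 1 b.succ) fun a a' ha => h.balancedWords hq hs hw ha

theorem exists_canonical (h : IsWavePair F K N) {p : Fin 6 → ℤ → Y} {r : Fin 6 → ℤ → X}
    (hp : IsCycleFamily F (fun _ => 3) p) (hr : IsCycleFamily K (fun _ => 3) r) :
    ∃ q s, IsCycleFamily F (fun _ => 3) q ∧ IsCycleFamily K (fun _ => 3) s ∧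
      (∀ a i, ∃ b j, q a i = p b j ∧ (b < 3 ↔ a < 3)) ∧
      ∀ a b (i j : ℤ), N (q a i) (s b j) = triangleBlock (arrayEntry canonicalWords a b) i j := by
  obtain ⟨q, s, hq, hs, hqp, w, ⟨ρ, hρ, b₀, hreduce⟩, hw⟩ := h.exists_sorted hp hr
  choose σ hσ using hreduce
  simp only [arrayEntry_ofFn] at hσ
  set f : Fin 6 → Fin 6 := fun a => (0 :: 1 :: 2 :: ρ).getD a 0
  have hσ_injective : σ.Injective := fun b b' hb =>
    canonicalWords_column_injective b b' fun a i => by rw [← hσ, ← hσ, hb]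
  refine ⟨fun a i => q (f a) (-(w (f a) b₀ : ℕ) + i), s ∘ σ,
    hq.of_subset (rowOrder_injective ρ hρ) (fun a => (hq.cover _).comp_add _) fun a i => ⟨_, rfl⟩,
    hs.comp hσ_injective, fun a i => ?_, fun a b i j => ?_⟩
  · obtain ⟨j, hj⟩ := hqp (f a) (-(w (f a) b₀ : ℕ) + i)
    exact ⟨f a, j, hj, rowOrder_lt_three ρ hρ a⟩
  · simp only [Function.comp_apply, hw, triangleBlock, ← hσ]
    push_cast
    rw [neg_add_eq_sub]

theorem exists_triangle_array (h : IsWavePair F K N) (hF : ∀ n p, IsCycleCover F n p → n = 3)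
    {C : Finset Y} (hC : AdjClosed F C) (hcard : C.card = 9) :
    ∃ (p : Fin 6 → ℤ → Y) (r : Fin 6 → ℤ → X), IsCycleFamily F (fun _ => 3) p ∧
      IsCycleFamily K (fun _ => 3) r ∧ (∀ a i, p a i ∈ C ↔ a < 3) ∧
      ∀ a b (i j : ℤ), N (p a i) (r b j) = triangleBlock (arrayEntry canonicalWords a b) i j := by
  obtain ⟨p, hp, hpC⟩ := h.exists_triangleFamily_left hF hC hcard
  obtain ⟨r, hr⟩ := h.exists_triangleFamily_right fun m r hr => h.length_eq_three_of_left hF hr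
  obtain ⟨q, s, hq, hs, hqp, hN⟩ := h.exists_canonical hp hr
  refine ⟨q, s, hq, hs, fun a i => ?_, hN⟩
  obtain ⟨b, j, hj, hba⟩ := hqp a i
  rw [hj, hpC, hba]

end IsWavePair

end TriangleFamilies

section HexagonBlocks

/-- The circulant matrix on `ZMod 6` with connection set `D`. -/
def circulantBlock (D : Finset (ZMod 6)) (i j : ZMod 6) : ℤ :=
  if j - i ∈ D then 1 else 0

theorem eq_of_wave {f g : ℤ → ℤ → ℤ}
    (hf : ∀ i j, f (i - 1) j + f (i + 1) j = f i (j - 1) + f i (j + 1))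
    (hg : ∀ i j, g (i - 1) j + g (i + 1) j = g i (j - 1) + g i (j + 1))
    (hzero : f 0 = g 0) (hone : f 1 = g 1) : f = g := by
  have hpair (i : ℤ) : f i = g i ∧ f (i + 1) = g (i + 1) := by
    induction i using Int.induction_on with
    | zero => exact ⟨hzero, hone⟩
    | succ i ih =>
      refine ⟨ih.2, funext fun j => ?_⟩
      have hfij := hf (i + 1) j
      have hgij := hg (i + 1) j
      rw [add_sub_cancel_right, ih.1, ih.2] at hfij
      rw [add_sub_cancel_right] at hgij
      linarith
    | pred i ih =>
      rw [sub_add_cancel]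
      refine ⟨funext fun j => ?_, ih.1⟩
      have hfij := hf (-i) j
      have hgij := hg (-i) j
      rw [ih.1, ih.2] at hfij
      linarith
  exact funext fun i => (hpair i).1

/-- The possible rows of a block between two `6`-cycles. -/
def hexagonRows : Finset (Finset (ZMod 6)) :=
  {S ∈ Finset.powersetCard 2 Finset.univ | ∀ z ∈ S, z + 3 ∉ S}

/-- The wave equation for three consecutive rows with supports `S`, `T` and `U`. -/
def IsWaveStep (S T U : Finset (ZMod 6)) : Prop :=
  ∀ z, ((if z ∈ S then 1 else 0) + (if z ∈ U then 1 else 0) : ℤ) =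
    (if z - 1 ∈ T then 1 else 0) + (if z + 1 ∈ T then 1 else 0)

instance (S T U : Finset (ZMod 6)) : Decidable (IsWaveStep S T U) :=
  inferInstanceAs (Decidable (∀ _, _))

theorem exists_hexagonRows_eq : ∀ S ∈ hexagonRows, ∀ T ∈ hexagonRows,
    (∃ U ∈ hexagonRows, IsWaveStep S T U ∧ ∃ V ∈ hexagonRows, IsWaveStep T U V ∧
      ∀ z, z ∈ V ↔ z + 3 ∈ S) →
    ∃ d : ZMod 6, (d = 1 ∨ d = 2) ∧ ∃ e : ZMod 6, S = {e, e + d} ∧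
      (T = {e + 1, e + 1 + d} ∨ T = {e - 1, e - 1 + d}) := by
  decide +kernel

open Classical

variable {Y : Type*} {F : SimpleGraph Y} {X : Type*} {K : SimpleGraph X} {N : Matrix Y X ℤ}
  {p : ℤ → Y} {r : ℤ → X} [Fintype Y] [Fintype X]

namespace IsWavePair

theorem exists_hexagonRows (h : IsWavePair F K N) (hr : IsCycleCover K 6 r)
    {y : Y} (hanti : ∀ j, N y (r j) * N y (r (j + 3)) = 0) :
    ∃ S ∈ hexagonRows, ∀ j : ℤ, N y (r j) = if (j : ZMod 6) ∈ S then 1 else 0 := by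
  have hentry (j : ℤ) : N y (r j) = if N y (r j) = 1 then 1 else 0 := by
    rcases h.left.entry y (r j) with h0 | h1 <;> simp [*]
  refine ⟨Finset.univ.filter fun z : ZMod 6 => N y (r z.val) = 1, ?_, fun j => ?_⟩
  · refine Finset.mem_filter.2 ⟨Finset.mem_powersetCard_univ.2 ?_, fun z hz hz3 => ?_⟩
    · have hsum := h.right.three_mul_sum_eq_card hr.adjClosed_cyclePoints y
      rw [hr.sum_cyclePoints, hr.card_cyclePoints] at hsum
      simp only [Matrix.transpose_apply] at hsum
      push_cast at hsum
      have htwo : ∑ z : ZMod 6, (if N y (r z.val) = 1 then 1 else 0 : ℤ) = 2 := by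
        rw [← sum_range_cast]
        simp only [hr.apply_val, ← hentry]
        linarith
      rw [Finset.sum_boole] at htwo
      exact_mod_cast htwo
    · have hval : r ((z + 3 : ZMod 6).val : ℤ) = r (z.val + 3) := by
        rw [← hr.apply_val (z.val + 3)]
        simp
      have hprod := hanti z.val
      rw [← hval, (Finset.mem_filter.1 hz).2, (Finset.mem_filter.1 hz3).2] at hprod
      norm_num at hprod
  · simp only [Finset.mem_filter, Finset.mem_univ, true_and, hr.apply_val]
    exact hentry j

theorem exists_circulantBlock (h : IsWavePair F K N) (hp : IsCycleCover F 6 p)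
    (hr : IsCycleCover K 6 r) (hanti : ∀ i j, N (p i) (r j) * N (p i) (r (j + 3)) = 0) :
    ∃ d : ZMod 6, (d = 1 ∨ d = 2) ∧ ∃ ε : ZMod 6, (ε = 1 ∨ ε = -1) ∧ ∃ e : ZMod 6,
      ∀ i j : ℤ, N (p i) (r j) = circulantBlock {0, d} (ε * i) (j - e) := by
  choose S hS hN using fun i => h.exists_hexagonRows hr (hanti i)
  have hwave (i : ℤ) : IsWaveStep (S (i - 1)) (S i) (S (i + 1)) := fun z => by
    have := h.wave hp hr i z.val
    simpa [hN] using this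
  have hshift (z : ZMod 6) : z ∈ S 3 ↔ z + 3 ∈ S 0 := by
    have hentry : (if z + 3 ∈ S 0 then 1 else 0 : ℤ) = if z ∈ S 3 then 1 else 0 := by
      simpa [hN] using h.apply_add_eq hp hr (k := 3) (by norm_num) 0 z.val
    split_ifs at hentry <;> simp_all
  obtain ⟨d, hd, e, hzero, hone⟩ := exists_hexagonRows_eq (S 0) (hS 0) (S 1) (hS 1)
    ⟨S 2, hS 2, hwave 1, S 3, hS 3, hwave 2, hshift⟩
  obtain ⟨ε, hε, hone⟩ : ∃ ε : ZMod 6, (ε = 1 ∨ ε = -1) ∧ S 1 = {e + ε, e + ε + d} := by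
    rcases hone with hone | hone
    exacts [⟨1, .inl rfl, hone⟩, ⟨-1, .inr rfl, by simpa [sub_eq_add_neg] using hone⟩]
  refine ⟨d, hd, ε, hε, e, fun i j => ?_⟩
  refine congrFun (congrFun (eq_of_wave (f := fun i j => N (p i) (r j)) (h.wave hp hr)
    (g := fun i j => circulantBlock {0, d} (ε * i) (j - e)) (fun i j => ?_)
    (funext fun j => ?_) (funext fun j => ?_)) i) j
  · rcases hε with rfl | rfl <;> simp only [circulantBlock] <;> push_cast <;> ring_nf
  · simp [hN, hzero, circulantBlock, sub_eq_iff_eq_add, add_comm]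
  · simp [hN, hone, circulantBlock, sub_eq_iff_eq_add, add_comm, add_left_comm]

end IsWavePair

end HexagonBlocks

section MixedFamilies

open Classical

variable {Y : Type*} [Fintype Y] {F : SimpleGraph Y} {n : ℕ} {p : ℤ → Y}
  {X : Type*} [Fintype X] {K : SimpleGraph X} {N : Matrix Y X ℤ} {m : ℕ} {r : ℤ → X}

/-- The cycle lengths of either graph of a wave pair that has a `6`-cycle. -/
def mixedLengths : Fin 4 → ℕ := ![6, 6, 3, 3]

theorem exists_isCycleCover_six (hdeg : ∀ y, F.degree y = 2)
    (hlength : ∀ n p, IsCycleCover F n p → n = 3 ∨ n = 6) {y : Y} (hy : y ∉ trianglePoints F) :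
    ∃ p, IsCycleCover F 6 p ∧ p 0 = y := by
  obtain ⟨n, p, hp, rfl⟩ := exists_isCycleCover hdeg y
  rcases hlength n p hp with rfl | rfl
  exacts [(hy (hp.apply_mem_trianglePoints 0)).elim, ⟨p, hp, rfl⟩]

theorem IsCycleCover.apply_notMem_trianglePoints (hp : IsCycleCover F 6 p) (i : ℤ) :
    p i ∉ trianglePoints F := fun hi => by
  obtain ⟨q, hq, hq0⟩ := mem_trianglePoints.1 hi
  have := hp.length_unique hq hq0.symm
  lia

namespace IsWavePair

theorem sum_mul_apply_add_three (h : IsWavePair F K N) (hr : IsCycleCover K 6 r) (j : ℤ) :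
    ∑ y, N y (r j) * N y (r (j + 3)) = 2 := by
  have hgram := h.right.gram_cover hr j (r (j + 3))
  simp only [hr.eq_iff] at hgram
  simpa [show ¬ (6 : ℤ) ∣ j - (j + 3) by lia, show ¬ (6 : ℤ) ∣ j - 1 - (j + 3) by lia,
    show ¬ (6 : ℤ) ∣ j + 1 - (j + 3) by lia, show ¬ (6 : ℤ) ∣ j - 2 - (j + 3) by lia,
    show ¬ (6 : ℤ) ∣ j + 2 - (j + 3) by lia] using hgram

theorem three_mul_sum_trianglePoints (h : IsWavePair F K N) (hr : IsCycleCover K 6 r) (j : ℤ) :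
    3 * ∑ y ∈ trianglePoints F, N y (r j) * N y (r (j + 3)) = (trianglePoints F).card := by
  rw [← h.left.three_mul_sum_eq_card (adjClosed_trianglePoints F) (r j)]
  congr 1
  refine Finset.sum_congr rfl fun y hy => ?_
  obtain ⟨q, hq, rfl⟩ := mem_trianglePoints.1 hy
  have happly : N (q 0) (r (j + 3)) = N (q 0) (r j) := h.swap.apply_add_three hr hq j 0
  rw [happly, h.left.mul_self_apply]

/-- Off the triangles, rows take different values at opposite vertices of a hexagon, since already
the six rows on triangles exhaust the inner product of the two columns. -/
theorem mul_apply_add_three_eq_zero (h : IsWavePair F K N) (hT : (trianglePoints F).card = 6)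
    (hr : IsCycleCover K 6 r) {y : Y} (hy : y ∉ trianglePoints F) (j : ℤ) :
    N y (r j) * N y (r (j + 3)) = 0 := by
  have htriangles := h.three_mul_sum_trianglePoints hr j
  have hall := h.sum_mul_apply_add_three hr j
  rw [← Finset.sum_add_sum_compl (trianglePoints F)] at hall
  have hzero : ∑ y ∈ (trianglePoints F)ᶜ, N y (r j) * N y (r (j + 3)) = 0 := by
    rw [hT] at htriangles
    push_cast at htriangles
    linarith
  exact (Finset.sum_eq_zero_iff_of_nonneg fun y _ =>
    mul_nonneg (h.left.nonneg y _) (h.left.nonneg y _)).1 hzero y (Finset.mem_compl.2 hy)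

theorem card_trianglePoints_right (h : IsWavePair F K N)
    (hK : ∀ m r, IsCycleCover K m r → m = 3 ∨ m = 6) (hp : IsCycleCover F 6 p)
    (hT : (trianglePoints F).card = 6) : (trianglePoints K).card = 6 := by
  have hzero (x : X) (hx : x ∈ (trianglePoints K)ᶜ) : N (p 0) x * N (p (0 + 3)) x = 0 := by
    obtain ⟨r, hr, rfl⟩ := exists_isCycleCover_six h.right.degree_eq hK (Finset.mem_compl.1 hx)
    have hopposite : N (p 0) (r (0 + 3)) = N (p (0 + 3)) (r 0) :=
      h.apply_add_eq hp hr (k := 3) (by norm_num) 0 0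
    rw [← hopposite]
    exact h.mul_apply_add_three_eq_zero hT hr (hp.apply_notMem_trianglePoints 0) 0
  have htriangles := h.swap.three_mul_sum_trianglePoints hp 0
  have hall := h.swap.sum_mul_apply_add_three hp 0
  simp only [Matrix.transpose_apply] at htriangles hall
  rw [← Finset.sum_add_sum_compl (trianglePoints K), Finset.sum_eq_zero hzero] at hall
  lia

theorem card_trianglePoints_left (h : IsWavePair F K N)
    (hF : ∀ n p, IsCycleCover F n p → n = 3 ∨ n = 6) (hr : IsCycleCover K 6 r) {C : Finset Y}
    (hC : AdjClosed F C) (hcard : C.card = 9) : (trianglePoints F).card = 6 := by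
  have hcompl : (Finset.univ \ C).card = 9 := by
    rw [Finset.card_sdiff_of_subset C.subset_univ, Finset.card_univ, h.card_left, hcard]
  have hin := h.card_inter_trianglePoints hF hr hC hcard
  have hout := h.card_inter_trianglePoints hF hr ((adjClosed_univ F).sdiff hC) hcompl
  have hdiff : trianglePoints F \ C = (Finset.univ \ C) ∩ trianglePoints F := by
    ext y
    simp [and_comm]
  have hsplit := Finset.card_inter_add_card_sdiff (trianglePoints F) C
  rw [Finset.inter_comm, hin, hdiff, hout] at hsplit
  exact hsplit.symm

theorem exists_mixedFamily_right (h : IsWavePair F K N)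
    (hK : ∀ m r, IsCycleCover K m r → m = 3 ∨ m = 6) (hT : (trianglePoints K).card = 6) :
    ∃ r : Fin 4 → ℤ → X, IsCycleFamily K mixedLengths r := by
  obtain ⟨k, hk, r, hr, hrT⟩ :=
    exists_isCycleFamily_hexagons h.right.degree_eq hK (adjClosed_univ K)
  obtain ⟨l, hl, s, hs, hsT⟩ := exists_isCycleFamily_triangles h.right.degree_eq (adjClosed_univ K)
  rw [Finset.univ_inter] at hl hsT
  rw [Finset.card_sdiff_of_subset (Finset.subset_univ _), Finset.card_univ,
    h.left.card_columns] at hk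
  obtain rfl : k = 2 := by lia
  obtain rfl : l = 2 := by lia
  have happend := hr.append hs fun a i b j heq =>
    (Finset.mem_sdiff.1 (hrT a i)).2 (heq ▸ hsT b j)
  have hlengths : Fin.append (fun _ : Fin 2 => 6) (fun _ : Fin 2 => 3) = mixedLengths := by decide
  exact ⟨Fin.append r s, hlengths ▸ happend⟩

theorem exists_hexagon_triangle (h : IsWavePair F K N)
    (hF : ∀ n p, IsCycleCover F n p → n = 3 ∨ n = 6) (hr : IsCycleCover K 6 r) {S : Finset Y}
    (hS : AdjClosed F S) (hcard : S.card = 9) :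
    ∃ q t, IsCycleCover F 6 q ∧ IsCycleCover F 3 t ∧
      (∀ i, q i ∈ S ∧ q i ∉ trianglePoints F) ∧ ∀ i, t i ∈ S ∧ t i ∈ trianglePoints F := by
  have hinter := h.card_inter_trianglePoints hF hr hS hcard
  obtain ⟨k, hk, q, hq, hqS⟩ := exists_isCycleFamily_hexagons h.left.degree_eq hF hS
  obtain ⟨l, hl, t, ht, htS⟩ := exists_isCycleFamily_triangles h.left.degree_eq hS
  have hadd := Finset.card_inter_add_card_sdiff S (trianglePoints F)
  obtain rfl : k = 1 := by lia
  obtain rfl : l = 1 := by lia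
  exact ⟨q 0, t 0, hq.cover 0, ht.cover 0, fun i => Finset.mem_sdiff.1 (hqS 0 i),
    fun i => Finset.mem_inter.1 (htS 0 i)⟩

theorem exists_mixedFamily_left (h : IsWavePair F K N)
    (hF : ∀ n p, IsCycleCover F n p → n = 3 ∨ n = 6) (hr : IsCycleCover K 6 r) {C : Finset Y}
    (hC : AdjClosed F C) (hcard : C.card = 9) :
    ∃ p : Fin 4 → ℤ → Y, IsCycleFamily F mixedLengths p ∧
      ∀ a i, p a i ∈ C ↔ a = 0 ∨ a = 2 := by
  have hcompl : (Finset.univ \ C).card = 9 := by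
    rw [Finset.card_sdiff_of_subset C.subset_univ, Finset.card_univ, h.card_left, hcard]
  obtain ⟨q, t, hq, ht, hqC, htC⟩ := h.exists_hexagon_triangle hF hr hC hcard
  obtain ⟨q', t', hq', ht', hqC', htC'⟩ :=
    h.exists_hexagon_triangle hF hr ((adjClosed_univ F).sdiff hC) hcompl
  simp only [Finset.mem_sdiff, Finset.mem_univ, true_and] at hqC' htC'
  have hmem (a : Fin 4) (i : ℤ) : (![q, q', t, t'] a i ∈ C ↔ a = 0 ∨ a = 2) ∧
      (![q, q', t, t'] a i ∈ trianglePoints F ↔ a = 2 ∨ a = 3) := by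
    fin_cases a <;> simp [hqC, htC, hqC', htC']
  refine ⟨![q, q', t, t'], ⟨fun a => ?_, fun {a b i j} heq => ?_⟩, fun a i => (hmem a i).1⟩
  · fin_cases a
    exacts [hq, hq', ht, ht']
  · have ha := hmem a i
    rw [heq, (hmem b j).1, (hmem b j).2] at ha
    clear heq
    revert a b
    decide

end IsWavePair

end MixedFamilies

section BlockCodes

/-- Parameters `ε`, `e` and `d` of a block whose `i`-th row has support `{e + εi, e + εi + d}`. The
coordinates run over `ZMod 6`, which covers a triangle twice. -/
structure BlockCode where
  (sign shift gap : ZMod 6)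
deriving DecidableEq

namespace BlockCode

/-- The support of the `i`-th row of the block with a given code. -/
def support (c : BlockCode) (i : ZMod 6) : Finset (ZMod 6) :=
  {c.shift + c.sign * i, c.shift + c.sign * i + c.gap}

/-- The block with a given code, as a matrix. -/
def entry (c : BlockCode) (i j : ZMod 6) : ℤ :=
  if j ∈ c.support i then 1 else 0

/-- The codes of the possible blocks between two hexagons. -/
def hexagons : List BlockCode :=
  [1, -1].flatMap fun ε => [0, 1, 2, 3, 4, 5].flatMap fun e => [⟨ε, e, 1⟩, ⟨ε, e, 2⟩]

/-- The codes of the possible blocks that involve a triangle. -/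
def triangles : List BlockCode :=
  [1, -1].flatMap fun ε => [⟨ε, 0, 3⟩, ⟨ε, 1, 3⟩, ⟨ε, 2, 3⟩]

/-- The codes of the possible blocks between two cycles of given lengths, both `3` or `6`. -/
def candidates (n m : ℕ) : List BlockCode :=
  if n = 6 ∧ m = 6 then hexagons else triangles

theorem exists_entry_eq_triangleBlock : ∀ k, ∃ c ∈ triangles, ∀ i j : ZMod 6,
    triangleBlock k (ZMod.castHom (by norm_num : 3 ∣ 6) _ i) (ZMod.castHom (by norm_num) _ j) =
      c.entry i j := by
  decide +kernel

/-- The block is circulant, with its first row starting at `0`. -/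
def IsAligned (c : BlockCode) : Prop :=
  c = ⟨1, 0, c.gap⟩

instance (c : BlockCode) : Decidable c.IsAligned :=
  inferInstanceAs (Decidable (_ = _))

theorem sign_eq_and_aligned_mem {n m : ℕ} {c : BlockCode} (hc : c ∈ candidates n m) :
    (c.sign = 1 ∨ c.sign = -1) ∧ ⟨1, 0, c.gap⟩ ∈ candidates n m := by
  have hall : (∀ c ∈ hexagons, (c.sign = 1 ∨ c.sign = -1) ∧ ⟨1, 0, c.gap⟩ ∈ hexagons) ∧
      ∀ c ∈ triangles, (c.sign = 1 ∨ c.sign = -1) ∧ ⟨1, 0, c.gap⟩ ∈ triangles := by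
    decide +kernel
  unfold candidates at hc ⊢
  split_ifs at hc ⊢
  exacts [hall.1 c hc, hall.2 c hc]

theorem eq_of_entry_eq {n m : ℕ} {c c' : BlockCode} (hc : c ∈ candidates n m)
    (hc' : c' ∈ candidates n m) (heq : ∀ i j, c.entry i j = c'.entry i j) : c = c' := by
  have hall : (∀ c ∈ hexagons, ∀ c' ∈ hexagons, (∀ i j, c.entry i j = c'.entry i j) → c = c') ∧
      ∀ c ∈ triangles, ∀ c' ∈ triangles, (∀ i j, c.entry i j = c'.entry i j) → c = c' := by
    decide +kernel
  unfold candidates at hc hc'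
  split_ifs at hc hc'
  exacts [hall.1 c hc c' hc' heq, hall.2 c hc c' hc' heq]

end BlockCode

open Classical

variable {Y : Type*} {F : SimpleGraph Y} {n : ℕ} {p : ℤ → Y}
  {X : Type*} {K : SimpleGraph X} {N : Matrix Y X ℤ} {m : ℕ} {r : ℤ → X}

theorem exists_aligned_columns (hr : IsCycleCover K m r) {k l : ℕ} {c : BlockCode}
    (hc : c ∈ BlockCode.candidates k l) (hN : ∀ i j : ℤ, N (p i) (r j) = c.entry i j) :
    ∃ s, IsCycleCover K m s ∧ (∀ j, ∃ j', s j = r j') ∧ ∃ c' ∈ BlockCode.candidates k l,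
      c'.IsAligned ∧ ∀ i j : ℤ, N (p i) (s j) = c'.entry i j := by
  obtain ⟨hsign, hmem⟩ := BlockCode.sign_eq_and_aligned_mem hc
  rcases hsign with hsign | hsign
  · refine ⟨_, hr.comp_add c.shift.val, fun j => ⟨_, rfl⟩, _, hmem, rfl, fun i j => ?_⟩
    simp [hN, BlockCode.entry, BlockCode.support, hsign, add_assoc]
  · refine ⟨_, hr.comp_sub (c.shift + c.gap).val, fun j => ⟨_, rfl⟩, _, hmem, rfl, fun i j => ?_⟩
    rw [hN, BlockCode.entry, BlockCode.entry]
    refine if_congr ?_ rfl rfl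
    simp only [BlockCode.support, hsign, Int.cast_sub, Int.cast_natCast, ZMod.natCast_zmod_val,
      Finset.mem_insert, Finset.mem_singleton]
    grind

theorem exists_aligned_rows (hp : IsCycleCover F n p) {k l : ℕ} {c : BlockCode}
    (hc : c ∈ BlockCode.candidates k l) (hN : ∀ i j : ℤ, N (p i) (r j) = c.entry i j) :
    ∃ q, IsCycleCover F n q ∧ (∀ i, ∃ i', q i = p i') ∧ ∃ c' ∈ BlockCode.candidates k l,
      c'.IsAligned ∧ ∀ i j : ℤ, N (q i) (r j) = c'.entry i j := by
  obtain ⟨hsign, hmem⟩ := BlockCode.sign_eq_and_aligned_mem hc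
  rcases hsign with hsign | hsign
  · refine ⟨_, hp.comp_add (-c.shift).val, fun j => ⟨_, rfl⟩, _, hmem, rfl, fun i j => ?_⟩
    simp [hN, BlockCode.entry, BlockCode.support, hsign]
  · refine ⟨_, hp.comp_sub c.shift.val, fun j => ⟨_, rfl⟩, _, hmem, rfl, fun i j => ?_⟩
    simp [hN, BlockCode.entry, BlockCode.support, hsign]

variable [Fintype Y] [Fintype X]

namespace IsWavePair

theorem exists_code_of_triangle (h : IsWavePair F K N) (hp : IsCycleCover F n p)
    (hn : n = 3 ∨ n = 6) (hr : IsCycleCover K m r) (hm : m = 3 ∨ m = 6) (hnm : ¬ (n = 6 ∧ m = 6)) :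
    ∃ c ∈ BlockCode.triangles, ∀ i j : ℤ, N (p i) (r j) = c.entry i j := by
  obtain ⟨k, hk⟩ : ∃ k, ∀ i j : ℤ, N (p i) (r j) = triangleBlock k i j := by
    rcases hm with rfl | rfl
    · exact h.exists_triangleBlock hp hn hr
    · obtain rfl := hn.resolve_right fun hn => hnm ⟨hn, rfl⟩
      obtain ⟨k, hk⟩ := h.swap.exists_triangleBlock hr (.inr rfl) hp
      obtain ⟨l, hl⟩ := exists_triangleBlock_transpose k
      exact ⟨l, fun i j => (hk j i).trans (hl _ _)⟩
  obtain ⟨c, hc, hentry⟩ := BlockCode.exists_entry_eq_triangleBlock k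
  refine ⟨c, hc, fun i j => ?_⟩
  rw [hk, ← hentry]
  simp

theorem exists_code (h : IsWavePair F K N) (hT : (trianglePoints F).card = 6)
    (hp : IsCycleCover F n p) (hn : n = 3 ∨ n = 6) (hr : IsCycleCover K m r) (hm : m = 3 ∨ m = 6) :
    ∃ c ∈ BlockCode.candidates n m, ∀ i j : ℤ, N (p i) (r j) = c.entry i j := by
  unfold BlockCode.candidates
  split_ifs with hnm
  · obtain ⟨rfl, rfl⟩ := hnm
    obtain ⟨d, hd, ε, hε, e, hN⟩ := h.exists_circulantBlock hp hr fun i =>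
      h.mul_apply_add_three_eq_zero hT hr (hp.apply_notMem_trianglePoints i)
    refine ⟨⟨ε, e, d⟩, ?_, fun i j => ?_⟩
    · clear hN
      rcases hd with rfl | rfl <;> rcases hε with rfl | rfl <;> revert e <;> decide
    · simp [hN, BlockCode.entry, BlockCode.support, circulantBlock, sub_sub, sub_eq_iff_eq_add,
        add_comm]
  · exact h.exists_code_of_triangle hp hn hr hm hnm

end IsWavePair

end BlockCodes

section RowOverlaps

theorem mixedLengths_eq : ∀ a, mixedLengths a = 3 ∨ mixedLengths a = 6 := by
  decide

namespace BlockCode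

/-- Six times the inner product of the `i`-th row of `u` and the `i'`-th row of `v`. A block with
columns in an `m`-cycle is counted `m` times, its columns being listed `6 / m` times. -/
def overlap (u v : Fin 4 → BlockCode) (i i' : ZMod 6) : ℕ :=
  ∑ b, mixedLengths b * ((u b).support i ∩ (v b).support i').card

/-- The condition that any row of `u` and any row of `v` have inner product `2`. -/
def IsBalanced (u v : Fin 4 → BlockCode) : Prop :=
  ∀ i i', overlap u v i i' = 12

instance (u v : Fin 4 → BlockCode) : Decidable (IsBalanced u v) :=
  inferInstanceAs (Decidable (∀ _, _))

theorem gap_of_overlap_eq : ∀ c ∈ hexagons, c.IsAligned →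
    ∀ c' ∈ hexagons, c'.IsAligned → ∀ d ∈ triangles, d.IsAligned →
    ∀ d' ∈ triangles, d'.IsAligned → overlap ![c, c', d, d'] ![c, c', d, d'] 0 1 = 6 →
      d = ⟨1, 0, 3⟩ ∧ d' = ⟨1, 0, 3⟩ ∧
        (c = ⟨1, 0, 1⟩ ∧ c' = ⟨1, 0, 2⟩ ∨ c = ⟨1, 0, 2⟩ ∧ c' = ⟨1, 0, 1⟩) := by
  decide +kernel

theorem hexagonRow_of_isBalanced : ∀ c' ∈ hexagons, c'.IsAligned →
    ∀ c ∈ hexagons, ∀ d ∈ triangles, ∀ d' ∈ triangles,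
      IsBalanced ![⟨1, 0, 1⟩, ⟨1, 0, 2⟩, ⟨1, 0, 3⟩, ⟨1, 0, 3⟩] ![c, c', d, d'] →
      c = ⟨1, 2, 2⟩ ∧ c' = ⟨1, 0, 1⟩ ∧
        (d = ⟨1, 0, 3⟩ ∧ d' = ⟨1, 2, 3⟩ ∨ d = ⟨1, 2, 3⟩ ∧ d' = ⟨1, 0, 3⟩) := by
  decide +kernel

theorem triangleRow_of_isBalanced : ∀ c ∈ triangles, c.IsAligned →
    ∀ c' ∈ triangles, ∀ d ∈ triangles, ∀ d' ∈ triangles,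
      IsBalanced ![⟨1, 0, 1⟩, ⟨1, 0, 2⟩, ⟨1, 0, 3⟩, ⟨1, 0, 3⟩] ![c, c', d, d'] →
      IsBalanced ![⟨1, 2, 2⟩, ⟨1, 0, 1⟩, ⟨1, 0, 3⟩, ⟨1, 2, 3⟩] ![c, c', d, d'] →
      c = ⟨1, 0, 3⟩ ∧ (c' = ⟨1, 0, 3⟩ ∧ d = ⟨1, 1, 3⟩ ∧ d' = ⟨1, 2, 3⟩ ∨
        c' = ⟨1, 1, 3⟩ ∧ d = ⟨1, 0, 3⟩ ∧ d' = ⟨1, 1, 3⟩) := by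
  decide +kernel

end BlockCode

end RowOverlaps

section BlockArrays

open Classical

variable {Y : Type*} {F : SimpleGraph Y} {p : Fin 4 → ℤ → Y}
  {X : Type*} {K : SimpleGraph X} {N : Matrix Y X ℤ} {m : ℕ} {r : Fin 4 → ℤ → X}
  {w : Fin 4 → Fin 4 → BlockCode}

theorem IsCycleCover.mul_sum_range (hm : m = 3 ∨ m = 6) {r : ℤ → X} (hr : IsCycleCover K m r)
    (f : X → ℤ) :
    6 * ∑ j ∈ Finset.range m, f (r j) = m * ∑ j ∈ Finset.range 6, f (r j) := by
  rcases hm with rfl | rfl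
  · have hperiod (j : ℤ) : r (j + 3) = r j := (hr.eq_iff _ _).2 (by simp)
    have h0 := hperiod 0
    have h1 := hperiod 1
    have h2 := hperiod 2
    norm_num at h0 h1 h2
    simp only [Finset.sum_range_succ, Finset.sum_range_zero]
    push_cast
    rw [h0, h1, h2]
    ring
  · rfl

theorem BlockCode.sum_entry_mul_entry (c c' : BlockCode) (i i' : ZMod 6) :
    ∑ j ∈ Finset.range 6, c.entry i (j : ℤ) * c'.entry i' (j : ℤ) =
      (c.support i ∩ c'.support i').card := by
  rw [sum_range_cast fun z => c.entry i z * c'.entry i' z]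
  simp [BlockCode.entry, ← ite_and, ← Finset.mem_inter, Finset.inter_comm]

/-- The matrix `N` in terms of unrollings of the cycles of both graphs, two hexagons followed by two
triangles. -/
structure IsBlockArray (F : SimpleGraph Y) (K : SimpleGraph X) (N : Matrix Y X ℤ)
    (w : Fin 4 → Fin 4 → BlockCode) (p : Fin 4 → ℤ → Y) (r : Fin 4 → ℤ → X) : Prop where
  left : IsCycleFamily F mixedLengths p
  right : IsCycleFamily K mixedLengths r
  mem : ∀ a b, w a b ∈ BlockCode.candidates (mixedLengths a) (mixedLengths b)
  entry : ∀ a b (i j : ℤ), N (p a i) (r b j) = (w a b).entry i j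

namespace IsBlockArray

theorem comp_right (h : IsBlockArray F K N w p r) (σ : Equiv.Perm (Fin 4))
    (hσ : mixedLengths ∘ σ = mixedLengths) :
    IsBlockArray F K N (fun a b => w a (σ b)) p (r ∘ σ) where
  left := h.left
  right := hσ ▸ h.right.comp σ.injective
  mem a b := by
    rw [← congrFun hσ b]
    exact h.mem a (σ b)
  entry a b := h.entry a (σ b)

theorem overlap_eq [Fintype X] (h : IsBlockArray F K N w p r) (hcard : Fintype.card X = 18)
    (a a' : Fin 4) (i i' : ℤ) :
    6 * ∑ x, N (p a i) x * N (p a' i') x = BlockCode.overlap (w a) (w a') i i' := by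
  rw [h.right.sum_eq (by rw [hcard]; decide), Finset.mul_sum, BlockCode.overlap, Nat.cast_sum]
  refine Finset.sum_congr rfl fun b _ => ?_
  rw [(h.right.cover b).mul_sum_range (mixedLengths_eq b) fun x => N (p a i) x * N (p a' i') x]
  simp only [h.entry, BlockCode.sum_entry_mul_entry]
  push_cast
  rfl

variable [Fintype Y] [Fintype X]

theorem isBalanced (h : IsBlockArray F K N w p r) (hN : IsWavePair F K N) {a a' : Fin 4}
    (ha : a ≠ a') : BlockCode.IsBalanced (w a) (w a') := fun i i' => by
  have hne (j) : p a j ≠ p a' i'.val := fun heq => ha (h.left.disjoint heq)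
  have hgram := hN.left.gram_cover (h.left.cover a) i.val (p a' i'.val)
  have hoverlap := h.overlap_eq hN.left.card_columns a a' i.val i'.val
  simp only [hgram, hne, if_false] at hoverlap
  simp only [Int.cast_natCast, ZMod.natCast_zmod_val] at hoverlap
  lia

theorem overlap_zero_one (h : IsBlockArray F K N w p r) (hN : IsWavePair F K N) :
    BlockCode.overlap (w 0) (w 0) 0 1 = 6 := by
  have hp : IsCycleCover F 6 (p 0) := h.left.cover 0
  have hgram := hN.left.gram_cover hp 0 (p 0 1)
  have hoverlap := h.overlap_eq hN.left.card_columns 0 0 0 1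
  simp only [hgram, hp.eq_iff] at hoverlap
  norm_num at hoverlap
  exact_mod_cast hoverlap.symm

end IsBlockArray

theorem IsWavePair.exists_isBlockArray [Fintype Y] [Fintype X] (h : IsWavePair F K N)
    (hT : (trianglePoints F).card = 6) (hp : IsCycleFamily F mixedLengths p)
    (hr : IsCycleFamily K mixedLengths r) : ∃ w, IsBlockArray F K N w p r := by
  choose w hmem hentry using fun a b =>
    h.exists_code hT (hp.cover a) (mixedLengths_eq a) (hr.cover b) (mixedLengths_eq b)
  exact ⟨w, hp, hr, hmem, hentry⟩

namespace IsBlockArray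

theorem code_eq (h : IsBlockArray F K N w p r) {a b : Fin 4} {c : BlockCode}
    (hc : c ∈ BlockCode.candidates (mixedLengths a) (mixedLengths b))
    (hN : ∀ i j : ℤ, N (p a i) (r b j) = c.entry i j) : w a b = c :=
  BlockCode.eq_of_entry_eq (h.mem a b) hc fun i j => by
    have := (h.entry a b i.val j.val).symm.trans (hN i.val j.val)
    simpa using this

theorem exists_aligned_right (h : IsBlockArray F K N w p r) (a₀ : Fin 4) :
    ∃ s, IsCycleFamily K mixedLengths s ∧
      ∀ w', IsBlockArray F K N w' p s → ∀ b, (w' a₀ b).IsAligned := by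
  choose s hs hsr c hc haligned hentry using fun b =>
    exists_aligned_columns (h.right.cover b) (h.mem a₀ b) (h.entry a₀ b)
  refine ⟨s, h.right.of_subset Function.injective_id hs hsr, fun w' h' b => ?_⟩
  rw [h'.code_eq (hc b) (hentry b)]
  exact haligned b

theorem exists_aligned_left (h : IsBlockArray F K N w p r) (f : Fin 4 → Fin 4) (a₀ : Fin 4)
    (ha₀ : (w a₀ (f a₀)).IsAligned) :
    ∃ q, IsCycleFamily F mixedLengths q ∧ q a₀ = p a₀ ∧ (∀ a i, ∃ j, q a i = p a j) ∧
      ∀ w', IsBlockArray F K N w' q r → ∀ a, (w' a (f a)).IsAligned := by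
  have hrow (a : Fin 4) : ∃ q, IsCycleCover F (mixedLengths a) q ∧ (∀ i, ∃ i', q i = p a i') ∧
      (∃ c ∈ BlockCode.candidates (mixedLengths a) (mixedLengths (f a)), c.IsAligned ∧
        ∀ i j : ℤ, N (q i) (r (f a) j) = c.entry i j) ∧ (a = a₀ → q = p a₀) := by
    by_cases ha : a = a₀
    · subst ha
      exact ⟨p a, h.left.cover a, fun i => ⟨i, rfl⟩,
        ⟨_, h.mem a (f a), ha₀, h.entry a (f a)⟩, fun _ => rfl⟩
    · obtain ⟨q, hq, hqp, hc⟩ :=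
        exists_aligned_rows (h.left.cover a) (h.mem a (f a)) (h.entry a (f a))
      exact ⟨q, hq, hqp, hc, fun h0 => (ha h0).elim⟩
  choose q hq hqp c hq₀ using hrow
  choose c hc haligned hentry using c
  refine ⟨q, h.left.of_subset Function.injective_id hq hqp, hq₀ a₀ rfl, hqp, fun w' h' a => ?_⟩
  rw [h'.code_eq (hc a) (hentry a)]
  exact haligned a

end IsBlockArray

end BlockArrays

section HexagonArrays

/-- The blocks of the matrix of a wave pair whose graphs both have `6`-cycles. -/
def hexagonCodes : Fin 4 → Fin 4 → BlockCode :=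
  ![![⟨1, 0, 1⟩, ⟨1, 0, 2⟩, ⟨1, 0, 3⟩, ⟨1, 0, 3⟩],
    ![⟨1, 2, 2⟩, ⟨1, 0, 1⟩, ⟨1, 0, 3⟩, ⟨1, 2, 3⟩],
    ![⟨1, 0, 3⟩, ⟨1, 0, 3⟩, ⟨1, 1, 3⟩, ⟨1, 2, 3⟩],
    ![⟨1, 0, 3⟩, ⟨1, 1, 3⟩, ⟨1, 0, 3⟩, ⟨1, 1, 3⟩]]

theorem BlockCode.not_isBalanced_triangleRow :
    ∀ a, a = 2 ∨ a = 3 → ¬ IsBalanced (hexagonCodes a) (hexagonCodes a) := by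
  decide +kernel

theorem hexagonCodes_entry_reverse : ∀ a b, ∀ i j : ZMod 6,
    (hexagonCodes (Equiv.swap 2 3 a) (Equiv.swap 2 3 b)).entry
      (![0, 1, 1, 1] a - i) (![1, 2, 0, 0] b - j) = (hexagonCodes a b).entry i j := by
  decide +kernel

open Classical

variable {Y : Type*} [Fintype Y] {F : SimpleGraph Y} {p : Fin 4 → ℤ → Y}
  {X : Type*} [Fintype X] {K : SimpleGraph X} {N : Matrix Y X ℤ} {r : Fin 4 → ℤ → X}
  {w : Fin 4 → Fin 4 → BlockCode}

theorem IsWavePair.exists_firstRow (h : IsWavePair F K N) (hT : (trianglePoints F).card = 6)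
    (hp : IsCycleFamily F mixedLengths p) (hr : IsCycleFamily K mixedLengths r) :
    ∃ w s, IsBlockArray F K N w p s ∧ w 0 = hexagonCodes 0 := by
  obtain ⟨w₀, h₀⟩ := h.exists_isBlockArray hT hp hr
  obtain ⟨s, hs, haligned⟩ := h₀.exists_aligned_right 0
  obtain ⟨w, hw⟩ := h.exists_isBlockArray hT hp hs
  have hrow : w 0 = ![w 0 0, w 0 1, w 0 2, w 0 3] := (FinVec.etaExpand_eq _).symm
  have hoverlap := hw.overlap_zero_one h
  rw [hrow] at hoverlap
  have ha := haligned w hw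
  obtain ⟨h2, h3, ⟨h0, h1⟩ | ⟨h0, h1⟩⟩ := BlockCode.gap_of_overlap_eq _ (hw.mem 0 0) (ha 0) _
    (hw.mem 0 1) (ha 1) _ (hw.mem 0 2) (ha 2) _ (hw.mem 0 3) (ha 3) hoverlap
  · exact ⟨w, s, hw, by rw [hrow, h0, h1, h2, h3]; rfl⟩
  · refine ⟨_, _, hw.comp_right (Equiv.swap 0 1) (by decide), ?_⟩
    rw [hrow, h0, h1, h2, h3]
    decide

namespace IsBlockArray

theorem exists_secondRow (h : IsBlockArray F K N w p r) (hN : IsWavePair F K N)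
    (h₀ : w 0 = hexagonCodes 0) (h₁ : (w 1 1).IsAligned) (h₂ : (w 2 0).IsAligned)
    (h₃ : (w 3 0).IsAligned) :
    ∃ w' s, IsBlockArray F K N w' p s ∧ w' 0 = hexagonCodes 0 ∧ w' 1 = hexagonCodes 1 ∧
      (w' 2 0).IsAligned ∧ (w' 3 0).IsAligned := by
  have hrow : w 1 = ![w 1 0, w 1 1, w 1 2, w 1 3] := (FinVec.etaExpand_eq _).symm
  have hbalanced := h.isBalanced hN (show (0 : Fin 4) ≠ 1 by decide)
  rw [h₀, hrow] at hbalanced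
  obtain ⟨h10, h11, ⟨h12, h13⟩ | ⟨h12, h13⟩⟩ :=
    BlockCode.hexagonRow_of_isBalanced _ (h.mem 1 1) h₁ _ (h.mem 1 0) _ (h.mem 1 2) _ (h.mem 1 3)
      hbalanced
  · exact ⟨w, r, h, h₀, by rw [hrow, h10, h11, h12, h13]; rfl, h₂, h₃⟩
  · refine ⟨_, _, h.comp_right (Equiv.swap 2 3) (by decide), ?_, ?_, h₂, h₃⟩
    · rw [h₀]
      decide
    · rw [hrow, h10, h11, h12, h13]
      decide

theorem triangleRow_eq (h : IsBlockArray F K N w p r) (hN : IsWavePair F K N)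
    (h₀ : w 0 = hexagonCodes 0) (h₁ : w 1 = hexagonCodes 1) {a : Fin 4} (ha : a = 2 ∨ a = 3)
    (haligned : (w a 0).IsAligned) : w a = hexagonCodes 2 ∨ w a = hexagonCodes 3 := by
  have hrow : w a = ![w a 0, w a 1, w a 2, w a 3] := (FinVec.etaExpand_eq _).symm
  have hbalanced₀ := h.isBalanced hN (show 0 ≠ a by rcases ha with rfl | rfl <;> decide)
  have hbalanced₁ := h.isBalanced hN (show 1 ≠ a by rcases ha with rfl | rfl <;> decide)
  rw [h₀, hrow] at hbalanced₀
  rw [h₁, hrow] at hbalanced₁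
  have hmem (b) : w a b ∈ BlockCode.triangles := by
    rcases ha with rfl | rfl <;> exact h.mem _ b
  obtain ⟨ha0, ⟨ha1, ha2, ha3⟩ | ⟨ha1, ha2, ha3⟩⟩ := BlockCode.triangleRow_of_isBalanced _ (hmem 0)
    haligned _ (hmem 1) _ (hmem 2) _ (hmem 3) hbalanced₀ hbalanced₁
  · exact .inl (by rw [hrow, ha0, ha1, ha2, ha3]; rfl)
  · exact .inr (by rw [hrow, ha0, ha1, ha2, ha3]; rfl)

theorem eq_or_eq_swap (h : IsBlockArray F K N w p r) (hN : IsWavePair F K N)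
    (h₀ : w 0 = hexagonCodes 0) (h₁ : w 1 = hexagonCodes 1) (h₂ : (w 2 0).IsAligned)
    (h₃ : (w 3 0).IsAligned) : w = hexagonCodes ∨ w = hexagonCodes ∘ Equiv.swap 2 3 := by
  have hbalanced := h.isBalanced hN (show (2 : Fin 4) ≠ 3 by decide)
  have hrows : w = ![w 0, w 1, w 2, w 3] := (FinVec.etaExpand_eq _).symm
  rcases h.triangleRow_eq hN h₀ h₁ (.inl rfl) h₂ with hw₂ | hw₂ <;>
    rcases h.triangleRow_eq hN h₀ h₁ (.inr rfl) h₃ with hw₃ | hw₃ <;> rw [hw₂, hw₃] at hbalanced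
  · exact (BlockCode.not_isBalanced_triangleRow 2 (.inl rfl) hbalanced).elim
  · exact .inl (by rw [hrows, h₀, h₁, hw₂, hw₃]; rfl)
  · exact .inr (by rw [hrows, h₀, h₁, hw₂, hw₃]; decide)
  · exact (BlockCode.not_isBalanced_triangleRow 3 (.inr rfl) hbalanced).elim

end IsBlockArray

theorem IsWavePair.exists_hexagon_array (h : IsWavePair F K N) (hT : (trianglePoints F).card = 6)
    (hp : IsCycleFamily F mixedLengths p) (hr : IsCycleFamily K mixedLengths r) :
    ∃ q s, IsCycleFamily F mixedLengths q ∧ IsCycleFamily K mixedLengths s ∧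
      (∀ a i, ∃ j, q a i = p a j) ∧
      ∀ a b (i j : ℤ), N (q a i) (s b j) = (hexagonCodes a b).entry i j := by
  obtain ⟨w₁, r₁, hw₁, hw₁₀⟩ := h.exists_firstRow hT hp hr
  obtain ⟨q, hq, hq₀, hqp, haligned⟩ :=
    hw₁.exists_aligned_left ![0, 1, 0, 0] 0 (by rw [hw₁₀]; decide)
  obtain ⟨w₂, hw₂⟩ := h.exists_isBlockArray hT hq hw₁.right
  have hw₂₀ : w₂ 0 = hexagonCodes 0 := hw₁₀ ▸ funext fun b =>
    hw₂.code_eq (hw₁.mem 0 b) fun i j => by rw [hq₀, hw₁.entry]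
  have ha := haligned w₂ hw₂
  obtain ⟨w, s, hw, h₀, h₁, h₂, h₃⟩ := hw₂.exists_secondRow h hw₂₀ (ha 1) (ha 2) (ha 3)
  rcases hw.eq_or_eq_swap h h₀ h₁ h₂ h₃ with rfl | rfl
  · exact ⟨q, s, hq, hw.right, hqp, hw.entry⟩
  · have hs := hw.right.comp (Equiv.swap (2 : Fin 4) 3).injective
    rw [show mixedLengths ∘ Equiv.swap 2 3 = mixedLengths by decide] at hs
    let c : Fin 4 → ℤ := ![0, 1, 1, 1]
    let d : Fin 4 → ℤ := ![1, 2, 0, 0]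
    have hc (a) : (c a : ZMod 6) = ![0, 1, 1, 1] a := by fin_cases a <;> rfl
    have hd (b) : (d b : ZMod 6) = ![1, 2, 0, 0] b := by fin_cases b <;> rfl
    refine ⟨fun a i => q a (c a - i), fun b j => s (Equiv.swap 2 3 b) (d b - j),
      hq.of_subset Function.injective_id (fun a => (hq.cover a).comp_sub (c a)) fun a i => ⟨_, rfl⟩,
      hs.of_subset Function.injective_id (fun b => (hs.cover b).comp_sub (d b)) fun b j => ⟨_, rfl⟩,
      fun a i => hqp a _, fun a b i j => ?_⟩
    rw [hw.entry, Function.comp_apply, Int.cast_sub, Int.cast_sub, hc, hd]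
    exact hexagonCodes_entry_reverse a b i j

end HexagonArrays

section Reassembly

variable {X Y : Type*}

/-- The disjoint union of cycles of lengths `n a ≥ 3`. -/
def cycleUnion {ι : Type*} (n : ι → ℕ) : SimpleGraph (Σ a, Fin (n a)) where
  Adj u v := u ≠ v ∧ u.1 = v.1 ∧
    ((n u.1 : ℤ) ∣ (v.2 : ℕ) - ((u.2 : ℕ) - 1) ∨ (n u.1 : ℤ) ∣ (v.2 : ℕ) - ((u.2 : ℕ) + 1))
  symm := ⟨by
    rintro ⟨a, i⟩ ⟨b, j⟩ ⟨hne, rfl, hij⟩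
    refine ⟨hne.symm, rfl, hij.symm.imp (fun h => ?_) fun h => ?_⟩ <;>
      exact (dvd_neg.2 h).trans (dvd_of_eq (by ring))⟩
  loopless := ⟨fun _ h => h.1 rfl⟩

instance {ι : Type*} [DecidableEq ι] (n : ι → ℕ) : DecidableRel (cycleUnion n).Adj :=
  fun _ _ => inferInstanceAs (Decidable (_ ∧ _))

/-- The graph consisting of the complement of `K`, the graph `F` and a bipartite graph between them
with adjacency matrix `N`, complemented in the rows of weight `β ≠ 1`. It inverts the decomposition
of a graph into `topGraph`, `lowGraph` and `crossMatrix`. -/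
def joinGraph (K : SimpleGraph X) (F : SimpleGraph Y) (β : Y → ℤ) (N : Matrix Y X ℤ) :
    SimpleGraph (X ⊕ Y) where
  Adj
    | .inl x, .inl x' => Kᶜ.Adj x x'
    | .inr y, .inr y' => F.Adj y y'
    | .inl x, .inr y => N y x = 1 ↔ β y = 1
    | .inr y, .inl x => N y x = 1 ↔ β y = 1
  symm := ⟨by
    rintro (x | y) (x' | y') h
    exacts [Kᶜ.adj_symm h, h, h, F.adj_symm h]⟩
  loopless := ⟨by
    rintro (x | y) h
    exacts [Kᶜ.irrefl h, F.irrefl h]⟩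

instance (K : SimpleGraph X) (F : SimpleGraph Y) (β : Y → ℤ) (N : Matrix Y X ℤ) [DecidableEq X]
    [DecidableRel K.Adj] [DecidableRel F.Adj] :
    DecidableRel (joinGraph K F β N).Adj
  | .inl x, .inl x' => inferInstanceAs (Decidable (Kᶜ.Adj x x'))
  | .inr y, .inr y' => inferInstanceAs (Decidable (F.Adj y y'))
  | .inl x, .inr y => inferInstanceAs (Decidable (N y x = 1 ↔ β y = 1))
  | .inr y, .inl x => inferInstanceAs (Decidable (N y x = 1 ↔ β y = 1))

/-- The weight `1` on the cycles `a ∈ L` and `2` on the others. -/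
def cycleWeight {k : ℕ} (n : Fin k → ℕ) (L : Finset (Fin k)) (y : Σ a, Fin (n a)) : ℤ :=
  if y.1 ∈ L then 1 else 2

/-- The weight of a vertex of an `arrayGraph`. -/
def arrayWeight {k : ℕ} (n : Fin k → ℕ) (L : Finset (Fin k)) :
    (Σ b, Fin (n b)) ⊕ (Σ a, Fin (n a)) → ℤ :=
  Sum.elim (fun _ => 3) (cycleWeight n L)

/-- The graph whose lower and upper parts have cycles of lengths `n a`, with vertices of weight `1`
in the cycles `a ∈ L` of the lower part, and with blocks `B a b`. -/
abbrev arrayGraph {k : ℕ} (n : Fin k → ℕ) (L : Finset (Fin k)) (B : Fin k → Fin k → ℤ → ℤ → ℤ) :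
    SimpleGraph ((Σ b, Fin (n b)) ⊕ Σ a, Fin (n a)) :=
  joinGraph (cycleUnion n) (cycleUnion n) (cycleWeight n L)
    (.of fun y x => B y.1 x.1 (y.2 : ℕ) (x.2 : ℕ))

/-- The graph of the case in which all cycles are triangles. -/
abbrev triangleArrayGraph :=
  arrayGraph (fun _ => 3) {0, 1, 2} fun a b i j => triangleBlock (arrayEntry canonicalWords a b) i j

/-- The graph of the case in which hexagons occur. -/
abbrev hexagonArrayGraph :=
  arrayGraph mixedLengths {0, 2} fun a b i j => (hexagonCodes a b).entry i j

end Reassembly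

section Isomorphisms

open Classical

variable {X X' Y Y' V : Type*} {K : SimpleGraph X} {K' : SimpleGraph X'} {F : SimpleGraph Y}
  {F' : SimpleGraph Y'} {G : SimpleGraph V} {α : V → ℤ}

theorem IsCycleFamily.adj_iff {ι : Type*} {n : ι → ℕ} {p : ι → ℤ → Y} (h : IsCycleFamily F n p)
    (u v : Σ a, Fin (n a)) :
    F.Adj (p u.1 (u.2 : ℕ)) (p v.1 (v.2 : ℕ)) ↔ (cycleUnion n).Adj u v := by
  obtain ⟨a, i⟩ := u
  obtain ⟨b, j⟩ := v
  by_cases hab : a = b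
  · subst hab
    have hne : F.Adj (p a (i : ℕ)) (p a (j : ℕ)) → (⟨a, i⟩ : Σ a, Fin (n a)) ≠ ⟨a, j⟩ := by
      rintro hadj heq
      cases heq
      exact F.irrefl hadj
    simpa only [cycleUnion, true_and, ← (h.cover a).eq_iff, ← (h.cover a).adj_iff,
      iff_and_self] using hne
  · refine iff_of_false (fun hadj => ?_) fun hadj => hab hadj.2.1
    rcases ((h.cover a).adj_iff _ _).1 hadj with heq | heq <;> exact hab (h.disjoint heq).symm

theorem IsCycleFamily.exists_iso [Fintype Y] {ι : Type*} [Fintype ι] {n : ι → ℕ} {p : ι → ℤ → Y}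
    (h : IsCycleFamily F n p) (hcard : ∑ a, n a = Fintype.card Y) :
    ∃ e : cycleUnion n ≃g F, ∀ v, e v = p v.1 (v.2 : ℕ) :=
  ⟨⟨Equiv.ofBijective _ ((Fintype.bijective_iff_injective_and_card _).2
    ⟨h.injective, by simp [hcard]⟩), fun {u v} => h.adj_iff u v⟩, fun _ => rfl⟩

theorem nonempty_joinGraph_iso {β : Y → ℤ} {β' : Y' → ℤ} {N : Matrix Y X ℤ} {N' : Matrix Y' X' ℤ}
    (f : K ≃g K') (e : F ≃g F') (hβ : ∀ y, β' (e y) = β y)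
    (hN : ∀ y x, N' (e y) (f x) = N y x) :
    Nonempty (joinGraph K F β N ≃g joinGraph K' F' β' N') := by
  refine ⟨⟨Equiv.sumCongr f.toEquiv e.toEquiv, ?_⟩⟩
  rintro (x | y) (x' | y')
  all_goals simp [joinGraph, hβ, hN, e.map_adj_iff, f.map_adj_iff]

theorem nonempty_joinGraph_iso_self (G : SimpleGraph V) (α : V → ℤ) :
    Nonempty (joinGraph (topGraph G α) (lowGraph G α) (fun y => α y) (crossMatrix G α) ≃g G) := by
  have hcross (y : {v // α v ≠ 3}) (x : {v // α v = 3}) :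
      (crossMatrix G α y x = 1 ↔ α y = 1) ↔ G.Adj y x := by
    by_cases hy : α y = 1 <;> by_cases hyx : G.Adj y x <;> simp [crossMatrix, hy, hyx]
  refine ⟨⟨Equiv.sumCompl fun v => α v = 3, ?_⟩⟩
  rintro (x | y) (x' | y')
  · have hne (h : G.Adj x x') : x ≠ x' := fun heq => G.irrefl (heq ▸ h : G.Adj x x)
    simp only [joinGraph, topGraph, SimpleGraph.compl_adj, SimpleGraph.comap_adj,
      Equiv.sumCompl_apply_inl, ne_eq, ← Subtype.ext_iff]
    tauto
  · simpa [joinGraph, G.adj_comm x] using (hcross y' x).symm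
  · exact (hcross y x').symm
  · rfl

variable [Fintype V]

theorem IsPerronWeight.nonempty_arrayGraph_iso (h : IsPerronWeight G α) {k : ℕ} {n : Fin k → ℕ}
    {p : Fin k → ℤ → {v // α v ≠ 3}} {r : Fin k → ℤ → {v // α v = 3}} {L : Finset (Fin k)}
    {B : Fin k → Fin k → ℤ → ℤ → ℤ} (hp : IsCycleFamily (lowGraph G α) n p)
    (hr : IsCycleFamily (topGraph G α) n r) (hn : ∑ a, n a = 18)
    (hL : ∀ a i, p a i ∈ lowLevel α 1 ↔ a ∈ L)
    (hB : ∀ a b i j, crossMatrix G α (p a i) (r b j) = B a b i j) :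
    Nonempty (G ≃g arrayGraph n L B) := by
  obtain ⟨e, he⟩ := hp.exists_iso (hn.trans h.card_low.symm)
  obtain ⟨f, hf⟩ := hr.exists_iso (hn.trans h.card_top.symm)
  obtain ⟨φ⟩ := nonempty_joinGraph_iso_self G α
  have hweight (y : Σ a, Fin (n a)) : α (e y) = cycleWeight n L y := by
    have := h.weight_low (e y)
    have hy := hL y.1 (y.2 : ℕ)
    rw [← he, mem_lowLevel] at hy
    unfold cycleWeight
    split_ifs <;> tauto
  have hentry (y : Σ a, Fin (n a)) (x : Σ b, Fin (n b)) : crossMatrix G α (e y) (f x) =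
      Matrix.of (fun y x : Σ a, Fin (n a) => B y.1 x.1 (y.2 : ℕ) (x.2 : ℕ)) y x := by
    rw [he, hf, hB, Matrix.of_apply]
  obtain ⟨ψ⟩ := nonempty_joinGraph_iso (β' := fun y : {v // α v ≠ 3} => α y) f e hweight hentry
  exact ⟨(ψ.trans φ).symm⟩

end Isomorphisms

section Classification

open Classical

variable {V : Type*} [Fintype V] {G : SimpleGraph V} {α : V → ℤ}

namespace IsPerronWeight

theorem nonempty_triangleArrayGraph_iso (h : IsPerronWeight G α)
    (hF : ∀ n p, IsCycleCover (lowGraph G α) n p → n = 3) :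
    Nonempty (G ≃g triangleArrayGraph) := by
  obtain ⟨p, r, hp, hr, hL, hN⟩ := h.isWavePair.exists_triangle_array hF (h.adjClosed_lowLevel 1)
    (h.card_lowLevel (.inl rfl))
  have hmem : ∀ a : Fin 6, a < 3 ↔ a ∈ ({0, 1, 2} : Finset (Fin 6)) := by
    simp only [Finset.mem_insert, Finset.mem_singleton]
    lia
  exact h.nonempty_arrayGraph_iso hp hr (by simp) (fun a i => (hL a i).trans (hmem a)) hN

theorem nonempty_hexagonArrayGraph_iso (h : IsPerronWeight G α)
    (hF : ∀ n p, IsCycleCover (lowGraph G α) n p → n = 3 ∨ n = 6)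
    (hex : ∃ p, IsCycleCover (lowGraph G α) 6 p) : Nonempty (G ≃g hexagonArrayGraph) := by
  have hwave := h.isWavePair
  have hC := h.adjClosed_lowLevel 1
  have hcard := h.card_lowLevel (k := 1) (.inl rfl)
  have hK (m r) (hr : IsCycleCover (topGraph G α) m r) : m = 3 ∨ m = 6 :=
    hwave.length_eq_three_or_six_of_left hF hr
  obtain ⟨p₀, hp₀⟩ := hex
  obtain ⟨r₀, hr₀⟩ := hwave.exists_hexagon_right hK hp₀
  have hT := hwave.card_trianglePoints_left hF hr₀ hC hcard
  obtain ⟨p, hp, hpC⟩ := hwave.exists_mixedFamily_left hF hr₀ hC hcard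
  obtain ⟨r, hr⟩ :=
    hwave.exists_mixedFamily_right hK (hwave.card_trianglePoints_right hK hp₀ hT)
  obtain ⟨q, s, hq, hs, hqp, hN⟩ := hwave.exists_hexagon_array hT hp hr
  refine h.nonempty_arrayGraph_iso hq hs rfl (fun a i => ?_) hN
  obtain ⟨j, hj⟩ := hqp a i
  rw [hj, hpC, Finset.mem_insert, Finset.mem_singleton]

theorem nonempty_arrayGraph_iso_or (h : IsPerronWeight G α) :
    Nonempty (G ≃g triangleArrayGraph) ∨ Nonempty (G ≃g hexagonArrayGraph) := by
  have hF (n p) (hp : IsCycleCover (lowGraph G α) n p) : n = 3 ∨ n = 6 :=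
    h.isWavePair.length_eq_three_or_six (h.adjClosed_lowLevel 1) (h.card_lowLevel (.inl rfl)) hp
  by_cases hex : ∃ p, IsCycleCover (lowGraph G α) 6 p
  · exact .inr (h.nonempty_hexagonArrayGraph_iso hF hex)
  · refine .inl (h.nonempty_triangleArrayGraph_iso fun n p hp => ?_)
    exact (hF n p hp).resolve_right fun hn => hex ⟨p, hn ▸ hp⟩

theorem comp_iso {W : Type*} [Fintype W] {H : SimpleGraph W} (h : IsPerronWeight G α)
    (e : H ≃g G) : IsPerronWeight H (α ∘ e) := by
  have hadj (u v) : H.adjMatrix ℤ u v = G.adjMatrix ℤ (e u) (e v) := by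
    simp only [SimpleGraph.adjMatrix_apply, e.map_adj_iff]
  have hcard (k : ℤ) : {v | (α ∘ e) v = k}.ncard = {v | α v = k}.ncard :=
    Set.ncard_preimage_of_injective_subset_range (s := {v | α v = k}) e.injective
      (by simp [e.surjective.range_eq])
  refine ⟨fun v => h.values (e v), (hcard 3).trans h.card_three, (hcard 2).trans h.card_two,
    (hcard 1).trans h.card_one, fun u v => ?_, fun u => ?_⟩
  · have hquad := h.quad (e u) (e v)
    simp only [Matrix.mul_apply, hadj, ← e.injective.eq_iff] at hquad ⊢
    rwa [← e.toEquiv.sum_comp] at hquad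
  · simp only [hadj, Function.comp_apply]
    exact (e.toEquiv.sum_comp fun w => G.adjMatrix ℤ (e u) w * α w).trans (h.eig (e u))

theorem weight_apply_iso {W : Type*} [Fintype W] {H : SimpleGraph W} {β : W → ℤ}
    (h : IsPerronWeight G α) (hβ : IsPerronWeight H β) (e : G ≃g H) (v : V) : β (e v) = α v := by
  have hα := h.degree_eq v
  have hdegree := hβ.degree_eq (e v)
  rw [e.degree_eq, hα] at hdegree
  have := h.values v
  have := hβ.values (e v)
  exact (sq_eq_sq₀ (by lia) (by lia)).1 (by lia)

theorem hasPrescribedArrayAndSpectrum (h : IsPerronWeight G α) :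
    G.HasPrescribedArrayAndSpectrum :=
  ⟨h.valencyArray_eq, h.adjSpectrum_eq⟩

end IsPerronWeight

end Classification

section ArrayGraphs

theorem isPerronWeight_of_decidable {V : Type*} [Fintype V] [DecidableEq V] {G : SimpleGraph V}
    [DecidableRel G.Adj] {α : V → ℤ} (values : ∀ v, α v = 3 ∨ α v = 2 ∨ α v = 1)
    (card_three : (Finset.univ.filter fun v => α v = 3).card = 18)
    (card_two : (Finset.univ.filter fun v => α v = 2).card = 9)
    (card_one : (Finset.univ.filter fun v => α v = 1).card = 9)
    (quad : ∀ u v, (G.adjMatrix ℤ * G.adjMatrix ℤ) u v + G.adjMatrix ℤ u v =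
      (if u = v then 6 else 0) + 2 * (α u * α v))
    (eig : ∀ u, ∑ w, G.adjMatrix ℤ u w * α w = 20 * α u) : IsPerronWeight G α := by
  refine ⟨values, ?_, ?_, ?_, ?_, ?_⟩
  · simpa [Set.ncard_eq_toFinset_card'] using card_three
  · simpa [Set.ncard_eq_toFinset_card'] using card_two
  · simpa [Set.ncard_eq_toFinset_card'] using card_one
  · convert quad
  · convert eig

theorem isPerronWeight_triangleArrayGraph :
    IsPerronWeight triangleArrayGraph (arrayWeight _ {0, 1, 2}) := by
  apply isPerronWeight_of_decidable <;> decide +kernel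

theorem isPerronWeight_hexagonArrayGraph :
    IsPerronWeight hexagonArrayGraph (arrayWeight _ {0, 2}) := by
  apply isPerronWeight_of_decidable <;> decide +kernel

theorem exists_triangle_of_weight_one : ∀ u, arrayWeight (fun _ => 3) {0, 1, 2} u = 1 →
    ∃ v w, arrayWeight (fun _ => 3) {0, 1, 2} v = 1 ∧ arrayWeight (fun _ => 3) {0, 1, 2} w = 1 ∧
      triangleArrayGraph.Adj u v ∧ triangleArrayGraph.Adj u w ∧ triangleArrayGraph.Adj v w := by
  decide +kernel

theorem exists_forall_not_triangle : ∃ u, arrayWeight mixedLengths {0, 2} u = 1 ∧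
    ∀ v w, arrayWeight mixedLengths {0, 2} v = 1 → arrayWeight mixedLengths {0, 2} w = 1 →
      hexagonArrayGraph.Adj u v → hexagonArrayGraph.Adj u w → ¬ hexagonArrayGraph.Adj v w := by
  decide +kernel

theorem isEmpty_triangleArrayGraph_iso : IsEmpty (triangleArrayGraph ≃g hexagonArrayGraph) := by
  refine ⟨fun e => ?_⟩
  have hweight := isPerronWeight_triangleArrayGraph.weight_apply_iso
    isPerronWeight_hexagonArrayGraph e
  obtain ⟨u', hu', hno⟩ := exists_forall_not_triangle
  obtain ⟨u, rfl⟩ := e.surjective u'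
  obtain ⟨v, w, hv, hw, huv, huw, hvw⟩ := exists_triangle_of_weight_one u (by rw [← hweight, hu'])
  exact hno (e v) (e w) (by rw [hweight, hv]) (by rw [hweight, hw]) (e.map_adj_iff.2 huv)
    (e.map_adj_iff.2 huw) (e.map_adj_iff.2 hvw)

end ArrayGraphs

theorem theorem7p3 :
    ∃ G₁ G₂ : SimpleGraph (Fin 36),
      G₁.HasPrescribedArrayAndSpectrum ∧ G₂.HasPrescribedArrayAndSpectrum ∧
      IsEmpty (G₁ ≃g G₂) ∧
      ∀ (V : Type*) [Fintype V] (G : SimpleGraph V), G.HasPrescribedArrayAndSpectrum →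
        Nonempty (G ≃g G₁) ∨ Nonempty (G ≃g G₂) := by
  let e₁ := triangleArrayGraph.overFinIso isPerronWeight_triangleArrayGraph.card_eq
  let e₂ := hexagonArrayGraph.overFinIso isPerronWeight_hexagonArrayGraph.card_eq
  refine ⟨_, _, (isPerronWeight_triangleArrayGraph.comp_iso e₁.symm).hasPrescribedArrayAndSpectrum,
    (isPerronWeight_hexagonArrayGraph.comp_iso e₂.symm).hasPrescribedArrayAndSpectrum,
    ⟨fun e => isEmpty_triangleArrayGraph_iso.elim ((e₁.trans e).trans e₂.symm)⟩, fun V _ G hG => ?_⟩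
  obtain ⟨α, hα⟩ := exists_isPerronWeight hG
  exact hα.nonempty_arrayGraph_iso_or.imp (fun ⟨e⟩ => ⟨e.trans e₁⟩) fun ⟨e⟩ => ⟨e.trans e₂⟩
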